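/- Let $h$ be the round metric on the unit sphere $\mathbb{S}^3\subset\mathbb{R}^4$ and let $\delta$ be the Euclidean metric on $\mathbb{R}^3$. Finite energy initial data for the Maxwell-scalar field system on the Einstein cylinder $\mathbb{R}\times\mathbb{S}^3$ are a set $(\mathbf{E}_0,\mathbf{B}_0,U,\phi_0)$, $U=(U_0,\mathbf{U})$, of $L^2(\mathbb{S}^3)$ fields ($\mathbf{E}_0,\mathbf{B}_0$ real and $\mathbf{U}$ complex covector fields, $U_0,\phi_0$ complex functions) such that $\nabla\cdot\mathbf{E}_0=-\operatorname{Im}(\bar\phi_0U_0)$ and $\nabla\cdot\mathbf{B}_0=0$ in the sense of distributions. Here $U$ stands for the initial gauge covariant derivative of the scalar field. Finite energy initial data on Minkowski space are sets $(\tilde{\mathbf{E}}_0,\tilde{\mathbf{B}}_0,\tilde U,\tilde\phi_0)$ of $L^2(\mathbb{R}^3)$ fields satisfying the same constraints $\nabla\cdot\tilde{\mathbf{E}}_0=-\operatorname{Im}(\bar{\tilde\phi}_0\tilde U_0)$, $\nabla\cdot\tilde{\mathbf{B}}_0=0$ on $\mathbb{R}^3$ in the sense of distributions. Let $r=|x|$,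 $r_+^2=\tfrac12(1+r^2)$, and let $\sigma:\mathbb{R}^3\to\mathbb{S}^3$, $\sigma(x)=\left(\frac{1-r^2}{1+r^2},\frac{2x}{1+r^2}\right)$, be the restriction to $\{t=0\}$ of the conformal embedding of Minkowski space in the cylinder, so that $\sigma^*h=r_+^{-4}\delta$. Pulling fields back by $\sigma$, a set of finite energy data on the cylinder induces on $\mathbb{R}^3$ the data $$(\tilde{\mathbf{E}}_0,\tilde{\mathbf{B}}_0,\tilde\phi_1,\tilde{\mathbf{U}},\tilde\phi_0)=\left(r_+^{-2}\mathbf{E}_0,\;r_+^{-2}\mathbf{B}_0,\;r_+^{-4}U_0,\;r_+^{-2}\mathbf{U}-r_+^{-4}\phi_0\,x,\;r_+^{-2}\phi_0\right).$$ **Lemma.** Let $(\mathbf{E}_0,\mathbf{B}_0,U,\phi_0)$ be finite energy initial data on the Einstein cylinder and let $R>0$. There are functions $\xi\in C^\infty(\mathbb{R}^3)$ with $\xi>0$, $\xi=1$ for $r\le R$ and $\xi=r_+$ for $r\ge 2R$. For every such $\xi$ put $$\tilde\psi_0=\xi^{-1}\tilde\phi_0,\qquad \tilde\psi_1=\xi\,\tilde\phi_1,\qquad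 \tilde{\mathbf{V}}=\xi^{-1}\tilde{\mathbf{U}}-\xi^{-2}(\nabla\xi)\,\tilde\phi_0 .$$ Then: 1. $(\tilde{\mathbf{E}}_0,\tilde{\mathbf{B}}_0,\tilde\psi_1,\tilde{\mathbf{V}},\tilde\psi_0)$ are finite energy initial data on Minkowski space: $\tilde{\mathbf{E}}_0,\tilde{\mathbf{B}}_0,\tilde\psi_1,\tilde{\mathbf{V}},\tilde\psi_0\in L^2(\mathbb{R}^3)$, and $\nabla\cdot\tilde{\mathbf{E}}_0=-\operatorname{Im}(\bar{\tilde\psi}_0\tilde\psi_1)$, $\nabla\cdot\tilde{\mathbf{B}}_0=0$ in the sense of distributions. 2. They coincide with the induced data $(\tilde{\mathbf{E}}_0,\tilde{\mathbf{B}}_0,\tilde\phi_1,\tilde{\mathbf{U}},\tilde\phi_0)$ on the ball $B_R=\{r\le R\}$. 3. If $\mathbf{a}\in L^2(\mathbb{S}^3)$ is an initial Maxwell potential for the data, that is, a real covector field with $\nabla\times\mathbf{a}=\mathbf{B}_0$ and $\mathbf{U}=\nabla\phi_0+i\mathbf{a}\phi_0$ in the sense of distributions on $\mathbb{S}^3$,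 and $\tilde{\mathbf{a}}=\sigma^*\mathbf{a}$, then $\nabla\times\tilde{\mathbf{a}}=\tilde{\mathbf{B}}_0$ and $\tilde{\mathbf{V}}=\nabla\tilde\psi_0+i\tilde{\mathbf{a}}\tilde\psi_0$ in the sense of distributions on $\mathbb{R}^3$. If moreover $\nabla\cdot\tilde{\mathbf{a}}=0$ (the residual Lorenz gauge freedom having been used to make $\tilde A_0=\partial_t\tilde A_0=0$ at $t=0$), then $\tilde\psi_0\in H^1(\mathbb{R}^3)$. -/

import Mathlib

open MeasureTheory
open scoped ContDiff SchwartzMap ENNReal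

noncomputable section

namespace MSF

/-! ### Spaces -/

abbrev R3 := EuclideanSpace ℝ (Fin 3)
abbrev R4 := EuclideanSpace ℝ (Fin 4)
abbrev C3 := EuclideanSpace ℂ (Fin 3)
abbrev C4 := EuclideanSpace ℂ (Fin 4)

/-- The round unit three-sphere in `ℝ⁴`. -/
abbrev S3 := Metric.sphere (0 : R4) 1

/-- The Riemannian (surface) measure of the round three-sphere. -/
def dvolS3 : Measure S3 := (volume : Measure R4).toSphere

/-- Standard basis vectors. -/
def stdVec {n : ℕ} (i : Fin n) : EuclideanSpace ℝ (Fin n) := EuclideanSpace.single i 1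

/-! ### Weak differential operators on the three-sphere

Every smooth function (vector field) on the sphere is the restriction of a smooth function (vector
field) on `ℝ⁴`, so test functions and test fields are taken on `ℝ⁴`. Tangent vectors and covectors
of the sphere are identified by the round metric and written as vectors of `ℝ⁴` (for complex ones,
of `ℂ⁴`) orthogonal to the position vector. -/

def IsTangent (a : S3 → R4) : Prop := ∀ x : S3, inner ℝ (x : R4) (a x) = 0

def IsTangentC (U : S3 → C4) : Prop := ∀ x : S3, ∑ k, ((x : R4) k : ℂ) * U x k = 0

/-- `∇ · E = ρ` on the sphere, in the sense of distributions. -/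
def HasWeakDivS3 (E : S3 → R4) (ρ : S3 → ℝ) : Prop :=
  ∀ η : R4 → ℝ, ContDiff ℝ ∞ η →
    ∫ x, fderiv ℝ η (x : R4) (E x) ∂dvolS3 = - ∫ x, ρ x * η (x : R4) ∂dvolS3

/-- The intrinsic divergence at `x ∈ S³` of a vector field tangent to the sphere: the trace of the
derivative over the tangent space. -/
def divS3 (w : R4 → R4) (x : R4) : ℝ :=
  (∑ i, fderiv ℝ w x (stdVec i) i) - inner ℝ x (fderiv ℝ w x x)

/-- The Levi-Civita symbol with four indices. -/
def leviCivita4 (i j k l : Fin 4) : ℝ :=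
  ((1 : Matrix (Fin 4) (Fin 4) ℝ).submatrix ![i, j, k, l] id).det

/-- The intrinsic curl `⋆ d w` on the sphere (for the orientation which makes the stereographic
parametrization `stereo` below orientation preserving) of the tangential part of `w`. -/
def curlS3 (w : R4 → R4) (x : R4) : R4 :=
  WithLp.toLp 2 fun i =>
    ∑ j, ∑ k, ∑ l, leviCivita4 j i k l * x j * fderiv ℝ w x (stdVec k) l

/-- `∇ × a = B` on the sphere, in the sense of distributions. -/
def HasWeakCurlS3 (a B : S3 → R4) : Prop :=
  ∀ w : R4 → R4, ContDiff ℝ ∞ w →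
    ∫ x, inner ℝ (a x) (curlS3 w (x : R4)) ∂dvolS3 = ∫ x, inner ℝ (B x) (w (x : R4)) ∂dvolS3

/-- `∇ φ = G` on the sphere, in the sense of distributions (`G` tangent). -/
def HasWeakGradS3 (φ : S3 → ℂ) (G : S3 → C4) : Prop :=
  ∀ w : R4 → R4, ContDiff ℝ ∞ w → (∀ x : S3, inner ℝ (x : R4) (w (x : R4)) = 0) →
    ∫ x, φ x * (divS3 w (x : R4) : ℂ) ∂dvolS3
      = - ∫ x, (∑ k, G x k * (w (x : R4) k : ℂ)) ∂dvolS3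

/-! ### Weak differential operators on Euclidean space -/

/-- `∇ · E = ρ` on `ℝ³`, in the sense of distributions. -/
def HasWeakDivR3 (E : R3 → R3) (ρ : R3 → ℝ) : Prop :=
  ∀ η : R3 → ℝ, ContDiff ℝ ∞ η → HasCompactSupport η →
    ∫ x, fderiv ℝ η x (E x) = - ∫ x, ρ x * η x

/-- Classical divergence of a smooth vector field. -/
def divR3 (w : R3 → R3) (x : R3) : ℝ := ∑ i, fderiv ℝ w x (stdVec i) i

/-- Classical curl of a smooth vector field. -/
def curlR3 (w : R3 → R3) (x : R3) : R3 :=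
  !₂[fderiv ℝ w x (stdVec 1) 2 - fderiv ℝ w x (stdVec 2) 1,
     fderiv ℝ w x (stdVec 2) 0 - fderiv ℝ w x (stdVec 0) 2,
     fderiv ℝ w x (stdVec 0) 1 - fderiv ℝ w x (stdVec 1) 0]

/-- `∇ × a = B` on `ℝ³`, in the sense of distributions. -/
def HasWeakCurlR3 (a B : R3 → R3) : Prop :=
  ∀ w : R3 → R3, ContDiff ℝ ∞ w → HasCompactSupport w →
    ∫ x, inner ℝ (a x) (curlR3 w x) = ∫ x, inner ℝ (B x) (w x)

/-- `∇ φ = G` on `ℝ³`, in the sense of distributions. -/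
def HasWeakGradR3 (φ : R3 → ℂ) (G : R3 → C3) : Prop :=
  ∀ w : R3 → R3, ContDiff ℝ ∞ w → HasCompactSupport w →
    ∫ x, φ x * (divR3 w x : ℂ) = - ∫ x, (∑ k, G x k * (w x k : ℂ))

/-- `f ∈ H¹(ℝ³)`, for a function `f`. -/
def MemH1 (f : R3 → ℂ) : Prop :=
  ∃ h : MemLp f 2 (volume : Measure R3),
    TemperedDistribution.MemSobolev 1 2 (h.toLp f : 𝓢'(R3, ℂ))

/-! ### Initial data -/

/-- A candidate set `(𝐄₀, 𝐁₀, U, φ₀)`, `U = (U₀, 𝐔)`, of initial data on `{τ = 0} = S³` in the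
Einstein cylinder. `U₀` and `𝐔` are the initial values of `D₀φ` and of the spatial part of `Dφ`. -/
structure CylinderData where
  E : S3 → R4
  B : S3 → R4
  U0 : S3 → ℂ
  U : S3 → C4
  φ : S3 → ℂ

/-- Finite energy initial data for the Maxwell-scalar field system on the Einstein cylinder. -/
structure CylinderData.IsFiniteEnergy (D : CylinderData) : Prop where
  tangent_E : IsTangent D.E
  tangent_B : IsTangent D.B
  tangent_U : IsTangentC D.U
  memLp_E : MemLp D.E 2 dvolS3
  memLp_B : MemLp D.B 2 dvolS3
  memLp_U0 : MemLp D.U0 2 dvolS3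
  memLp_U : MemLp D.U 2 dvolS3
  memLp_φ : MemLp D.φ 2 dvolS3
  div_E : HasWeakDivS3 D.E (fun x => - (star (D.φ x) * D.U0 x).im)
  div_B : HasWeakDivS3 D.B (fun _ => 0)

/-- `a` is a (spatial) initial Maxwell potential for the data: `𝐁₀ = ∇ × a` and
`𝐔 = ∇ φ₀ + i a φ₀` on the sphere, in the sense of distributions. -/
structure CylinderData.IsPotential (D : CylinderData) (a : S3 → R4) : Prop where
  tangent : IsTangent a
  memLp : MemLp a 2 dvolS3
  curl_eq : HasWeakCurlS3 a D.B
  cov_grad : HasWeakGradS3 D.φ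
    (fun x => WithLp.toLp 2 fun k => D.U x k - Complex.I * (a x k : ℂ) * D.φ x)

/-- A candidate set of initial data on `{t = 0} = ℝ³` in Minkowski space. -/
structure MinkowskiData where
  E : R3 → R3
  B : R3 → R3
  U0 : R3 → ℂ
  U : R3 → C3
  φ : R3 → ℂ

/-- Finite energy initial data for the Maxwell-scalar field system on Minkowski space. -/
structure MinkowskiData.IsFiniteEnergy (D : MinkowskiData) : Prop where
  memLp_E : MemLp D.E 2 volume
  memLp_B : MemLp D.B 2 volume
  memLp_U0 : MemLp D.U0 2 volume
  memLp_U : MemLp D.U 2 volume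
  memLp_φ : MemLp D.φ 2 volume
  div_E : HasWeakDivR3 D.E (fun x => - (star (D.φ x) * D.U0 x).im)
  div_B : HasWeakDivR3 D.B (fun _ => 0)

/-- `𝐔 = ∇ φ + i a φ` on `ℝ³`, in the sense of distributions. -/
def MinkowskiData.HasPotential (D : MinkowskiData) (a : R3 → R3) : Prop :=
  HasWeakGradR3 D.φ
    (fun x => WithLp.toLp 2 fun k => D.U x k - Complex.I * (a x k : ℂ) * D.φ x)

/-! ### The conformal embedding at time zero -/

/-- `r₊ = ((1 + r²) / 2)^{1/2}`; the conformal factor at `t = 0` is `Ω = r₊⁻²`. -/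
def rPlus (x : R3) : ℝ := Real.sqrt ((1 + ‖x‖ ^ 2) / 2)

/-- The restriction to `{t = 0}` of the conformal embedding of Minkowski space in the cylinder, as a
map into `ℝ⁴`. With `ζ = 2 arctan r` it sends `r ω`, `|ω| = 1`, to `(cos ζ, (sin ζ) ω)`. -/
def stereoMap (x : R3) : R4 :=
  !₂[(1 - ‖x‖ ^ 2) / (1 + ‖x‖ ^ 2), 2 * x 0 / (1 + ‖x‖ ^ 2), 2 * x 1 / (1 + ‖x‖ ^ 2),
     2 * x 2 / (1 + ‖x‖ ^ 2)]

theorem stereoMap_mem (x : R3) : stereoMap x ∈ Metric.sphere (0 : R4) 1 := by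
  have h : ‖x‖ ^ 2 = x 0 ^ 2 + x 1 ^ 2 + x 2 ^ 2 := by
    simp [EuclideanSpace.norm_sq_eq, Fin.sum_univ_three]
  have hp : (1 + ‖x‖ ^ 2) ≠ 0 := by positivity
  rw [mem_sphere_zero_iff_norm, ← sq_eq_sq₀ (norm_nonneg _) zero_le_one,
    EuclideanSpace.norm_sq_eq, Fin.sum_univ_four]
  simp only [stereoMap, Real.norm_eq_abs, sq_abs]
  simp
  field_simp
  rw [h]
  ring

/-- The embedding `ℝ³ → S³` at time zero. -/
def stereo (x : R3) : S3 := ⟨stereoMap x, stereoMap_mem x⟩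

/-- Pull-back to `ℝ³` of a real covector field on the sphere. -/
def pull (a : S3 → R4) (x : R3) : R3 :=
  WithLp.toLp 2 fun i => inner ℝ (a (stereo x)) (fderiv ℝ stereoMap x (stdVec i))

/-- Pull-back to `ℝ³` of a complex covector field on the sphere. -/
def pullC (U : S3 → C4) (x : R3) : C3 :=
  WithLp.toLp 2 fun i => ∑ k, U (stereo x) k * (fderiv ℝ stereoMap x (stdVec i) k : ℂ)

/-- The conformally induced data
`(r₊⁻² 𝐄₀, r₊⁻² 𝐁₀, r₊⁻⁴ U₀, r₊⁻² 𝐔 - r₊⁻⁴ φ₀ r 𝐞_r, r₊⁻² φ₀)`, where `r 𝐞_r = x`. -/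
def CylinderData.induced (D : CylinderData) : MinkowskiData where
  E x := (rPlus x ^ 2)⁻¹ • pull D.E x
  B x := (rPlus x ^ 2)⁻¹ • pull D.B x
  U0 x := ((rPlus x ^ 4)⁻¹ : ℝ) * D.U0 (stereo x)
  U x := WithLp.toLp 2 fun i =>
    ((rPlus x ^ 2)⁻¹ : ℝ) * pullC D.U x i - ((rPlus x ^ 4)⁻¹ : ℝ) * D.φ (stereo x) * (x i : ℂ)
  φ x := ((rPlus x ^ 2)⁻¹ : ℝ) * D.φ (stereo x)

/-! ### The modification outside a ball -/

/-- `ξ` is smooth and positive, `ξ = 1` for `r ≤ R` and `ξ = r₊` for `r ≥ 2R`. -/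
structure IsModifier (R : ℝ) (ξ : R3 → ℝ) : Prop where
  smooth : ContDiff ℝ ∞ ξ
  pos : ∀ x, 0 < ξ x
  eq_one : ∀ x, ‖x‖ ≤ R → ξ x = 1
  eq_rPlus : ∀ x, 2 * R ≤ ‖x‖ → ξ x = rPlus x

/-- The modification `φ ↦ φ / ξ`, `U₀ ↦ ξ U₀`, `𝐔 ↦ ξ⁻¹ 𝐔 - ξ⁻² (∇ ξ) φ`; the electric and the
magnetic field are unchanged. -/
def MinkowskiData.modify (D : MinkowskiData) (ξ : R3 → ℝ) : MinkowskiData where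
  E := D.E
  B := D.B
  U0 x := (ξ x : ℂ) * D.U0 x
  U x := WithLp.toLp 2 fun i =>
    ((ξ x)⁻¹ : ℝ) * D.U x i - ((ξ x ^ 2)⁻¹ : ℝ) * (fderiv ℝ ξ x (stdVec i) : ℂ) * D.φ x
  φ x := D.φ x / (ξ x : ℂ)

end MSF

end

/-!
Write `lam = r₊⁻² = 2 / (1 + r²)`. The stereographic parametrization `σ` is conformal,
`σ^* h = lam² δ`, and misses one point of the sphere, so integrals over the sphere are integrals
over `ℝ³` with density `lam³` (`integral_dvolS3`). All the weights in the induced data come from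
this.

*Constraints and potentials.* A compactly supported test function or field on `ℝ³` extends by zero
to a smooth one on the sphere (`exists_smooth_extension`). With the powers of `lam` put on the test
fields, the powers from the volume cancel those from the metric, and the weak divergence, curl and
gradient on the sphere become the flat ones (`HasWeakDivS3.pull`, `HasWeakCurlS3.pull`,
`HasWeakGradS3.pull`). The charge density `Im(φ̄₀ U₀)` is unchanged by the modification because `ξ`
cancels. The modified scalar field is the pulled-back one times `lam / ξ`, so its covariant gradient
is given by the Leibniz rule (`hasPotential_modify`).

*Square integrability.* A pulled-back covector field costs a factor `lam`, and `L²` of the sphere is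
`L²` with weight `lam³`. Since `ξ` is comparable with `r₊` and has bounded gradient
(`IsModifier.bounds`), every modified field is dominated by `lam^{3/2}` times an `L²` field of the
sphere (`isFiniteEnergy_modify`).

*The `H¹` bound.* The pulled-back potential `a` satisfies `lam^{1/2} a ∈ L²`, its curl is in `L²`,
and it is divergence free. The gradient of a cut-off function at radius `n` is `O(lam^{1/2})`, uniformly
in `n`, so curl and divergence of `χₙ a` are bounded in `L²`. For compactly supported fields
`∫ |∇u|² = ∫ |∇ × u|² + ∫ (∇ · u)²`, and the Sobolev inequality gives `a ∈ L⁶`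
(`memLp_six_of_curl`). Now `∇ψ = V - i a ψ` with `ψ, V ∈ L²`. Applied to `χₙ ψ`, the Sobolev
inequality and the interpolation `‖f‖₃² ≤ ‖f‖₂ ‖f‖₆` give `‖χₙ ψ‖₃² ≤ P + Q ‖χₙ ψ‖₃` with `P`, `Q`
independent of `n`. So `ψ ∈ L³`, whence `a ψ ∈ L²` by Hölder, and `∇ψ ∈ L²`
(`HasWeakGradR3.memLp_two`). A function in `L²` with weak gradient in `L²` is in the
Fourier-analytic `H¹` (`HasWeakGradR3.memH1`).
-/

noncomputable section

namespace MSF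

/-! ### Geometry of the stereographic parametrization -/

/-- The conformal factor `r₊⁻² = 2 / (1 + r²)`: the pull-back of the round metric by `stereo` is
`lam² δ`. -/
def lam (x : R3) : ℝ := 2 / (1 + ‖x‖ ^ 2)

/-- The embedding of `ℝ³` into `ℝ⁴` as the last three coordinates. -/
def emb : R3 →L[ℝ] R4 :=
  LinearMap.toContinuousLinearMap
    { toFun := fun x => !₂[0, x 0, x 1, x 2]
      map_add' := fun x y => by ext k; fin_cases k <;> simp
      map_smul' := fun c x => by ext k; fin_cases k <;> simp }

@[simp] theorem emb_apply_zero (x : R3) : emb x 0 = 0 := rfl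
@[simp] theorem emb_apply_one (x : R3) : emb x 1 = x 0 := rfl
@[simp] theorem emb_apply_two (x : R3) : emb x 2 = x 1 := rfl
@[simp] theorem emb_apply_three (x : R3) : emb x 3 = x 2 := rfl

@[simp] theorem stdVec_apply {n : ℕ} (i j : Fin n) :
    (stdVec i : EuclideanSpace ℝ (Fin n)) j = if j = i then 1 else 0 := by
  simp [stdVec]

theorem inner_stdVec {n : ℕ} (x : EuclideanSpace ℝ (Fin n)) (i : Fin n) :
    inner ℝ x (stdVec i) = x i := by
  simp [stdVec, EuclideanSpace.inner_single_right]

theorem norm_sq_R3 (x : R3) : ‖x‖ ^ 2 = x 0 ^ 2 + x 1 ^ 2 + x 2 ^ 2 := by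
  simp [EuclideanSpace.norm_sq_eq, Fin.sum_univ_three]

theorem inner_R3 (x y : R3) : inner ℝ x y = x 0 * y 0 + x 1 * y 1 + x 2 * y 2 := by
  simp [PiLp.inner_apply, Fin.sum_univ_three, mul_comm]

theorem inner_R4 (x y : R4) :
    inner ℝ x y = x 0 * y 0 + x 1 * y 1 + x 2 * y 2 + x 3 * y 3 := by
  simp [PiLp.inner_apply, Fin.sum_univ_four, mul_comm]

theorem lam_pos (x : R3) : 0 < lam x := by unfold lam; positivity

theorem lam_ne_zero (x : R3) : lam x ≠ 0 := (lam_pos x).ne'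

theorem lam_le_two (x : R3) : lam x ≤ 2 := by
  unfold lam
  rw [div_le_iff₀ (by positivity)]
  nlinarith [sq_nonneg ‖x‖]

theorem lam_mul (x : R3) : lam x * (1 + ‖x‖ ^ 2) = 2 := by
  unfold lam; field_simp

theorem lam_coord (x : R3) : lam x = 2 / (1 + (x 0 ^ 2 + x 1 ^ 2 + x 2 ^ 2)) := by
  rw [lam, norm_sq_R3]

theorem lam_mul_norm_sq_le (x : R3) : lam x * ‖x‖ ^ 2 ≤ 2 := by
  nlinarith [lam_mul x, lam_pos x]

theorem contDiff_lam : ContDiff ℝ ∞ lam := by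
  unfold lam
  refine contDiff_const.div (contDiff_const.add (contDiff_norm_sq ℝ)) fun x => ?_
  positivity

theorem hasFDerivAt_lam (x : R3) :
    HasFDerivAt lam (-(lam x ^ 2) • innerSL ℝ x) x := by
  have h1 : HasFDerivAt (fun y : R3 => ‖y‖ ^ 2) (2 • innerSL ℝ x) x :=
    (hasStrictFDerivAt_norm_sq x).hasFDerivAt
  have h2 := ((hasDerivAt_inv (by positivity : (1 + ‖x‖ ^ 2) ≠ 0)).comp_hasFDerivAt x
    (h1.const_add 1)).const_mul 2
  have h3 : lam = fun y : R3 => 2 * (1 + ‖y‖ ^ 2)⁻¹ := by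
    ext y; simp [lam, div_eq_mul_inv]
  rw [h3]
  refine h2.congr_fderiv ?_
  ext v
  simp
  field_simp

theorem rPlus_sq (x : R3) : (rPlus x) ^ 2 = (lam x)⁻¹ := by
  rw [rPlus, Real.sq_sqrt (by positivity), lam, inv_div]

theorem rPlus_pos (x : R3) : 0 < rPlus x := Real.sqrt_pos.2 (by positivity)

theorem inv_rPlus_sq (x : R3) : ((rPlus x) ^ 2)⁻¹ = lam x := by rw [rPlus_sq, inv_inv]

theorem inv_rPlus_pow_four (x : R3) : ((rPlus x) ^ 4)⁻¹ = lam x ^ 2 := by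
  rw [show (rPlus x) ^ 4 = ((rPlus x) ^ 2) ^ 2 by ring, rPlus_sq, inv_pow, inv_inv]

theorem stereoMap_eq (x : R3) :
    stereoMap x = lam x • (stdVec 0 + emb x) - stdVec 0 := by
  have : (1 + ‖x‖ ^ 2) ≠ 0 := by positivity
  ext k
  fin_cases k <;> simp [stereoMap, lam] <;> field_simp
  ring

theorem contDiff_stereoMap : ContDiff ℝ ∞ stereoMap := by
  have : stereoMap = fun x => lam x • (stdVec 0 + emb x) - stdVec 0 := funext stereoMap_eq
  rw [this]
  exact (contDiff_lam.smul (contDiff_const.add emb.contDiff)).sub contDiff_const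

theorem fderiv_stereoMap (x v : R3) :
    fderiv ℝ stereoMap x v =
      -(lam x ^ 2 * inner ℝ x v) • (stdVec 0 + emb x) + lam x • emb v := by
  have : stereoMap = fun x => lam x • (stdVec 0 + emb x) - stdVec 0 := funext stereoMap_eq
  rw [this]
  have h := ((hasFDerivAt_lam x).fun_smul
    ((emb.hasFDerivAt (x := x)).const_add (stdVec 0))).sub_const (stdVec 0)
  rw [h.fderiv]
  simp [add_comm]

theorem hasFDerivAt_stereoMap (x : R3) :
    HasFDerivAt stereoMap (fderiv ℝ stereoMap x) x :=
  (contDiff_stereoMap.differentiable (by simp)).differentiableAt.hasFDerivAt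

/-- The coordinate vector field `∂ᵢσ` on the sphere, along the parametrization. -/
def dsig (i : Fin 3) (x : R3) : R4 := fderiv ℝ stereoMap x (stdVec i)

theorem contDiff_dsig (i : Fin 3) : ContDiff ℝ ∞ (dsig i) :=
  (contDiff_stereoMap.fderiv_right (by simp)).clm_apply contDiff_const

theorem dsig_eq (i : Fin 3) (x : R3) :
    dsig i x = -(lam x ^ 2 * x i) • (stdVec 0 + emb x) + lam x • emb (stdVec i) := by
  rw [dsig, fderiv_stereoMap, inner_stdVec]

theorem inner_stereoMap_dsig (i : Fin 3) (x : R3) : inner ℝ (stereoMap x) (dsig i x) = 0 := by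
  rw [stereoMap_eq, dsig_eq, inner_R4]
  fin_cases i <;> simp [lam_coord] <;> field_simp <;> ring

theorem inner_dsig_dsig (i j : Fin 3) (x : R3) :
    inner ℝ (dsig i x) (dsig j x) = if i = j then lam x ^ 2 else 0 := by
  rw [dsig_eq, dsig_eq, inner_R4]
  fin_cases i <;> fin_cases j <;> simp [lam_coord] <;> field_simp <;> ring

/-- `σ` and the `∂ᵢσ / lam` form an orthonormal basis of `ℝ⁴`. -/
theorem frame_expansion (x : R3) (v : R4) :
    lam x ^ 2 • v = (lam x ^ 2 * inner ℝ v (stereoMap x)) • stereoMap x +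
      ∑ i, (inner ℝ v (dsig i x)) • dsig i x := by
  ext k
  simp only [Fin.sum_univ_three, inner_R4, stereoMap_eq, dsig_eq]
  fin_cases k <;> simp [lam_coord] <;> field_simp <;> ring

/-! ### The surface measure in the stereographic parametrization -/

/-- The last three coordinates of a vector of `ℝ⁴`. -/
def tl : R4 →L[ℝ] R3 :=
  LinearMap.toContinuousLinearMap
    { toFun := fun y => !₂[y 1, y 2, y 3]
      map_add' := fun x y => by ext k; fin_cases k <;> simp
      map_smul' := fun c x => by ext k; fin_cases k <;> simp }

@[simp] theorem tl_apply_zero (y : R4) : tl y 0 = y 1 := rfl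
@[simp] theorem tl_apply_one (y : R4) : tl y 1 = y 2 := rfl
@[simp] theorem tl_apply_two (y : R4) : tl y 2 = y 3 := rfl

/-- The inverse of the parametrization, `y ↦ y' / (1 + y₀)`. -/
def stereoInv (y : R4) : R3 := (1 + y 0)⁻¹ • tl y

theorem stereoMap_zero_add_one (x : R3) : 1 + stereoMap x 0 = lam x := by
  rw [stereoMap_eq]; simp

theorem tl_stereoMap (x : R3) : tl (stereoMap x) = lam x • x := by
  rw [stereoMap_eq]
  ext k
  fin_cases k <;> simp

theorem stereoInv_stereoMap (x : R3) : stereoInv (stereoMap x) = x := by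
  rw [stereoInv, stereoMap_zero_add_one, tl_stereoMap, inv_smul_smul₀ (lam_ne_zero x)]

theorem stereoMap_injective : Function.Injective stereoMap :=
  Function.LeftInverse.injective stereoInv_stereoMap

theorem continuous_stereo : Continuous stereo :=
  contDiff_stereoMap.continuous.subtype_mk _

theorem stereo_injective : Function.Injective stereo := fun _ _ h =>
  stereoMap_injective (congrArg Subtype.val h)

theorem measurableEmbedding_stereo : MeasurableEmbedding stereo :=
  continuous_stereo.measurableEmbedding stereo_injective

theorem norm_stereoMap (x : R3) : ‖stereoMap x‖ = 1 :=
  mem_sphere_zero_iff_norm.1 (stereoMap_mem x)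

/-- The parametrization only misses the pole `-e₀`. -/
theorem stereoMap_stereoInv {y : R4} (hy : ‖y‖ = 1) (h0 : y 0 ≠ -1) :
    stereoMap (stereoInv y) = y := by
  have h1 : y 0 ^ 2 + y 1 ^ 2 + y 2 ^ 2 + y 3 ^ 2 = 1 := by
    have := EuclideanSpace.norm_sq_eq y
    rw [hy, Fin.sum_univ_four] at this
    simpa using this.symm
  have h2 : 1 + y 0 ≠ 0 := fun h => h0 (by linarith)
  have h3 : lam (stereoInv y) = 1 + y 0 := by
    rw [lam_coord]
    simp only [stereoInv, PiLp.smul_apply, tl_apply_zero, tl_apply_one, tl_apply_two, smul_eq_mul]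
    have h4 : 1 + (((1 + y 0)⁻¹ * y 1) ^ 2 + ((1 + y 0)⁻¹ * y 2) ^ 2 + ((1 + y 0)⁻¹ * y 3) ^ 2)
        = 2 / (1 + y 0) := by
      field_simp
      linear_combination h1
    rw [h4]
    field_simp
  rw [stereoMap_eq, h3]
  ext k
  fin_cases k <;> simp [stereoInv] <;> field_simp

/-- The conical extension `(t, x) ↦ t σ(x)` of the parametrization. -/
def coneMap (y : R4) : R4 := y 0 • stereoMap (tl y)

/-- The derivative of `coneMap`. -/
def coneDeriv (y : R4) : R4 →L[ℝ] R4 :=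
  y 0 • (fderiv ℝ stereoMap (tl y) ∘L tl) +
    (EuclideanSpace.proj (𝕜 := ℝ) (0 : Fin 4)).smulRight (stereoMap (tl y))

theorem hasFDerivAt_coneMap (y : R4) : HasFDerivAt coneMap (coneDeriv y) y := by
  have h1 : HasFDerivAt (fun y : R4 => y 0) (EuclideanSpace.proj (𝕜 := ℝ) (0 : Fin 4)) y :=
    (EuclideanSpace.proj (𝕜 := ℝ) (0 : Fin 4)).hasFDerivAt
  exact h1.fun_smul ((hasFDerivAt_stereoMap (tl y)).comp y tl.hasFDerivAt)

theorem coneDeriv_apply (y v : R4) :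
    coneDeriv y v = y 0 • fderiv ℝ stereoMap (tl y) (tl v) + v 0 • stereoMap (tl y) := by
  simp [coneDeriv]

theorem det_coneDeriv (y : R4) : (coneDeriv y).det = y 0 ^ 3 * lam (tl y) ^ 3 := by
  have h : (coneDeriv y).det = (Matrix.of fun i j : Fin 4 => coneDeriv y (stdVec j) i).det := by
    rw [ContinuousLinearMap.det,
      ← LinearMap.det_toMatrix (EuclideanSpace.basisFun (Fin 4) ℝ).toBasis]
    congr 1
  rw [h]
  simp only [coneDeriv_apply, fderiv_stereoMap, stereoMap_eq, Matrix.det_succ_row_zero,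
    Fin.sum_univ_succ, inner_R3]
  simp [Fin.succAbove, lam_coord]
  field_simp
  ring

/-- The splitting `ℝ⁴ = ℝ × ℝ³` preserves Lebesgue measure. -/
theorem measurePreserving_split :
    MeasurePreserving (fun y : R4 => (y 0, tl y)) volume (volume.prod volume) := by
  have h1 := EuclideanSpace.volume_preserving_symm_measurableEquiv_toLp (Fin 4)
  have h2 := volume_preserving_piFinSuccAbove (fun _ : Fin 4 => ℝ) 0
  have h3 := (EuclideanSpace.volume_preserving_symm_measurableEquiv_toLp (Fin 3)).symm
  have h4 := ((MeasurePreserving.id (volume : Measure ℝ)).prod h3).comp (h2.comp h1)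
  have h5 : (fun y : R4 => (y 0, tl y)) =
      Prod.map id (MeasurableEquiv.toLp 2 (Fin 3 → ℝ)).symm.symm ∘
        MeasurableEquiv.piFinSuccAbove (fun _ => ℝ) 0 ∘
          (MeasurableEquiv.toLp 2 (Fin 4 → ℝ)).symm := by
    funext y
    refine Prod.ext rfl ?_
    ext k
    fin_cases k <;> rfl
  rw [h5]
  exact h4

theorem lintegral_pow_three_Ioo :
    ∫⁻ t in Set.Ioo (0 : ℝ) 1, ENNReal.ofReal (t ^ 3) = ENNReal.ofReal (1 / 4) := by
  rw [← ofReal_integral_eq_lintegral_ofReal]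
  · rw [← integral_Ioc_eq_integral_Ioo, ← intervalIntegral.integral_of_le zero_le_one]
    norm_num
  · exact ((continuous_pow 3).integrableOn_Icc (a := 0) (b := 1)).mono_set Set.Ioo_subset_Icc_self
  · filter_upwards [ae_restrict_mem measurableSet_Ioo] with t ht
    exact pow_nonneg ht.1.le 3

/-- The cone of height one over `σ(A)`; the factor `1/4 = ∫₀¹ t³ dt` comes from the radial
variable. -/
theorem volume_coneMap_image {A : Set R3} (hA : MeasurableSet A) :
    volume (coneMap '' {y | y 0 ∈ Set.Ioo (0 : ℝ) 1 ∧ tl y ∈ A}) =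
      ENNReal.ofReal (1 / 4) * ∫⁻ x in A, ENNReal.ofReal (lam x ^ 3) := by
  have hpre : {y : R4 | y 0 ∈ Set.Ioo (0 : ℝ) 1 ∧ tl y ∈ A}
      = (fun y : R4 => (y 0, tl y)) ⁻¹' (Set.Ioo (0 : ℝ) 1 ×ˢ A) := rfl
  have hmeas : MeasurableSet {y : R4 | y 0 ∈ Set.Ioo (0 : ℝ) 1 ∧ tl y ∈ A} := by
    rw [hpre]
    exact measurePreserving_split.measurable (measurableSet_Ioo.prod hA)
  have hinj : Set.InjOn coneMap {y : R4 | y 0 ∈ Set.Ioo (0 : ℝ) 1 ∧ tl y ∈ A} := by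
    intro y hy z hz h
    have hn : ∀ w : R4, 0 < w 0 → ‖coneMap w‖ = w 0 := fun w hw => by
      rw [coneMap, norm_smul, norm_stereoMap, mul_one, Real.norm_of_nonneg hw.le]
    have h0 : y 0 = z 0 := by rw [← hn y hy.1.1, ← hn z hz.1.1, h]
    have h1 : tl y = tl z := by
      apply stereoMap_injective
      rw [coneMap, coneMap, ← h0] at h
      exact smul_right_injective R4 hy.1.1.ne' h
    ext k
    fin_cases k
    · exact h0
    · exact congrArg (fun w : R3 => w 0) h1
    · exact congrArg (fun w : R3 => w 1) h1
    · exact congrArg (fun w : R3 => w 2) h1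
  have hl : Measurable fun x : R3 => ENNReal.ofReal (lam x ^ 3) :=
    (contDiff_lam.continuous.pow 3).measurable.ennreal_ofReal
  have ht : Measurable fun t : ℝ => ENNReal.ofReal (t ^ 3) :=
    (continuous_pow 3).measurable.ennreal_ofReal
  rw [← setLIntegral_one,
    lintegral_image_eq_lintegral_abs_det_fderiv_mul volume hmeas
      (fun y _ => (hasFDerivAt_coneMap y).hasFDerivWithinAt) hinj]
  calc ∫⁻ y in {y : R4 | y 0 ∈ Set.Ioo (0 : ℝ) 1 ∧ tl y ∈ A},
        ENNReal.ofReal |(coneDeriv y).det| * 1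
      = ∫⁻ y in (fun y : R4 => (y 0, tl y)) ⁻¹' (Set.Ioo (0 : ℝ) 1 ×ˢ A),
          (fun p : ℝ × R3 => ENNReal.ofReal (p.1 ^ 3) * ENNReal.ofReal (lam p.2 ^ 3))
            (y 0, tl y) := by
        rw [hpre]
        refine setLIntegral_congr_fun (hpre ▸ hmeas) fun y hy => ?_
        have hy0 : 0 < y 0 := hy.1.1
        have hl0 := lam_pos (tl y)
        simp only [mul_one]
        rw [det_coneDeriv, abs_of_nonneg (by positivity), ENNReal.ofReal_mul (by positivity)]
    _ = ∫⁻ p in Set.Ioo (0 : ℝ) 1 ×ˢ A,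
          ENNReal.ofReal (p.1 ^ 3) * ENNReal.ofReal (lam p.2 ^ 3) ∂(volume.prod volume) :=
        measurePreserving_split.setLIntegral_comp_preimage (measurableSet_Ioo.prod hA)
          ((ht.comp measurable_fst).mul (hl.comp measurable_snd))
    _ = _ := by
        rw [← Measure.prod_restrict, lintegral_prod_mul ht.aemeasurable hl.aemeasurable,
          lintegral_pow_three_Ioo]

open scoped Pointwise in
/-- The Jacobian of the stereographic parametrization is `lam³`: the surface measure of a set is by
definition four times the volume of the cone over it. -/
theorem dvolS3_eq_map :
    dvolS3 = (volume.withDensity fun x : R3 => ENNReal.ofReal (lam x ^ 3)).map stereo := by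
  ext s hs
  have hA : MeasurableSet (stereo ⁻¹' s) := continuous_stereo.measurable hs
  rw [Measure.map_apply continuous_stereo.measurable hs, withDensity_apply _ hA, dvolS3,
    Measure.toSphere_apply' _ hs]
  -- the cone over the pole `-e₀` lies in a line
  have hline : volume ((ℝ ∙ (stdVec 0 : R4) : Submodule ℝ R4) : Set R4) = 0 := by
    refine Measure.addHaar_submodule _ _ fun h => ?_
    have h1 : (stdVec 1 : R4) ∈ (ℝ ∙ (stdVec 0 : R4) : Submodule ℝ R4) := h ▸ Submodule.mem_top
    obtain ⟨c, hc⟩ := Submodule.mem_span_singleton.1 h1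
    have := congrArg (fun w : R4 => w 1) hc
    simp at this
  have hcone : volume (Set.Ioo (0 : ℝ) 1 • (((↑) : S3 → R4) '' s)) =
      volume (coneMap '' {y | y 0 ∈ Set.Ioo (0 : ℝ) 1 ∧ tl y ∈ stereo ⁻¹' s}) := by
    apply le_antisymm
    · calc volume (Set.Ioo (0 : ℝ) 1 • (((↑) : S3 → R4) '' s))
          ≤ volume (coneMap '' {y | y 0 ∈ Set.Ioo (0 : ℝ) 1 ∧ tl y ∈ stereo ⁻¹' s} ∪
              ((ℝ ∙ (stdVec 0 : R4) : Submodule ℝ R4) : Set R4)) := by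
            refine measure_mono ?_
            rintro _ ⟨t, ht, _, ⟨p, hp, rfl⟩, rfl⟩
            have hpn : ‖(p : R4)‖ = 1 := norm_eq_of_mem_sphere p
            by_cases h0 : (p : R4) 0 = -1
            · right
              refine Submodule.smul_mem _ _ (Submodule.mem_span_singleton.2 ⟨-1, ?_⟩)
              have h1 := EuclideanSpace.norm_sq_eq (p : R4)
              rw [hpn, Fin.sum_univ_four, h0] at h1
              simp only [Real.norm_eq_abs, sq_abs] at h1
              have e1 : (p : R4) 1 = 0 := by nlinarith
              have e2 : (p : R4) 2 = 0 := by nlinarith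
              have e3 : (p : R4) 3 = 0 := by nlinarith
              ext k
              fin_cases k <;> simp [h0, e1, e2, e3]
            · left
              have hst := stereoMap_stereoInv hpn h0
              have htl : tl (t • stdVec 0 + emb (stereoInv (p : R4))) = stereoInv (p : R4) := by
                ext k
                fin_cases k <;> simp
              refine ⟨t • stdVec 0 + emb (stereoInv (p : R4)), ⟨by simpa using ht, ?_⟩, ?_⟩
              · have : stereo (stereoInv (p : R4)) = p := Subtype.ext hst
                rw [htl, Set.mem_preimage, this]
                exact hp
              · rw [coneMap, htl, hst]
                simp
        _ ≤ _ := measure_union_le _ _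
        _ = _ := by rw [hline, add_zero]
    · refine measure_mono ?_
      rintro _ ⟨y, ⟨hy, hys⟩, rfl⟩
      exact Set.smul_mem_smul hy ⟨_, hys, rfl⟩
  rw [hcone, volume_coneMap_image hA, ← mul_assoc]
  have h4 : ((Module.finrank ℝ R4 : ℕ) : ℝ≥0∞) * ENNReal.ofReal (1 / 4) = 1 := by
    rw [finrank_euclideanSpace_fin, show ((4 : ℕ) : ℝ≥0∞) = ENNReal.ofReal 4 by simp,
      ← ENNReal.ofReal_mul (by norm_num)]
    norm_num
  rw [h4, one_mul]

/-- Change of variables for the Bochner integral; no integrability is needed. -/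
theorem integral_dvolS3 {E : Type*} [NormedAddCommGroup E] [NormedSpace ℝ E] (f : S3 → E) :
    ∫ y, f y ∂dvolS3 = ∫ x, lam x ^ 3 • f (stereo x) := by
  rw [dvolS3_eq_map, measurableEmbedding_stereo.integral_map]
  have hm : Measurable fun x : R3 => Real.toNNReal (lam x ^ 3) :=
    (contDiff_lam.continuous.pow 3).measurable.real_toNNReal
  have := integral_withDensity_eq_integral_smul (μ := (volume : Measure R3)) hm
    (fun x => f (stereo x))
  refine Eq.trans this (integral_congr_ae (Filter.Eventually.of_forall fun x => ?_))
  simp only [NNReal.smul_def]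
  rw [Real.coe_toNNReal _ (pow_nonneg (lam_pos x).le 3)]

theorem lintegral_dvolS3 {f : S3 → ℝ≥0∞} :
    ∫⁻ y, f y ∂dvolS3 = ∫⁻ x, ENNReal.ofReal (lam x ^ 3) * f (stereo x) := by
  have hm : Measurable fun x : R3 => ENNReal.ofReal (lam x ^ 3) :=
    (contDiff_lam.continuous.pow 3).measurable.ennreal_ofReal
  rw [dvolS3_eq_map, measurableEmbedding_stereo.lintegral_map,
    lintegral_withDensity_eq_lintegral_mul_non_measurable _
      hm (Filter.Eventually.of_forall fun x => ENNReal.ofReal_lt_top)]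
  rfl

theorem quasiMeasurePreserving_stereo :
    Measure.QuasiMeasurePreserving stereo volume dvolS3 := by
  refine ⟨continuous_stereo.measurable, ?_⟩
  rw [dvolS3_eq_map]
  refine Measure.AbsolutelyContinuous.map ?_ continuous_stereo.measurable
  refine withDensity_absolutelyContinuous'
    (contDiff_lam.continuous.pow 3).measurable.ennreal_ofReal.aemeasurable
    (Filter.Eventually.of_forall fun x => ?_)
  simpa using pow_pos (lam_pos x) 3

theorem aestronglyMeasurable_comp_stereo {E : Type*} [NormedAddCommGroup E] {f : S3 → E}
    (hf : AEStronglyMeasurable f dvolS3) :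
    AEStronglyMeasurable (fun x => f (stereo x)) volume :=
  hf.comp_quasiMeasurePreserving quasiMeasurePreserving_stereo

/-- A field on `ℝ³` which is pointwise dominated by `lam^{3/2} |f ∘ stereo|`, with `f ∈ L²(S³)`,
is square integrable. -/
theorem memLp_two_of_le_stereo {E F : Type*} [NormedAddCommGroup E] [NormedAddCommGroup F]
    {f : S3 → E} (hf : MemLp f 2 dvolS3) {g : R3 → F} (hg : AEStronglyMeasurable g volume)
    (C : ℝ) (h : ∀ x, ‖g x‖ ^ 2 ≤ C * lam x ^ 3 * ‖f (stereo x)‖ ^ 2) : MemLp g 2 volume := by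
  have hsq : Integrable (fun x => C * (lam x ^ 3 * ‖f (stereo x)‖ ^ 2)) volume := by
    refine Integrable.const_mul ?_ C
    have h1 := hf.integrable_norm_pow (by norm_num : (2 : ℕ) ≠ 0)
    refine ⟨(contDiff_lam.continuous.pow 3).aestronglyMeasurable.mul
      ((aestronglyMeasurable_comp_stereo hf.1).norm.pow 2), ?_⟩
    have h2 := h1.2
    rw [hasFiniteIntegral_iff_enorm, lintegral_dvolS3] at h2
    rw [hasFiniteIntegral_iff_enorm]
    convert h2 using 3 with x
    rw [enorm_mul, Real.enorm_of_nonneg (pow_nonneg (lam_pos x).le 3)]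
  refine (memLp_two_iff_integrable_sq_norm hg).2 (hsq.mono' (hg.norm.pow 2) ?_)
  filter_upwards with x
  rw [Real.norm_of_nonneg (by positivity), ← mul_assoc]
  exact h x

/-! ### Transfer of the weak differential equations to `ℝ³` -/

/-- Compactly supported smooth fields on `ℝ³` are restrictions along `σ` of smooth fields on `ℝ⁴`
vanishing at the pole: this is what turns test fields on `ℝ³` into test fields on the sphere. -/
theorem exists_smooth_extension {E : Type*} [NormedAddCommGroup E] [NormedSpace ℝ E]
    {F : R3 → E} (hF : ContDiff ℝ ∞ F) (hc : HasCompactSupport F) :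
    ∃ w : R4 → E, ContDiff ℝ ∞ w ∧ (∀ x, w (stereoMap x) = F x) ∧ ∀ y : R4, y 0 = -1 → w y = 0 := by
  obtain ⟨ρ, hρ⟩ := hc.isCompact.isBounded.subset_closedBall (0 : R3)
  -- on the support of `F`, `1 + σ₀ = lam ≥ l`
  set l : ℝ := 2 / (1 + ρ ^ 2) with hl
  have hlpos : 0 < l := by positivity
  let χ : R4 → ℝ := fun y => Real.smoothTransition ((1 + y 0) / (l / 2) - 1)
  have hχ : ContDiff ℝ ∞ χ := by
    refine Real.smoothTransition.contDiff.comp ?_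
    have : ContDiff ℝ ∞ fun y : R4 => y 0 :=
      (EuclideanSpace.proj (𝕜 := ℝ) (0 : Fin 4)).contDiff
    fun_prop
  refine ⟨fun y => χ y • F (stereoInv y), ?_, ?_, ?_⟩
  · rw [contDiff_iff_contDiffAt]
    intro y
    by_cases hy : 1 + y 0 = 0 ∨ 1 + y 0 < l / 2
    · have hlt : 1 + y 0 < l / 2 := by
        rcases hy with h | h
        · rw [h]; positivity
        · exact h
      have hopen : IsOpen {y : R4 | 1 + y 0 < l / 2} :=
        isOpen_lt (continuous_const.add
          (EuclideanSpace.proj (𝕜 := ℝ) (0 : Fin 4)).continuous) continuous_const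
      refine (contDiffAt_const (c := (0 : E))).congr_of_eventuallyEq ?_
      filter_upwards [hopen.mem_nhds hlt] with z hz
      have hz' : (1 + z 0) / (l / 2) - 1 ≤ 0 := by
        rw [sub_nonpos, div_le_one (by positivity)]
        exact (show 1 + z 0 < l / 2 from hz).le
      simp only [χ, Real.smoothTransition.zero_of_nonpos hz', zero_smul]
    · push Not at hy
      refine hχ.contDiffAt.smul (hF.contDiffAt.comp y ?_)
      have h0 : ContDiffAt ℝ ∞ (fun y : R4 => 1 + y 0) y :=
        contDiffAt_const.add (EuclideanSpace.proj (𝕜 := ℝ) (0 : Fin 4)).contDiff.contDiffAt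
      exact (h0.inv hy.1).smul tl.contDiff.contDiffAt
  · intro x
    simp only [stereoInv_stereoMap]
    by_cases hx : F x = 0
    · rw [hx, smul_zero]
    · have h1 : ‖x‖ ≤ ρ := by
        simpa using hρ (subset_tsupport _ hx)
      have h2 : l ≤ lam x := by
        rw [hl, lam]
        gcongr
      have h3 : 1 ≤ (1 + stereoMap x 0) / (l / 2) - 1 := by
        rw [stereoMap_zero_add_one, le_sub_iff_add_le, le_div_iff₀ (by positivity)]
        linarith
      simp only [χ, Real.smoothTransition.one_of_one_le h3, one_smul]
  · intro y hy
    have : (1 + y 0) / (l / 2) - 1 ≤ 0 := by rw [hy]; simp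
    simp only [χ, Real.smoothTransition.zero_of_nonpos this, zero_smul]

theorem fderiv_comp_stereoMap {E : Type*} [NormedAddCommGroup E] [NormedSpace ℝ E]
    {w : R4 → E} {F : R3 → E} (hw : ContDiff ℝ ∞ w) (h : ∀ x, w (stereoMap x) = F x)
    (x v : R3) : fderiv ℝ F x v = fderiv ℝ w (stereoMap x) (fderiv ℝ stereoMap x v) := by
  have : F = w ∘ stereoMap := funext fun x => (h x).symm
  rw [this, fderiv_comp x (hw.differentiable (by simp)).differentiableAt
    (contDiff_stereoMap.differentiable (by simp)).differentiableAt]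
  rfl

theorem frame_expansion_tangent (x : R3) {v : R4} (hv : inner ℝ (stereoMap x) v = 0) :
    ∑ i, (inner ℝ v (dsig i x)) • dsig i x = lam x ^ 2 • v := by
  rw [frame_expansion x v, real_inner_comm, hv]
  simp

theorem eq_sum_stdVec {n : ℕ} (v : EuclideanSpace ℝ (Fin n)) : v = ∑ i, v i • stdVec i := by
  ext k
  simp [Finset.sum_apply]

theorem pull_apply (a : S3 → R4) (x : R3) (i : Fin 3) :
    pull a x i = inner ℝ (a (stereo x)) (dsig i x) := rfl

theorem pull_eq_sum (a : S3 → R4) (x : R3) :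
    pull a x = ∑ i, (inner ℝ (a (stereo x)) (dsig i x)) • stdVec i :=
  eq_sum_stdVec (pull a x)

theorem fderiv_pull {a : S3 → R4} (ha : IsTangent a) {w : R4 → ℝ} {η : R3 → ℝ}
    (hw : ContDiff ℝ ∞ w) (h : ∀ x, w (stereoMap x) = η x) (x : R3) :
    fderiv ℝ η x (pull a x) = lam x ^ 2 * fderiv ℝ w (stereoMap x) (a (stereo x)) := by
  rw [pull_eq_sum, map_sum]
  simp only [map_smul, fderiv_comp_stereoMap hw h]
  rw [← smul_eq_mul, ← map_smul, ← frame_expansion_tangent x (ha (stereo x)), map_sum]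
  simp only [map_smul]
  rfl

/-- On a three-dimensional space, `lam • pull E` is the flat dual of the pull-back of the two-form
`⋆E`, so its divergence is the pull-back of the divergence with the weight `lam³` of the volume. -/
theorem HasWeakDivS3.pull {E : S3 → R4} {ρ : S3 → ℝ} (h : HasWeakDivS3 E ρ) (hE : IsTangent E) :
    HasWeakDivR3 (fun x => lam x • pull E x) (fun x => lam x ^ 3 * ρ (stereo x)) := by
  intro η hη hηc
  obtain ⟨w, hw, hwσ, -⟩ := exists_smooth_extension hη hηc
  have h1 := h w hw
  rw [integral_dvolS3, integral_dvolS3] at h1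
  convert h1 using 2
  · ext x
    rw [map_smul, fderiv_pull hE hw hwσ, smul_eq_mul, smul_eq_mul]
    simp only [stereo]
    ring
  · congr 1
    ext x
    rw [smul_eq_mul, ← hwσ]
    simp only [stereo]
    ring

theorem fderiv_dsig_symm (i j : Fin 3) (x : R3) :
    fderiv ℝ (dsig i) x (stdVec j) = fderiv ℝ (dsig j) x (stdVec i) := by
  have hd : DifferentiableAt ℝ (fderiv ℝ stereoMap) x :=
    ((contDiff_stereoMap.fderiv_right (m := ∞) (by simp)).differentiable
      (by simp)).differentiableAt
  have h : ∀ i j : Fin 3, fderiv ℝ (dsig i) x (stdVec j) =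
      fderiv ℝ (fderiv ℝ stereoMap) x (stdVec j) (stdVec i) := fun i j => by
    have : dsig i = fun y => fderiv ℝ stereoMap y (stdVec i) := rfl
    rw [this, fderiv_clm_apply hd (differentiableAt_const _)]
    simp
  rw [h, h]
  exact (contDiff_stereoMap.contDiffAt.isSymmSndFDerivAt
    (by
      simp only [minSmoothness_of_isRCLikeNormedField]
      exact WithTop.coe_le_coe.2 (le_top : (2 : ℕ∞) ≤ ⊤))) _ _

/-- Leibniz rule for the inner product of two fields along the parametrization. -/
theorem fderiv_inner_R4 {F G : R3 → R4} (hF : ContDiff ℝ ∞ F) (hG : ContDiff ℝ ∞ G) (x v : R3) :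
    fderiv ℝ (fun y => inner ℝ (F y) (G y)) x v =
      inner ℝ (F x) (fderiv ℝ G x v) + inner ℝ (fderiv ℝ F x v) (G x) :=
  fderiv_inner_apply ℝ (hF.differentiable (by simp)).differentiableAt
    (hG.differentiable (by simp)).differentiableAt v

/-- The Christoffel symbols of the first kind `⟨∂ₘσ, ∂ₘ∂ᵢσ⟩` of the round metric. -/
theorem inner_dsig_fderiv_dsig (i m : Fin 3) (x : R3) :
    inner ℝ (dsig m x) (fderiv ℝ (dsig i) x (stdVec m)) =
      lam x * fderiv ℝ lam x (stdVec i) := by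
  have h1 := fderiv_inner_R4 (contDiff_dsig m) (contDiff_dsig m) x (stdVec i)
  have h2 : (fun y => inner ℝ (dsig m y) (dsig m y)) = fun y => lam y ^ 2 := by
    ext y; rw [inner_dsig_dsig, if_pos rfl]
  have hl : DifferentiableAt ℝ lam x := (contDiff_lam.differentiable (by simp)).differentiableAt
  rw [h2, real_inner_comm (fderiv ℝ (dsig m) x (stdVec i)), fderiv_fun_pow _ hl] at h1
  rw [fderiv_dsig_symm, real_inner_comm]
  simp at h1
  linarith

/-- The vector field `c Σ wᵢ ∂ᵢσ` along the parametrization. -/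
def pushField (c : R3 → ℝ) (w : R3 → R3) (x : R3) : R4 := ∑ i, (c x * w x i) • dsig i x

theorem contDiff_coord {w : R3 → R3} (hw : ContDiff ℝ ∞ w) (i : Fin 3) :
    ContDiff ℝ ∞ fun x => w x i :=
  (EuclideanSpace.proj (𝕜 := ℝ) i).contDiff.comp hw

theorem fderiv_coord {w : R3 → R3} (hw : ContDiff ℝ ∞ w) (i : Fin 3) (x v : R3) :
    fderiv ℝ (fun x => w x i) x v = fderiv ℝ w x v i := by
  have := ((EuclideanSpace.proj (𝕜 := ℝ) i).hasFDerivAt.comp x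
    (hw.differentiable (by simp)).differentiableAt.hasFDerivAt).fderiv
  exact congrArg (fun L : R3 →L[ℝ] ℝ => L v) this

theorem contDiff_pushField {c : R3 → ℝ} {w : R3 → R3} (hc : ContDiff ℝ ∞ c)
    (hw : ContDiff ℝ ∞ w) : ContDiff ℝ ∞ (pushField c w) :=
  ContDiff.sum fun i _ => (hc.mul (contDiff_coord hw i)).smul (contDiff_dsig i)

theorem hasCompactSupport_pushField (c : R3 → ℝ) {w : R3 → R3} (hw : HasCompactSupport w) :
    HasCompactSupport (pushField c w) := by
  refine hw.mono fun x hx => ?_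
  contrapose! hx
  simp only [Function.mem_support, not_not] at hx
  simp [pushField, hx]

theorem inner_pushField_dsig (c : R3 → ℝ) (w : R3 → R3) (x : R3) (j : Fin 3) :
    inner ℝ (dsig j x) (pushField c w x) = c x * lam x ^ 2 * w x j := by
  rw [pushField, inner_sum]
  simp only [inner_smul_right, inner_dsig_dsig]
  simp
  ring

theorem inner_stereoMap_pushField (c : R3 → ℝ) (w : R3 → R3) (x : R3) :
    inner ℝ (stereoMap x) (pushField c w x) = 0 := by
  rw [pushField, inner_sum]
  simp [inner_smul_right, inner_stereoMap_dsig]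

theorem contDiff_lam_inv_pow (n : ℕ) : ContDiff ℝ ∞ fun x => (lam x ^ n)⁻¹ :=
  (contDiff_lam.pow n).inv fun x => pow_ne_zero n (lam_ne_zero x)

/-- The trace over the tangent space, in the orthogonal frame `∂ₘσ`. -/
theorem trace_eq_frame (x : R3) (L : R4 →L[ℝ] R4) :
    lam x ^ 2 * ((∑ k, L (stdVec k) k) - inner ℝ (stereoMap x) (L (stereoMap x))) =
      ∑ m, inner ℝ (dsig m x) (L (dsig m x)) := by
  have h : ∀ k, lam x ^ 2 * L (stdVec k) k = lam x ^ 2 * (stereoMap x k * L (stereoMap x) k) +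
      ∑ m, dsig m x k * L (dsig m x) k := fun k => by
    have h1 := congrArg (fun v => L v k) (frame_expansion x (stdVec k))
    simp only [map_smul, map_add, map_sum, real_inner_comm, inner_stdVec, PiLp.smul_apply,
      PiLp.add_apply, smul_eq_mul] at h1
    rw [h1]
    simp [Finset.sum_apply, mul_assoc]
  rw [mul_sub, Finset.mul_sum, Finset.sum_congr rfl fun k _ => h k]
  simp only [inner_R4, Fin.sum_univ_four, Fin.sum_univ_three]
  ring

/-- The divergence in conformal coordinates: the weights `lam⁻³` and `lam³` of vector field and
volume cancel. -/
theorem divS3_pushField {w : R3 → R3} (hw : ContDiff ℝ ∞ w) {W : R4 → R4} (hW : ContDiff ℝ ∞ W)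
    (h : ∀ x, W (stereoMap x) = pushField (fun x => (lam x ^ 3)⁻¹) w x) (x : R3) :
    lam x ^ 3 * divS3 W (stereoMap x) = divR3 w x := by
  have hl := lam_ne_zero x
  have hld : DifferentiableAt ℝ lam x := (contDiff_lam.differentiable (by simp)).differentiableAt
  have hF : ContDiff ℝ ∞ (pushField (fun x => (lam x ^ 3)⁻¹) w) :=
    contDiff_pushField (contDiff_lam_inv_pow 3) hw
  have hterm : ∀ m, inner ℝ (dsig m x) (fderiv ℝ W (stereoMap x) (dsig m x)) =
      (lam x)⁻¹ * fderiv ℝ w x (stdVec m) m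
        - (lam x ^ 2)⁻¹ * fderiv ℝ lam x (stdVec m) * w x m
        - (∑ i, (lam x ^ 3)⁻¹ * w x i *
            inner ℝ (fderiv ℝ (dsig m) x (stdVec m)) (dsig i x)) := fun m => by
    rw [dsig, ← fderiv_comp_stereoMap hW h]
    have h1 := fderiv_inner_R4 (contDiff_dsig m) hF x (stdVec m)
    have h2 : (fun y => inner ℝ (dsig m y) (pushField (fun x => (lam x ^ 3)⁻¹) w y)) =
        fun y => (lam y)⁻¹ * w y m := by
      ext y
      have := lam_ne_zero y
      rw [inner_pushField_dsig]
      field_simp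
    have h3 : fderiv ℝ (fun y => (lam y)⁻¹ * w y m) x (stdVec m) =
        (lam x)⁻¹ * fderiv ℝ w x (stdVec m) m
          - (lam x ^ 2)⁻¹ * fderiv ℝ lam x (stdVec m) * w x m := by
      have h4 := ((hasDerivAt_inv hl).comp_hasFDerivAt x hld.hasFDerivAt).fun_mul
        ((contDiff_coord hw m).differentiable (by simp)).differentiableAt.hasFDerivAt
      refine (congrArg (fun L : R3 →L[ℝ] ℝ => L (stdVec m)) h4.fderiv).trans ?_
      simp [fderiv_coord hw]
      ring
    rw [h2, h3] at h1
    rw [show fderiv ℝ stereoMap x (stdVec m) = dsig m x from rfl]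
    have h5 : inner ℝ (fderiv ℝ (dsig m) x (stdVec m)) (pushField (fun x => (lam x ^ 3)⁻¹) w x) =
        ∑ i, (lam x ^ 3)⁻¹ * w x i * inner ℝ (fderiv ℝ (dsig m) x (stdVec m)) (dsig i x) := by
      rw [pushField, inner_sum]
      simp only [inner_smul_right]
    rw [h5] at h1
    linarith
  have hchr : ∀ i m, inner ℝ (fderiv ℝ (dsig m) x (stdVec m)) (dsig i x) =
      (if m = i then 2 * lam x * fderiv ℝ lam x (stdVec m) else 0)
        - lam x * fderiv ℝ lam x (stdVec i) := fun i m => by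
    have h1 := fderiv_inner_R4 (contDiff_dsig m) (contDiff_dsig i) x (stdVec m)
    rw [inner_dsig_fderiv_dsig] at h1
    have h2 : (fun y => inner ℝ (dsig m y) (dsig i y)) =
        fun y => if m = i then lam y ^ 2 else 0 := by
      ext y; rw [inner_dsig_dsig]
    rw [h2] at h1
    split_ifs with hmi
    · simp only [if_pos hmi] at h1
      rw [fderiv_fun_pow _ hld] at h1
      simp at h1
      linarith
    · simp only [if_neg hmi] at h1
      simp at h1
      linarith
  have htr := trace_eq_frame x (fderiv ℝ W (stereoMap x))
  have hdiv : lam x ^ 2 * divS3 W (stereoMap x) = (lam x)⁻¹ * divR3 w x := by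
    rw [divS3, htr]
    simp only [hterm, hchr, divR3, Fin.sum_univ_three]
    simp
    field_simp
    ring
  calc lam x ^ 3 * divS3 W (stereoMap x) = lam x * (lam x ^ 2 * divS3 W (stereoMap x)) := by ring
    _ = divR3 w x := by rw [hdiv]; field_simp

theorem twelve_mul_det_submatrix_one (i j k l : Fin 4) :
    12 * ((1 : Matrix (Fin 4) (Fin 4) ℤ).submatrix ![i, j, k, l] id).det =
      ((j : ℤ) - i) * (k - i) * (l - i) * (k - j) * (l - j) * (l - k) := by
  revert i j k l
  decide +kernel

/-- The Levi-Civita symbol as a normalized Vandermonde product, the form in which it is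
evaluated. -/
theorem leviCivita4_eq (i j k l : Fin 4) :
    leviCivita4 i j k l =
      (((j : ℕ) : ℝ) - (i : ℕ)) * ((k : ℕ) - (i : ℕ)) * ((l : ℕ) - (i : ℕ)) *
        ((k : ℕ) - (j : ℕ)) * ((l : ℕ) - (j : ℕ)) * ((l : ℕ) - (k : ℕ)) / 12 := by
  have h : leviCivita4 i j k l =
      (((1 : Matrix (Fin 4) (Fin 4) ℤ).submatrix ![i, j, k, l] id).det : ℤ) := by
    rw [leviCivita4, ← eq_intCast (Int.castRingHom ℝ), RingHom.map_det]
    congr 1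
    ext a b
    simp only [RingHom.mapMatrix_apply, Matrix.map_apply, Matrix.submatrix_apply,
      Matrix.one_apply]
    split_ifs <;> simp
  have h1 := congrArg (Int.cast : ℤ → ℝ) (twelve_mul_det_submatrix_one i j k l)
  simp only [Int.cast_mul, Int.cast_sub, Int.cast_natCast, Int.cast_ofNat] at h1
  rw [h, eq_div_iff (by norm_num), mul_comm]
  exact h1

theorem apply_eq_sum_stdVec (L : R4 →L[ℝ] R4) (v : R4) (l : Fin 4) :
    L v l = ∑ k, v k * L (stdVec k) l := by
  conv_lhs => rw [eq_sum_stdVec v]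
  simp [Finset.sum_apply]

theorem curlS3_apply (W : R4 → R4) (x : R4) (i : Fin 4) :
    curlS3 W x i = ∑ j, ∑ k, ∑ l, leviCivita4 j i k l * x j * fderiv ℝ W x (stdVec k) l := rfl

/-- The components of `curlS3` in the frame `∂ᵢσ` are those of the exterior derivative; the sign
says that `σ` preserves the orientation. Both sides are linear in the derivative of `W`, which is treated
as an arbitrary linear map. -/
theorem inner_dsig_curlS3_zero (W : R4 → R4) (x : R3) :
    lam x * inner ℝ (dsig 0 x) (curlS3 W (stereoMap x)) =
      inner ℝ (dsig 2 x) (fderiv ℝ W (stereoMap x) (dsig 1 x)) -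
      inner ℝ (dsig 1 x) (fderiv ℝ W (stereoMap x) (dsig 2 x)) := by
  simp only [inner_R4, apply_eq_sum_stdVec _ (dsig _ x), curlS3_apply]
  generalize fderiv ℝ W (stereoMap x) = L
  simp only [Fin.sum_univ_four, leviCivita4_eq, stereoMap_eq, dsig_eq]
  generalize L (stdVec 0) = L0
  generalize L (stdVec 1) = L1
  generalize L (stdVec 2) = L2
  generalize L (stdVec 3) = L3
  simp [lam_coord]
  field_simp
  ring

theorem inner_dsig_curlS3_one (W : R4 → R4) (x : R3) :
    lam x * inner ℝ (dsig 1 x) (curlS3 W (stereoMap x)) =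
      inner ℝ (dsig 0 x) (fderiv ℝ W (stereoMap x) (dsig 2 x)) -
      inner ℝ (dsig 2 x) (fderiv ℝ W (stereoMap x) (dsig 0 x)) := by
  simp only [inner_R4, apply_eq_sum_stdVec _ (dsig _ x), curlS3_apply]
  generalize fderiv ℝ W (stereoMap x) = L
  simp only [Fin.sum_univ_four, leviCivita4_eq, stereoMap_eq, dsig_eq]
  generalize L (stdVec 0) = L0
  generalize L (stdVec 1) = L1
  generalize L (stdVec 2) = L2
  generalize L (stdVec 3) = L3
  simp [lam_coord]
  field_simp
  ring

theorem inner_dsig_curlS3_two (W : R4 → R4) (x : R3) :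
    lam x * inner ℝ (dsig 2 x) (curlS3 W (stereoMap x)) =
      inner ℝ (dsig 1 x) (fderiv ℝ W (stereoMap x) (dsig 0 x)) -
      inner ℝ (dsig 0 x) (fderiv ℝ W (stereoMap x) (dsig 1 x)) := by
  simp only [inner_R4, apply_eq_sum_stdVec _ (dsig _ x), curlS3_apply]
  generalize fderiv ℝ W (stereoMap x) = L
  simp only [Fin.sum_univ_four, leviCivita4_eq, stereoMap_eq, dsig_eq]
  generalize L (stdVec 0) = L0
  generalize L (stdVec 1) = L1
  generalize L (stdVec 2) = L2
  generalize L (stdVec 3) = L3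
  simp [lam_coord]
  field_simp
  ring

/-- The pull-back of `dW` is `dw`, where `w` is the pull-back of `W`: the second derivatives of
`σ` cancel in the antisymmetrization. -/
theorem antisymm_fderiv_pushField {w : R3 → R3} (hw : ContDiff ℝ ∞ w) {W : R4 → R4}
    (hW : ContDiff ℝ ∞ W)
    (h : ∀ x, W (stereoMap x) = pushField (fun x => (lam x ^ 2)⁻¹) w x) (p q : Fin 3) (x : R3) :
    inner ℝ (dsig q x) (fderiv ℝ W (stereoMap x) (dsig p x)) -
      inner ℝ (dsig p x) (fderiv ℝ W (stereoMap x) (dsig q x)) =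
    fderiv ℝ w x (stdVec p) q - fderiv ℝ w x (stdVec q) p := by
  have hF : ContDiff ℝ ∞ (pushField (fun x => (lam x ^ 2)⁻¹) w) :=
    contDiff_pushField (contDiff_lam_inv_pow 2) hw
  have key : ∀ p q : Fin 3, inner ℝ (dsig q x) (fderiv ℝ W (stereoMap x) (dsig p x)) =
      fderiv ℝ w x (stdVec p) q -
        inner ℝ (fderiv ℝ (dsig q) x (stdVec p)) (pushField (fun x => (lam x ^ 2)⁻¹) w x) :=
      fun p q => by
    rw [show dsig p x = fderiv ℝ stereoMap x (stdVec p) from rfl, ← fderiv_comp_stereoMap hW h]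
    have h1 := fderiv_inner_R4 (contDiff_dsig q) hF x (stdVec p)
    have h2 : (fun y => inner ℝ (dsig q y) (pushField (fun x => (lam x ^ 2)⁻¹) w y)) =
        fun y => w y q := by
      ext y
      have := lam_ne_zero y
      rw [inner_pushField_dsig]
      field_simp
    rw [h2, fderiv_coord hw] at h1
    linarith
  rw [key, key, fderiv_dsig_symm p q]
  ring

theorem inner_pull (a : S3 → R4) (w : R3 → R3) (x : R3) :
    inner ℝ (pull a x) (w x) = inner ℝ (a (stereo x)) (pushField (fun _ => 1) w x) := by
  rw [pushField, inner_sum, inner_R3, Fin.sum_univ_three]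
  simp only [pull_apply, inner_smul_right]
  ring

/-- The curl in conformal coordinates, tested with a tangent field. -/
theorem inner_curlS3 {a : S3 → R4} (ha : IsTangent a) {w : R3 → R3} (hw : ContDiff ℝ ∞ w)
    {W : R4 → R4} (hW : ContDiff ℝ ∞ W)
    (h : ∀ x, W (stereoMap x) = pushField (fun x => (lam x ^ 2)⁻¹) w x) (x : R3) :
    lam x ^ 3 * inner ℝ (a (stereo x)) (curlS3 W (stereoMap x)) =
      inner ℝ (pull a x) (curlR3 w x) := by
  have hfr : lam x ^ 2 * inner ℝ (a (stereo x)) (curlS3 W (stereoMap x)) =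
      ∑ i, pull a x i * inner ℝ (dsig i x) (curlS3 W (stereoMap x)) := by
    have := congrArg (fun v => inner ℝ v (curlS3 W (stereoMap x)))
      (frame_expansion_tangent x (ha (stereo x)))
    simp only [sum_inner, real_inner_smul_left] at this
    exact this.symm
  have h0 := antisymm_fderiv_pushField hw hW h 1 2 x
  have h1 := antisymm_fderiv_pushField hw hW h 2 0 x
  have h2 := antisymm_fderiv_pushField hw hW h 0 1 x
  rw [← inner_dsig_curlS3_zero] at h0
  rw [← inner_dsig_curlS3_one] at h1
  rw [← inner_dsig_curlS3_two] at h2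
  rw [inner_R3]
  calc lam x ^ 3 * inner ℝ (a (stereo x)) (curlS3 W (stereoMap x))
      = lam x * (lam x ^ 2 * inner ℝ (a (stereo x)) (curlS3 W (stereoMap x))) := by ring
    _ = pull a x 0 * (lam x * inner ℝ (dsig 0 x) (curlS3 W (stereoMap x))) +
        pull a x 1 * (lam x * inner ℝ (dsig 1 x) (curlS3 W (stereoMap x))) +
        pull a x 2 * (lam x * inner ℝ (dsig 2 x) (curlS3 W (stereoMap x))) := by
        rw [hfr, Fin.sum_univ_three]; ring
    _ = _ := by rw [h0, h1, h2]; simp [curlR3]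

/-- The curl is the exterior derivative up to Hodge duals, and only the dual on the right-hand side
costs a power of `lam`. The test field `w` is extended as `lam⁻² Σ wᵢ ∂ᵢσ`, its metric dual having
pull-back `w`. -/
theorem HasWeakCurlS3.pull {a B : S3 → R4} (h : HasWeakCurlS3 a B) (ha : IsTangent a) :
    HasWeakCurlR3 (pull a) (fun x => lam x • pull B x) := by
  intro w hw hwc
  obtain ⟨W, hW, hWσ, -⟩ := exists_smooth_extension
    (contDiff_pushField (contDiff_lam_inv_pow 2) hw) (hasCompactSupport_pushField _ hwc)
  have h1 := h W hW
  rw [integral_dvolS3, integral_dvolS3] at h1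
  convert h1 using 2
  · ext x
    rw [smul_eq_mul]
    exact (inner_curlS3 ha hw hW hWσ x).symm
  · ext x
    have hl := lam_ne_zero x
    rw [smul_eq_mul, real_inner_smul_left, inner_pull,
      show W (stereo x : R4) = W (stereoMap x) from rfl, hWσ]
    simp only [pushField, inner_sum, inner_smul_right, Finset.mul_sum]
    refine Finset.sum_congr rfl fun i _ => ?_
    field_simp

/-- The gradient is the exterior derivative and commutes with pull-backs. The test field `w` is
extended as `lam⁻³ Σ wᵢ ∂ᵢσ`; the extension is tangent also at the pole, where it vanishes. -/
theorem HasWeakGradS3.pull {φ : S3 → ℂ} {G : S3 → C4} (h : HasWeakGradS3 φ G) :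
    HasWeakGradR3 (fun x => φ (stereo x)) (pullC G) := by
  intro w hw hwc
  obtain ⟨W, hW, hWσ, hW0⟩ := exists_smooth_extension
    (contDiff_pushField (contDiff_lam_inv_pow 3) hw) (hasCompactSupport_pushField _ hwc)
  have htan : ∀ y : S3, inner ℝ (y : R4) (W (y : R4)) = 0 := fun y => by
    by_cases hy : (y : R4) 0 = -1
    · rw [hW0 _ hy, inner_zero_right]
    · rw [← stereoMap_stereoInv (norm_eq_of_mem_sphere y) hy, hWσ, inner_stereoMap_pushField]
  have h1 := h W hW htan
  rw [integral_dvolS3, integral_dvolS3] at h1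
  convert h1 using 2
  · ext x
    rw [← divS3_pushField hw hW hWσ x]
    simp only [stereo, Complex.real_smul]
    push_cast
    ring
  · congr 1
    ext x
    have hl : (lam x : ℂ) ≠ 0 := by exact_mod_cast lam_ne_zero x
    rw [show W (stereo x : R4) = W (stereoMap x) from rfl, hWσ]
    simp only [pushField, pullC, dsig, Fin.sum_univ_three, Fin.sum_univ_four, PiLp.add_apply,
      PiLp.smul_apply, smul_eq_mul, Complex.real_smul]
    push_cast
    field_simp
    ring

/-! ### The modifying factor -/

theorem contDiff_rPlus : ContDiff ℝ ∞ rPlus := by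
  unfold rPlus
  refine ContDiff.sqrt ?_ fun x => by positivity
  exact (contDiff_const.add (contDiff_norm_sq ℝ)).div_const _

theorem exists_isModifier {R : ℝ} (hR : 0 < R) : ∃ ξ : R3 → ℝ, IsModifier R ξ := by
  let χ : ContDiffBump (0 : R3) := ⟨R, 2 * R, hR, by linarith⟩
  refine ⟨fun x => χ x + (1 - χ x) * rPlus x, ?_, fun x => ?_, fun x hx => ?_, fun x hx => ?_⟩
  · exact χ.contDiff.add ((contDiff_const.sub χ.contDiff).mul contDiff_rPlus)
  · have h0 := χ.nonneg (x := x)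
    have h1 := χ.le_one (x := x)
    have h2 := rPlus_pos x
    rcases h0.lt_or_eq with h | h
    · have : 0 ≤ (1 - χ x) * rPlus x := mul_nonneg (by linarith) h2.le
      linarith
    · rw [← h]; simpa using h2
  · have : χ x = 1 := χ.one_of_mem_closedBall (by simpa using hx)
    simp [this]
  · have : χ x = 0 := χ.zero_of_le_dist (by simpa using hx)
    simp [this]

theorem norm_fderiv_rPlus_le (x : R3) : ‖fderiv ℝ rPlus x‖ ≤ 1 := by
  have h1 : HasFDerivAt (fun y : R3 => (1 + ‖y‖ ^ 2) / 2) (innerSL ℝ x) x := by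
    have h := ((hasStrictFDerivAt_norm_sq x).hasFDerivAt.const_add 1).mul_const (2⁻¹ : ℝ)
    refine h.congr_fderiv ?_
    ext v
    simp
  have h2 := h1.sqrt (by positivity)
  have h3 : fderiv ℝ rPlus x = (1 / (2 * rPlus x)) • innerSL ℝ x := h2.fderiv
  have hp := rPlus_pos x
  have h4 : ‖x‖ ≤ 2 * rPlus x := by
    refine (sq_le_sq₀ (norm_nonneg x) (by positivity)).1 ?_
    rw [mul_pow, rPlus, Real.sq_sqrt (by positivity)]
    nlinarith [sq_nonneg ‖x‖]
  rw [h3, norm_smul, innerSL_apply_norm, Real.norm_of_nonneg (by positivity), one_div_mul_eq_div,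
    div_le_one (by positivity)]
  exact h4

/-- `ξ` is comparable with `r₊ = lam^{-1/2}` and has a bounded gradient. -/
theorem IsModifier.bounds {R : ℝ} {ξ : R3 → ℝ} (hξ : IsModifier R ξ) :
    ∃ C : ℝ, 1 ≤ C ∧ ∀ x, (ξ x)⁻¹ ^ 2 ≤ C * lam x ∧ ξ x ^ 2 * lam x ≤ C ∧ ‖fderiv ℝ ξ x‖ ≤ C := by
  have hcξ := hξ.smooth.continuous
  have hcl := contDiff_lam.continuous
  have hK := isCompact_closedBall (0 : R3) (2 * R)
  obtain ⟨C1, h1⟩ := hK.exists_bound_of_continuousOn (f := fun x => (ξ x)⁻¹ ^ 2 * (lam x)⁻¹)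
    (((hcξ.inv₀ fun x => (hξ.pos x).ne').pow 2).mul (hcl.inv₀ lam_ne_zero)).continuousOn
  obtain ⟨C2, h2⟩ := hK.exists_bound_of_continuousOn (f := fun x => ξ x ^ 2 * lam x)
    ((hcξ.pow 2).mul hcl).continuousOn
  obtain ⟨C3, h3⟩ := hK.exists_bound_of_continuousOn (f := fun x => fderiv ℝ ξ x)
    (hξ.smooth.continuous_fderiv (by simp)).continuousOn
  refine ⟨max 1 (max C1 (max C2 C3)), le_max_left _ _, fun x => ?_⟩
  have hl := lam_pos x
  by_cases hx : ‖x‖ ≤ 2 * R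
  · have hx' : x ∈ Metric.closedBall (0 : R3) (2 * R) := by simpa using hx
    refine ⟨?_, ?_, (h3 x hx').trans (by simp)⟩
    · have := (le_abs_self _).trans
        ((h1 x hx').trans (show C1 ≤ max 1 (max C1 (max C2 C3)) by simp))
      rwa [← div_eq_mul_inv, div_le_iff₀ hl] at this
    · exact (le_abs_self _).trans ((h2 x hx').trans (by simp))
  · push Not at hx
    have hr := rPlus_sq x
    have hξx := hξ.eq_rPlus x hx.le
    refine ⟨?_, ?_, ?_⟩
    · rw [hξx, inv_pow, hr, inv_inv]
      exact le_mul_of_one_le_left hl.le (le_max_left _ _)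
    · rw [hξx, hr, inv_mul_cancel₀ hl.ne']
      exact le_max_left _ _
    · have : ξ =ᶠ[nhds x] rPlus := by
        filter_upwards [(isOpen_lt continuous_const continuous_norm).mem_nhds hx] with y hy
        exact hξ.eq_rPlus y (le_of_lt hy)
      rw [this.fderiv_eq]
      exact (norm_fderiv_rPlus_le x).trans (le_max_left _ _)

/-! ### Square integrability of the modified data -/

/-- A real vector regarded as a complex one. -/
def toC (v : R3) : C3 := WithLp.toLp 2 fun i => (v i : ℂ)

@[simp] theorem toC_apply (v : R3) (i : Fin 3) : toC v i = (v i : ℂ) := rfl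

theorem norm_toC (v : R3) : ‖toC v‖ = ‖v‖ := by
  simp [EuclideanSpace.norm_eq]

theorem continuous_toC : Continuous toC :=
  (PiLp.continuous_toLp 2 _).comp
    (continuous_pi fun i => Complex.continuous_ofReal.comp
      (EuclideanSpace.proj (𝕜 := ℝ) i).continuous)

/-- The gradient of a real function, as a vector. -/
def grad (f : R3 → ℝ) (x : R3) : R3 := WithLp.toLp 2 fun i => fderiv ℝ f x (stdVec i)

@[simp] theorem grad_apply (f : R3 → ℝ) (x : R3) (i : Fin 3) :
    grad f x i = fderiv ℝ f x (stdVec i) := rfl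

theorem inner_grad (f : R3 → ℝ) (x v : R3) : inner ℝ (grad f x) v = fderiv ℝ f x v := by
  conv_rhs => rw [eq_sum_stdVec v]
  rw [map_sum, inner_R3, Fin.sum_univ_three]
  simp
  ring

theorem norm_grad_le (f : R3 → ℝ) (x : R3) : ‖grad f x‖ ≤ ‖fderiv ℝ f x‖ := by
  have h := inner_grad f x (grad f x)
  rw [real_inner_self_eq_norm_sq] at h
  have h2 := (le_abs_self _).trans ((fderiv ℝ f x).le_opNorm (grad f x))
  rw [← h, sq] at h2
  rcases (norm_nonneg (grad f x)).lt_or_eq with h0 | h0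
  · exact le_of_mul_le_mul_right h2 h0
  · rw [← h0]; exact norm_nonneg _

theorem continuous_grad {f : R3 → ℝ} (hf : ContDiff ℝ ∞ f) : Continuous (grad f) :=
  (PiLp.continuous_toLp 2 _).comp
    (continuous_pi fun i => (hf.continuous_fderiv (by simp)).clm_apply continuous_const)

theorem norm_dsig (i : Fin 3) (x : R3) : ‖dsig i x‖ ^ 2 = lam x ^ 2 := by
  rw [← real_inner_self_eq_norm_sq, inner_dsig_dsig, if_pos rfl]

theorem norm_sq_pull_le (a : S3 → R4) (x : R3) :
    ‖pull a x‖ ^ 2 ≤ 3 * lam x ^ 2 * ‖a (stereo x)‖ ^ 2 := by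
  have h : ∀ i, pull a x i ^ 2 ≤ lam x ^ 2 * ‖a (stereo x)‖ ^ 2 := fun i => by
    rw [pull_apply, ← norm_dsig i x, ← mul_pow, mul_comm, ← sq_abs]
    exact pow_le_pow_left₀ (abs_nonneg _) (abs_real_inner_le_norm (a (stereo x)) (dsig i x)) 2
  rw [norm_sq_R3]
  linarith [h 0, h 1, h 2]

theorem norm_sq_pullC_le (U : S3 → C4) (x : R3) :
    ‖pullC U x‖ ^ 2 ≤ 3 * lam x ^ 2 * ‖U (stereo x)‖ ^ 2 := by
  have h : ∀ i, ‖pullC U x i‖ ^ 2 ≤ lam x ^ 2 * ‖U (stereo x)‖ ^ 2 := fun i => by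
    have h1 : ‖pullC U x i‖ ≤ ∑ k, ‖U (stereo x) k‖ * |dsig i x k| := by
      refine (norm_sum_le (E := ℂ) _ _).trans (le_of_eq (Finset.sum_congr rfl fun k _ => ?_))
      rw [norm_mul, Complex.norm_real, Real.norm_eq_abs]
      rfl
    refine (pow_le_pow_left₀ (norm_nonneg _) h1 2).trans ?_
    refine (Finset.sum_mul_sq_le_sq_mul_sq _ _ _).trans (le_of_eq ?_)
    rw [← norm_dsig i x, EuclideanSpace.norm_sq_eq, EuclideanSpace.norm_sq_eq, mul_comm]
    simp
  rw [EuclideanSpace.norm_sq_eq, Fin.sum_univ_three]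
  linarith [h 0, h 1, h 2]

theorem aestronglyMeasurable_toLp {𝕜 : Type*} [RCLike 𝕜] {f : R3 → Fin 3 → 𝕜}
    (hf : ∀ i, AEStronglyMeasurable (fun x => f x i) volume) :
    AEStronglyMeasurable (fun x => (WithLp.toLp 2 (f x) : EuclideanSpace 𝕜 (Fin 3))) volume :=
  (PiLp.continuous_toLp 2 _).comp_aestronglyMeasurable
    (aemeasurable_pi_iff.2 fun i => (hf i).aemeasurable).aestronglyMeasurable

theorem aestronglyMeasurable_pull {a : S3 → R4} (ha : AEStronglyMeasurable a dvolS3) :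
    AEStronglyMeasurable (pull a) volume :=
  aestronglyMeasurable_toLp fun i =>
    (aestronglyMeasurable_comp_stereo ha).inner (contDiff_dsig i).continuous.aestronglyMeasurable

theorem aestronglyMeasurable_pullC {U : S3 → C4} (hU : AEStronglyMeasurable U dvolS3) :
    AEStronglyMeasurable (pullC U) volume :=
  aestronglyMeasurable_toLp fun i => Finset.aestronglyMeasurable_fun_sum _ fun k _ =>
    ((EuclideanSpace.proj (𝕜 := ℂ) k).continuous.comp_aestronglyMeasurable
      (aestronglyMeasurable_comp_stereo hU)).mul
      (Complex.continuous_ofReal.comp ((EuclideanSpace.proj (𝕜 := ℝ) k).continuous.comp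
        (contDiff_dsig i).continuous)).aestronglyMeasurable

theorem lam_pow_four_le (x : R3) : lam x ^ 4 ≤ 2 * lam x ^ 3 := by
  have := mul_le_mul_of_nonneg_right (lam_le_two x) (pow_nonneg (lam_pos x).le 3)
  linarith [this, show lam x ^ 4 = lam x * lam x ^ 3 by ring]

theorem memLp_lam_smul_pull {a : S3 → R4} (ha : MemLp a 2 dvolS3) :
    MemLp (fun x => lam x • pull a x) 2 volume := by
  refine memLp_two_of_le_stereo ha
    (contDiff_lam.continuous.aestronglyMeasurable.smul (aestronglyMeasurable_pull ha.1)) 6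
    fun x => ?_
  rw [norm_smul, mul_pow, Real.norm_of_nonneg (lam_pos x).le]
  calc lam x ^ 2 * ‖pull a x‖ ^ 2
      ≤ lam x ^ 2 * (3 * lam x ^ 2 * ‖a (stereo x)‖ ^ 2) := by
        gcongr; exact norm_sq_pull_le a x
    _ = 3 * lam x ^ 4 * ‖a (stereo x)‖ ^ 2 := by ring
    _ ≤ 3 * (2 * lam x ^ 3) * ‖a (stereo x)‖ ^ 2 := by gcongr; exact lam_pow_four_le x
    _ = _ := by ring

/-- The natural weighted bound of a pulled-back square integrable covector field. -/
theorem memLp_sqrt_lam_smul_pull {a : S3 → R4} (ha : MemLp a 2 dvolS3) :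
    MemLp (fun x => Real.sqrt (lam x) • pull a x) 2 volume := by
  refine memLp_two_of_le_stereo ha
    (contDiff_lam.continuous.sqrt.aestronglyMeasurable.smul (aestronglyMeasurable_pull ha.1)) 3
    fun x => ?_
  rw [norm_smul, mul_pow, Real.norm_of_nonneg (Real.sqrt_nonneg _), Real.sq_sqrt (lam_pos x).le]
  calc lam x * ‖pull a x‖ ^ 2 ≤ lam x * (3 * lam x ^ 2 * ‖a (stereo x)‖ ^ 2) := by
        gcongr
        · exact (lam_pos x).le
        · exact norm_sq_pull_le a x
    _ = _ := by ring

section Modified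

variable {D : CylinderData} {R : ℝ} {ξ : R3 → ℝ}

theorem memLp_modify_φ (hD : D.IsFiniteEnergy) (hξ : IsModifier R ξ) :
    MemLp (D.induced.modify ξ).φ 2 volume := by
  obtain ⟨C, -, hC⟩ := hξ.bounds
  have h : (D.induced.modify ξ).φ = fun x => ((lam x * (ξ x)⁻¹ : ℝ) : ℂ) * D.φ (stereo x) := by
    ext x
    simp only [MinkowskiData.modify, CylinderData.induced, inv_rPlus_sq]
    push_cast
    ring
  rw [h]
  refine memLp_two_of_le_stereo hD.memLp_φ ((Complex.continuous_ofReal.comp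
    (contDiff_lam.continuous.mul (hξ.smooth.continuous.inv₀ fun x => (hξ.pos x).ne'))
    ).aestronglyMeasurable.mul (aestronglyMeasurable_comp_stereo hD.memLp_φ.1)) C fun x => ?_
  have hl := lam_pos x
  rw [norm_mul, mul_pow, Complex.norm_real, Real.norm_eq_abs, sq_abs]
  gcongr
  nlinarith [mul_le_mul_of_nonneg_left (hC x).1 (sq_nonneg (lam x))]

theorem memLp_modify_U0 (hD : D.IsFiniteEnergy) (hξ : IsModifier R ξ) :
    MemLp (D.induced.modify ξ).U0 2 volume := by
  obtain ⟨C, -, hC⟩ := hξ.bounds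
  have h : (D.induced.modify ξ).U0 = fun x => ((ξ x * lam x ^ 2 : ℝ) : ℂ) * D.U0 (stereo x) := by
    ext x
    simp only [MinkowskiData.modify, CylinderData.induced, inv_rPlus_pow_four]
    push_cast
    ring
  rw [h]
  refine memLp_two_of_le_stereo hD.memLp_U0 ((Complex.continuous_ofReal.comp
    (hξ.smooth.continuous.mul (contDiff_lam.continuous.pow 2))
    ).aestronglyMeasurable.mul (aestronglyMeasurable_comp_stereo hD.memLp_U0.1)) C fun x => ?_
  have hl := lam_pos x
  rw [norm_mul, mul_pow, Complex.norm_real, Real.norm_eq_abs, sq_abs]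
  gcongr
  nlinarith [mul_le_mul_of_nonneg_left (hC x).2.1 (pow_nonneg hl.le 3)]

theorem modify_U_eq (x : R3) : (D.induced.modify ξ).U x =
    (((ξ x)⁻¹ * lam x : ℝ) : ℂ) • pullC D.U x
      - (((ξ x)⁻¹ * lam x ^ 2 : ℝ) * D.φ (stereo x)) • toC x
      - (((ξ x ^ 2)⁻¹ * lam x : ℝ) * D.φ (stereo x)) • toC (grad ξ x) := by
  ext i
  simp only [MinkowskiData.modify, CylinderData.induced, inv_rPlus_pow_four, inv_rPlus_sq,
    PiLp.sub_apply, PiLp.smul_apply, toC_apply, grad_apply, smul_eq_mul]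
  push_cast
  ring

theorem memLp_modify_U (hD : D.IsFiniteEnergy) (hξ : IsModifier R ξ) :
    MemLp (D.induced.modify ξ).U 2 volume := by
  obtain ⟨C, hC1, hC⟩ := hξ.bounds
  have hcl := contDiff_lam.continuous
  have hcξ := hξ.smooth.continuous
  have hcξi : Continuous fun x => (ξ x)⁻¹ := hcξ.inv₀ fun x => (hξ.pos x).ne'
  have hφm := aestronglyMeasurable_comp_stereo hD.memLp_φ.1
  have h1 : MemLp (fun x => (((ξ x)⁻¹ * lam x : ℝ) : ℂ) • pullC D.U x) 2 volume := by
    refine memLp_two_of_le_stereo hD.memLp_U ((Complex.continuous_ofReal.comp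
      (hcξi.mul hcl)).aestronglyMeasurable.smul (aestronglyMeasurable_pullC hD.memLp_U.1))
      (C * 2 * 3 * 2) fun x => ?_
    have hl := lam_pos x
    rw [norm_smul, mul_pow, Complex.norm_real, Real.norm_eq_abs, sq_abs, mul_pow]
    calc (ξ x)⁻¹ ^ 2 * lam x ^ 2 * ‖pullC D.U x‖ ^ 2
        ≤ (C * 2) * lam x ^ 2 * (3 * lam x ^ 2 * ‖D.U (stereo x)‖ ^ 2) := by
          gcongr
          · exact (hC x).1.trans (by gcongr; exact lam_le_two x)
          · exact norm_sq_pullC_le D.U x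
      _ = (C * 2) * 3 * lam x ^ 4 * ‖D.U (stereo x)‖ ^ 2 := by ring
      _ ≤ (C * 2) * 3 * (2 * lam x ^ 3) * ‖D.U (stereo x)‖ ^ 2 := by
          gcongr; exact lam_pow_four_le x
      _ = _ := by ring
  have h2 : MemLp (fun x => (((ξ x)⁻¹ * lam x ^ 2 : ℝ) * D.φ (stereo x)) • toC x) 2 volume := by
    refine memLp_two_of_le_stereo hD.memLp_φ (((Complex.continuous_ofReal.comp
      (hcξi.mul (hcl.pow 2))).aestronglyMeasurable.mul hφm).smul
      continuous_toC.aestronglyMeasurable) (C * 4) fun x => ?_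
    have hl := lam_pos x
    rw [norm_smul, norm_mul, mul_pow, mul_pow, Complex.norm_real, Real.norm_eq_abs, sq_abs,
      mul_pow, norm_toC]
    calc (ξ x)⁻¹ ^ 2 * (lam x ^ 2) ^ 2 * ‖D.φ (stereo x)‖ ^ 2 * ‖x‖ ^ 2
        = (ξ x)⁻¹ ^ 2 * lam x ^ 3 * ‖D.φ (stereo x)‖ ^ 2 * (lam x * ‖x‖ ^ 2) := by ring
      _ ≤ (C * 2) * lam x ^ 3 * ‖D.φ (stereo x)‖ ^ 2 * 2 := by
          gcongr
          · exact (hC x).1.trans (by gcongr; exact lam_le_two x)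
          · exact lam_mul_norm_sq_le x
      _ = _ := by ring
  have h3 : MemLp (fun x => (((ξ x ^ 2)⁻¹ * lam x : ℝ) * D.φ (stereo x)) • toC (grad ξ x)) 2
      volume := by
    refine memLp_two_of_le_stereo hD.memLp_φ (((Complex.continuous_ofReal.comp
      (((hcξ.pow 2).inv₀ fun x => pow_ne_zero 2 (hξ.pos x).ne').mul hcl)).aestronglyMeasurable.mul
      hφm).smul (continuous_toC.comp (continuous_grad hξ.smooth)).aestronglyMeasurable)
      (C ^ 2 * 2 * C ^ 2) fun x => ?_
    have hl := lam_pos x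
    rw [norm_smul, norm_mul, mul_pow, mul_pow, Complex.norm_real, Real.norm_eq_abs, sq_abs,
      mul_pow, norm_toC, ← inv_pow]
    calc ((ξ x)⁻¹ ^ 2) ^ 2 * lam x ^ 2 * ‖D.φ (stereo x)‖ ^ 2 * ‖grad ξ x‖ ^ 2
        ≤ (C * lam x) ^ 2 * lam x ^ 2 * ‖D.φ (stereo x)‖ ^ 2 * C ^ 2 := by
          gcongr
          · exact (hC x).1
          · exact (norm_grad_le ξ x).trans (hC x).2.2
      _ = C ^ 2 * lam x ^ 4 * ‖D.φ (stereo x)‖ ^ 2 * C ^ 2 := by ring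
      _ ≤ C ^ 2 * (2 * lam x ^ 3) * ‖D.φ (stereo x)‖ ^ 2 * C ^ 2 := by
          gcongr; exact lam_pow_four_le x
      _ = _ := by ring
  rw [funext (modify_U_eq (D := D) (ξ := ξ))]
  exact (h1.sub h2).sub h3

theorem modify_E_eq : (D.induced.modify ξ).E = fun x => lam x • pull D.E x := by
  ext x
  simp [MinkowskiData.modify, CylinderData.induced, inv_rPlus_sq]

theorem modify_B_eq : (D.induced.modify ξ).B = fun x => lam x • pull D.B x := by
  ext x
  simp [MinkowskiData.modify, CylinderData.induced, inv_rPlus_sq]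

/-- The electric constraint survives since `ξ` cancels in `conj (ξ⁻¹ φ₀) (ξ φ₁)`. -/
theorem isFiniteEnergy_modify (hD : D.IsFiniteEnergy) (hξ : IsModifier R ξ) :
    (D.induced.modify ξ).IsFiniteEnergy where
  memLp_E := modify_E_eq (D := D) (ξ := ξ) ▸ memLp_lam_smul_pull hD.memLp_E
  memLp_B := modify_B_eq (D := D) (ξ := ξ) ▸ memLp_lam_smul_pull hD.memLp_B
  memLp_U0 := memLp_modify_U0 hD hξ
  memLp_U := memLp_modify_U hD hξ
  memLp_φ := memLp_modify_φ hD hξ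
  div_E := by
    rw [modify_E_eq]
    convert hD.div_E.pull hD.tangent_E using 1
    ext x
    have hx : (ξ x : ℂ) ≠ 0 := by exact_mod_cast (hξ.pos x).ne'
    have h : star ((D.induced.modify ξ).φ x) * (D.induced.modify ξ).U0 x =
        ((lam x ^ 3 : ℝ) : ℂ) * (star (D.φ (stereo x)) * D.U0 (stereo x)) := by
      simp only [MinkowskiData.modify, CylinderData.induced, inv_rPlus_pow_four, inv_rPlus_sq,
        RCLike.star_def, map_div₀, map_mul, Complex.conj_ofReal]
      push_cast
      field_simp
    rw [h, Complex.im_ofReal_mul]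
    ring
  div_B := by
    rw [modify_B_eq]
    convert hD.div_B.pull hD.tangent_B using 1
    simp

/-- The gradient of `ξ` vanishes up to the boundary of the ball on which `ξ = 1`, by continuity. -/
theorem IsModifier.fderiv_eq_zero (hξ : IsModifier R ξ) (hR : 0 < R) {x : R3} (hx : ‖x‖ ≤ R) :
    fderiv ℝ ξ x = 0 := by
  have hcl : IsClosed {y | fderiv ℝ ξ y = 0} :=
    isClosed_eq (hξ.smooth.continuous_fderiv (by simp)) continuous_const
  have hsub : Metric.ball (0 : R3) R ⊆ {y | fderiv ℝ ξ y = 0} := fun y hy => by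
    have : ξ =ᶠ[nhds y] fun _ => 1 := by
      filter_upwards [Metric.isOpen_ball.mem_nhds hy] with z hz
      exact hξ.eq_one z (by simpa using (Metric.mem_ball.1 hz).le)
    rw [Set.mem_ofPred_eq, this.fderiv_eq, fderiv_fun_const]
    rfl
  refine hcl.closure_subset_iff.2 hsub ?_
  rw [closure_ball _ hR.ne']
  simpa using hx

theorem modify_eq_induced (hξ : IsModifier R ξ) (hR : 0 < R) {x : R3} (hx : ‖x‖ ≤ R) :
    (D.induced.modify ξ).U0 x = D.induced.U0 x ∧ (D.induced.modify ξ).U x = D.induced.U x ∧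
      (D.induced.modify ξ).φ x = D.induced.φ x := by
  have h1 := hξ.eq_one x hx
  refine ⟨by simp [MinkowskiData.modify, h1], ?_, by simp [MinkowskiData.modify, h1]⟩
  ext i
  simp [MinkowskiData.modify, h1, hξ.fderiv_eq_zero hR hx]

/-! ### The covariant derivative of the modified scalar field -/

/-- The total factor `lam / ξ` relating the modified scalar field to the one on the sphere. -/
def factor (ξ : R3 → ℝ) (x : R3) : ℝ := lam x * (ξ x)⁻¹

theorem IsModifier.contDiff_factor (hξ : IsModifier R ξ) : ContDiff ℝ ∞ (factor ξ) :=
  contDiff_lam.mul (hξ.smooth.inv fun x => (hξ.pos x).ne')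

theorem IsModifier.grad_factor (hξ : IsModifier R ξ) (x : R3) :
    grad (factor ξ) x = -((ξ x)⁻¹ * lam x ^ 2) • x - ((ξ x ^ 2)⁻¹ * lam x) • grad ξ x := by
  have hξ0 := (hξ.pos x).ne'
  have h := (hasFDerivAt_lam x).fun_mul ((hasDerivAt_inv hξ0).comp_hasFDerivAt x
    (hξ.smooth.differentiable (by simp)).differentiableAt.hasFDerivAt)
  ext i
  have h2 : fderiv ℝ (factor ξ) x = _ := h.fderiv
  simp only [grad_apply, h2]
  simp [inner_stdVec]
  ring

theorem modify_φ_eq (x : R3) :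
    (D.induced.modify ξ).φ x = (factor ξ x : ℂ) * D.φ (stereo x) := by
  simp only [MinkowskiData.modify, CylinderData.induced, inv_rPlus_sq, factor]
  push_cast
  ring

end Modified

/-! ### Calculus of the weak operators on `ℝ³` -/

theorem integrable_of_norm_le_of_hasCompactSupport {E F : Type*}
    [NormedAddCommGroup E] [NormedSpace ℝ E]
    [NormedAddCommGroup F] {f : R3 → E} (hf : LocallyIntegrable f volume) {g : R3 → F}
    (hg : AEStronglyMeasurable g volume) {c : R3 → ℝ} (hc : Continuous c)
    (hcc : HasCompactSupport c) (h : ∀ x, ‖g x‖ ≤ ‖c x‖ * ‖f x‖) : Integrable g volume := by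
  refine (hf.integrable_smul_left_of_hasCompactSupport hc hcc).mono hg ?_
  filter_upwards with x
  rw [norm_smul]
  exact h x

theorem divR3_smul {f : R3 → ℝ} {w : R3 → R3} (hf : ContDiff ℝ ∞ f) (hw : ContDiff ℝ ∞ w) (x : R3) :
    divR3 (fun y => f y • w y) x = f x * divR3 w x + inner ℝ (grad f x) (w x) := by
  have h := (hf.differentiable (by simp)).differentiableAt.hasFDerivAt.fun_smul
    (hw.differentiable (by simp)).differentiableAt.hasFDerivAt (x := x)
  rw [divR3, divR3, h.fderiv, inner_R3, Fin.sum_univ_three, Fin.sum_univ_three]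
  simp
  ring

theorem continuous_divR3 {w : R3 → R3} (hw : ContDiff ℝ ∞ w) : Continuous (divR3 w) :=
  continuous_finsetSum _ fun i _ => (EuclideanSpace.proj (𝕜 := ℝ) i).continuous.comp
    ((hw.continuous_fderiv (by simp)).clm_apply continuous_const)

theorem hasCompactSupport_divR3 {w : R3 → R3} (hw : HasCompactSupport w) :
    HasCompactSupport (divR3 w) := by
  refine (hw.fderiv (𝕜 := ℝ)).mono fun x hx => ?_
  contrapose! hx
  simp only [Function.mem_support, not_not] at hx
  simp [divR3, hx]

theorem sum_mul_ofReal_eq (G : C3) (v : R3) : ∑ k, G k * (v k : ℂ) = inner ℂ (toC v) G := by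
  simp [PiLp.inner_apply]

theorem norm_sum_mul_ofReal_le (G : C3) (v : R3) : ‖∑ k, G k * (v k : ℂ)‖ ≤ ‖v‖ * ‖G‖ := by
  rw [sum_mul_ofReal_eq, ← norm_toC v]
  exact norm_inner_le_norm _ _

theorem integrable_sum_mul {G : R3 → C3} (hG : LocallyIntegrable G volume) {w : R3 → R3}
    (hw : Continuous w) (hwc : HasCompactSupport w) :
    Integrable (fun x => ∑ k, G x k * (w x k : ℂ)) volume := by
  refine integrable_of_norm_le_of_hasCompactSupport hG ?_ hw.norm hwc.norm fun x => ?_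
  · simp only [sum_mul_ofReal_eq]
    exact (continuous_toC.comp hw).aestronglyMeasurable.inner hG.aestronglyMeasurable
  · rw [norm_norm]
    exact norm_sum_mul_ofReal_le _ _

theorem integrable_inner_of_hasCompactSupport {a : R3 → R3} (ha : LocallyIntegrable a volume)
    {w : R3 → R3} (hw : Continuous w) (hwc : HasCompactSupport w) :
    Integrable (fun x => inner ℝ (a x) (w x)) volume := by
  refine integrable_of_norm_le_of_hasCompactSupport ha
    (ha.aestronglyMeasurable.inner hw.aestronglyMeasurable) hw.norm hwc.norm fun x => ?_
  rw [norm_norm, mul_comm]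
  exact norm_inner_le_norm _ _

/-- Leibniz rule for the weak gradient. -/
theorem HasWeakGradR3.smul {φ : R3 → ℂ} {G : R3 → C3} (h : HasWeakGradR3 φ G)
    (hφ : LocallyIntegrable φ volume) (hG : LocallyIntegrable G volume) {f : R3 → ℝ}
    (hf : ContDiff ℝ ∞ f) :
    HasWeakGradR3 (fun x => (f x : ℂ) * φ x)
      (fun x => (f x : ℂ) • G x + φ x • toC (grad f x)) := by
  intro w hw hwc
  have hfwc : HasCompactSupport fun y => f y • w y := hwc.smul_left (f := f)
  have hfw : ContDiff ℝ ∞ fun y => f y • w y := hf.smul hw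
  have h1 := h (fun y => f y • w y) hfw hfwc
  have hcgw : Continuous fun x => (inner ℝ (grad f x) (w x) : ℝ) :=
    (continuous_grad hf).inner hw.continuous
  have hsgw : HasCompactSupport fun x => (inner ℝ (grad f x) (w x) : ℝ) := by
    refine hwc.mono fun x hx => ?_
    contrapose! hx
    simp only [Function.mem_support, not_not] at hx
    simp [hx]
  have i1 : Integrable (fun x => φ x * ((inner ℝ (grad f x) (w x) : ℝ) : ℂ)) volume :=
    hφ.integrable_smul_right_of_hasCompactSupport (g := fun x =>
      ((inner ℝ (grad f x) (w x) : ℝ) : ℂ)) (Complex.continuous_ofReal.comp hcgw)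
      (hsgw.comp_left (g := fun t : ℝ => (t : ℂ)) Complex.ofReal_zero)
  have i2 : Integrable (fun x => φ x * (divR3 (fun y => f y • w y) x : ℂ)) volume :=
    hφ.integrable_smul_right_of_hasCompactSupport (g := fun x =>
      (divR3 (fun y => f y • w y) x : ℂ)) (Complex.continuous_ofReal.comp (continuous_divR3 hfw))
      ((hasCompactSupport_divR3 hfwc).comp_left (g := fun t : ℝ => (t : ℂ)) Complex.ofReal_zero)
  have i3 := integrable_sum_mul hG hfw.continuous hfwc
  calc ∫ x, (f x : ℂ) * φ x * (divR3 w x : ℂ)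
      = ∫ x, (φ x * (divR3 (fun y => f y • w y) x : ℂ)
          - φ x * ((inner ℝ (grad f x) (w x) : ℝ) : ℂ)) := by
        congr 1
        ext x
        rw [divR3_smul hf hw]
        push_cast
        ring
    _ = -(∫ x, ((∑ k, G x k * ((f x • w x) k : ℂ))
          + φ x * ((inner ℝ (grad f x) (w x) : ℝ) : ℂ))) := by
        rw [integral_sub i2 i1, h1, integral_add i3 i1]
        ring
    _ = _ := by
        congr 2
        ext x
        simp only [inner_R3, Fin.sum_univ_three, PiLp.add_apply, PiLp.smul_apply, smul_eq_mul,
          toC_apply]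
        push_cast
        ring

/-- The vector product of `ℝ³`. -/
def cross (u v : R3) : R3 :=
  !₂[u 1 * v 2 - u 2 * v 1, u 2 * v 0 - u 0 * v 2, u 0 * v 1 - u 1 * v 0]

theorem norm_cross_le (u v : R3) : ‖cross u v‖ ≤ ‖u‖ * ‖v‖ := by
  refine (sq_le_sq₀ (norm_nonneg _) (by positivity)).1 ?_
  rw [mul_pow, norm_sq_R3, norm_sq_R3, norm_sq_R3]
  simp only [cross, PiLp.toLp_apply, Matrix.cons_val]
  nlinarith [sq_nonneg (u 0 * v 0 + u 1 * v 1 + u 2 * v 2)]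

theorem inner_cross (a u w : R3) : inner ℝ a (cross u w) = -inner ℝ (cross u a) w := by
  rw [inner_R3, inner_R3]
  simp only [cross, PiLp.toLp_apply, Matrix.cons_val]
  ring

theorem continuous_cross {X : Type*} [TopologicalSpace X] {u v : X → R3} (hu : Continuous u)
    (hv : Continuous v) : Continuous fun x => cross (u x) (v x) := by
  have hu' := fun i => (EuclideanSpace.proj (𝕜 := ℝ) i).continuous.comp hu
  have hv' := fun i => (EuclideanSpace.proj (𝕜 := ℝ) i).continuous.comp hv
  refine (PiLp.continuous_toLp 2 _).comp (continuous_pi fun i => ?_)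
  fin_cases i
  · exact ((hu' 1).mul (hv' 2)).sub ((hu' 2).mul (hv' 1))
  · exact ((hu' 2).mul (hv' 0)).sub ((hu' 0).mul (hv' 2))
  · exact ((hu' 0).mul (hv' 1)).sub ((hu' 1).mul (hv' 0))

theorem curlR3_smul {f : R3 → ℝ} {w : R3 → R3} (hf : ContDiff ℝ ∞ f) (hw : ContDiff ℝ ∞ w)
    (x : R3) : curlR3 (fun y => f y • w y) x = f x • curlR3 w x + cross (grad f x) (w x) := by
  have h := (hf.differentiable (by simp)).differentiableAt.hasFDerivAt.fun_smul
    (hw.differentiable (by simp)).differentiableAt.hasFDerivAt (x := x)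
  rw [curlR3, curlR3, h.fderiv]
  ext i
  fin_cases i <;> simp [cross] <;> ring

theorem continuous_curlR3 {w : R3 → R3} (hw : ContDiff ℝ ∞ w) : Continuous (curlR3 w) := by
  have h : ∀ i j : Fin 3, Continuous fun x => fderiv ℝ w x (stdVec i) j := fun i j =>
    (EuclideanSpace.proj (𝕜 := ℝ) j).continuous.comp
      ((hw.continuous_fderiv (by simp)).clm_apply continuous_const)
  refine (PiLp.continuous_toLp 2 _).comp (continuous_pi fun i => ?_)
  fin_cases i
  · exact (h 1 2).sub (h 2 1)
  · exact (h 2 0).sub (h 0 2)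
  · exact (h 0 1).sub (h 1 0)

theorem hasCompactSupport_curlR3 {w : R3 → R3} (hw : HasCompactSupport w) :
    HasCompactSupport (curlR3 w) := by
  refine (hw.fderiv (𝕜 := ℝ)).mono fun x hx => ?_
  contrapose! hx
  simp only [Function.mem_support, not_not] at hx
  refine Function.notMem_support.2 ?_
  ext i
  fin_cases i <;> simp [curlR3, hx]

/-- Leibniz rule for the weak curl. -/
theorem HasWeakCurlR3.smul {a B : R3 → R3} (h : HasWeakCurlR3 a B)
    (ha : LocallyIntegrable a volume) (hB : LocallyIntegrable B volume) {f : R3 → ℝ}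
    (hf : ContDiff ℝ ∞ f) :
    HasWeakCurlR3 (fun x => f x • a x) (fun x => f x • B x + cross (grad f x) (a x)) := by
  intro w hw hwc
  have hfwc : HasCompactSupport fun y => f y • w y := hwc.smul_left (f := f)
  have hfw : ContDiff ℝ ∞ fun y => f y • w y := hf.smul hw
  have hcr : Continuous fun x => cross (grad f x) (w x) :=
    continuous_cross (continuous_grad hf) hw.continuous
  have hcrs : HasCompactSupport fun x => cross (grad f x) (w x) := by
    refine hwc.mono fun x hx => ?_
    contrapose! hx
    simp only [Function.mem_support, not_not] at hx
    refine Function.notMem_support.2 ?_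
    ext i
    fin_cases i <;> simp [cross, hx]
  have i1 := integrable_inner_of_hasCompactSupport ha (continuous_curlR3 hfw)
    (hasCompactSupport_curlR3 hfwc)
  have i2 := integrable_inner_of_hasCompactSupport ha hcr hcrs
  have i3 := integrable_inner_of_hasCompactSupport hB hfw.continuous hfwc
  calc ∫ x, inner ℝ (f x • a x) (curlR3 w x)
      = ∫ x, (inner ℝ (a x) (curlR3 (fun y => f y • w y) x)
          - inner ℝ (a x) (cross (grad f x) (w x))) := by
        congr 1
        ext x
        rw [curlR3_smul hf hw, inner_add_right, real_inner_smul_left, real_inner_smul_right]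
        ring
    _ = ∫ x, (inner ℝ (B x) (f x • w x) - inner ℝ (a x) (cross (grad f x) (w x))) := by
        rw [integral_sub i1 i2, h _ hfw hfwc, integral_sub i3 i2]
    _ = _ := by
        congr 1
        ext x
        rw [inner_cross, inner_add_left, real_inner_smul_left, real_inner_smul_right]
        ring

/-- Leibniz rule for the weak divergence. -/
theorem HasWeakDivR3.smul {E : R3 → R3} {ρ : R3 → ℝ} (h : HasWeakDivR3 E ρ)
    (hE : LocallyIntegrable E volume) (hρ : LocallyIntegrable ρ volume) {f : R3 → ℝ}
    (hf : ContDiff ℝ ∞ f) :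
    HasWeakDivR3 (fun x => f x • E x) (fun x => f x * ρ x + inner ℝ (grad f x) (E x)) := by
  intro η hη hηc
  have hfη : HasCompactSupport fun y => f y * η y := hηc.mul_left (f := f)
  have i1 : Integrable (fun x => fderiv ℝ (fun y => f y * η y) x (E x)) volume := by
    simp only [← inner_grad, real_inner_comm (E _)]
    refine integrable_inner_of_hasCompactSupport hE (continuous_grad (hf.mul hη))
      ((hfη.fderiv (𝕜 := ℝ)).mono fun x hx => ?_)
    contrapose! hx
    simp only [Function.mem_support, not_not] at hx
    refine Function.notMem_support.2 ?_
    ext i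
    simp [hx]
  have i2 : Integrable (fun x => inner ℝ (E x) (η x • grad f x)) volume :=
    integrable_inner_of_hasCompactSupport hE (hη.continuous.smul (continuous_grad hf))
      (hηc.smul_right)
  have i3 : Integrable (fun x => ρ x * (f x * η x)) volume :=
    hρ.integrable_smul_right_of_hasCompactSupport (hf.mul hη).continuous hfη
  have hpt : ∀ x, fderiv ℝ (fun y => f y * η y) x (E x) =
      fderiv ℝ η x (f x • E x) + inner ℝ (E x) (η x • grad f x) := fun x => by
    have h := (hf.differentiable (by simp)).differentiableAt.hasFDerivAt.fun_mul
      (hη.differentiable (by simp)).differentiableAt.hasFDerivAt (x := x)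
    rw [h.fderiv, inner_smul_right, real_inner_comm, inner_grad]
    simp
  calc ∫ x, fderiv ℝ η x (f x • E x)
      = ∫ x, (fderiv ℝ (fun y => f y * η y) x (E x) - inner ℝ (E x) (η x • grad f x)) := by
        congr 1
        ext x
        rw [hpt]
        ring
    _ = -∫ x, (ρ x * (f x * η x) + inner ℝ (E x) (η x • grad f x)) := by
        rw [integral_sub i1 i2, h _ (hf.mul hη) hfη, integral_add i3 i2]
        ring
    _ = _ := by
        congr 2
        ext x
        rw [inner_smul_right, real_inner_comm]
        ring

/-! ### The gauge covariant derivative of the modified field -/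

/-- A field on `ℝ³` dominated by `c |f ∘ stereo|`, with `f` integrable on the sphere and `c`
continuous, is locally integrable. -/
theorem locallyIntegrable_of_le_stereo {E F : Type*} [NormedAddCommGroup E] [NormedSpace ℝ E]
    [NormedAddCommGroup F] {f : S3 → E} (hf : Integrable f dvolS3) {g : R3 → F}
    (hg : AEStronglyMeasurable g volume) {c : R3 → ℝ} (hc : Continuous c)
    (h : ∀ x, ‖g x‖ ≤ c x * ‖f (stereo x)‖) : LocallyIntegrable g volume := by
  have h1 : Integrable (fun x => lam x ^ 3 • f (stereo x)) volume := by
    refine ⟨(contDiff_lam.continuous.pow 3).aestronglyMeasurable.smul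
      (aestronglyMeasurable_comp_stereo hf.1), ?_⟩
    have h2 := hf.2
    rw [hasFiniteIntegral_iff_enorm, lintegral_dvolS3] at h2
    rw [hasFiniteIntegral_iff_enorm]
    convert h2 using 3 with x
    rw [enorm_smul, Real.enorm_of_nonneg (pow_nonneg (lam_pos x).le 3)]
  have h2 := h1.locallyIntegrable.continuous_smul
    (hc.mul ((contDiff_lam.continuous.pow 3).inv₀ fun x => pow_ne_zero 3 (lam_ne_zero x)))
  refine h2.mono hg (Filter.Eventually.of_forall fun x => (h x).trans ?_)
  have hl := lam_pos x
  simp only [norm_smul, Pi.mul_apply, Pi.inv_apply, Pi.pow_apply, norm_mul, norm_inv,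
    Real.norm_of_nonneg (pow_pos hl 3).le]
  rw [mul_assoc, inv_mul_cancel_left₀ (pow_pos hl 3).ne']
  gcongr
  exact le_abs_self _

instance : IsFiniteMeasure dvolS3 := by unfold dvolS3; infer_instance

/-- The covariant gradient on `ℝ³`, by the Leibniz rule for the factor `lam / ξ`. -/
theorem hasPotential_modify {D : CylinderData} {R : ℝ} {ξ : R3 → ℝ} (hD : D.IsFiniteEnergy)
    (hξ : IsModifier R ξ) {a : S3 → R4} (ha : D.IsPotential a) :
    (D.induced.modify ξ).HasPotential (pull a) := by
  have hφ : LocallyIntegrable (fun x => D.φ (stereo x)) volume :=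
    locallyIntegrable_of_le_stereo (hD.memLp_φ.integrable (by norm_num))
      (aestronglyMeasurable_comp_stereo hD.memLp_φ.1) continuous_const (c := fun _ => 1)
      fun x => by simp
  have hUi := hD.memLp_U.integrable (by norm_num)
  have hA : MemLp (fun y => (WithLp.toLp 2 fun k => (a y k : ℂ) : C4)) 2 dvolS3 := by
    refine ha.memLp.congr_norm (Continuous.comp_aestronglyMeasurable (g := fun v : R4 =>
      (WithLp.toLp 2 fun k => (v k : ℂ) : C4)) ?_ ha.memLp.1)
      (Filter.Eventually.of_forall fun y => ?_)
    · exact (PiLp.continuous_toLp 2 _).comp (continuous_pi fun i =>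
        Complex.continuous_ofReal.comp (EuclideanSpace.proj (𝕜 := ℝ) i).continuous)
    · simp [EuclideanSpace.norm_eq]
  have hφA : Integrable (fun y => D.φ y • (WithLp.toLp 2 fun k => (a y k : ℂ) : C4)) dvolS3 :=
    memLp_one_iff_integrable.1 (hA.smul hD.memLp_φ)
  have hG : Integrable (fun y => (WithLp.toLp 2 fun k =>
      D.U y k - Complex.I * (a y k : ℂ) * D.φ y : C4)) dvolS3 := by
    have h := hUi.sub (hφA.smul Complex.I)
    have he : (fun y => (WithLp.toLp 2 fun k => D.U y k - Complex.I * (a y k : ℂ) * D.φ y : C4)) =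
        D.U - Complex.I • fun y => D.φ y • (WithLp.toLp 2 fun k => (a y k : ℂ) : C4) := by
      refine funext fun y => ?_
      ext k
      simp
      ring
    rw [he]
    exact h
  have hGl : LocallyIntegrable (pullC fun y => (WithLp.toLp 2 fun k =>
      D.U y k - Complex.I * (a y k : ℂ) * D.φ y : C4)) volume := by
    refine locallyIntegrable_of_le_stereo hG (aestronglyMeasurable_pullC hG.1)
      (contDiff_lam.continuous.const_mul (Real.sqrt 3)) fun x => ?_
    have hl := lam_pos x
    refine (sq_le_sq₀ (norm_nonneg _) (by positivity)).1 ((norm_sq_pullC_le _ x).trans ?_)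
    rw [mul_pow, mul_pow, Real.sq_sqrt (by norm_num)]
  have h := ha.cov_grad.pull.smul hφ hGl hξ.contDiff_factor
  unfold MinkowskiData.HasPotential
  convert h using 1
  · ext x; exact modify_φ_eq x
  · ext x i
    rw [modify_φ_eq, modify_U_eq, hξ.grad_factor]
    simp only [pullC, pull, factor, PiLp.add_apply, PiLp.smul_apply, PiLp.sub_apply, smul_eq_mul,
      toC_apply, inner_R4, Fin.sum_univ_four]
    push_cast
    ring

/-! ### Mollification -/

open scoped Convolution NNReal

/-- Convolution with a normalized bump function. -/
def mollify {E : Type*} [NormedAddCommGroup E] [NormedSpace ℝ E] (φ : ContDiffBump (0 : R3))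
    (g : R3 → E) : R3 → E :=
  φ.normed volume ⋆[ContinuousLinearMap.lsmul ℝ ℝ, volume] g

section Mollify

variable {E : Type*} [NormedAddCommGroup E] [NormedSpace ℝ E] (φ : ContDiffBump (0 : R3))

theorem mollify_apply (g : R3 → E) (x : R3) :
    mollify φ g x = ∫ y, φ.normed volume (x - y) • g y := by
  rw [mollify, convolution_eq_swap]
  simp

theorem hasCompactSupport_mollify {g : R3 → E} (hg : HasCompactSupport g) :
    HasCompactSupport (mollify φ g) :=
  φ.hasCompactSupport_normed.convolution _ hg

theorem contDiff_mollify [CompleteSpace E] {g : R3 → E} (hg : LocallyIntegrable g volume) :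
    ContDiff ℝ ∞ (mollify φ g) :=
  φ.hasCompactSupport_normed.contDiff_convolution_left _ φ.contDiff_normed hg

theorem fderiv_mollify [CompleteSpace E] {g : R3 → E} (hg : LocallyIntegrable g volume)
    (x v : R3) : fderiv ℝ (mollify φ g) x v =
      ∫ y, fderiv ℝ (φ.normed volume) (x - y) v • g y := by
  have hc : HasCompactSupport (φ.normed (volume : Measure R3)) := φ.hasCompactSupport_normed
  have h1 := (hc.hasFDerivAt_convolution_left (ContinuousLinearMap.lsmul ℝ ℝ)
    (φ.contDiff_normed (n := 1)) hg x).fderiv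
  have hcd : Continuous (fderiv ℝ (φ.normed (volume : Measure R3))) :=
    (φ.contDiff_normed (n := 1)).continuous_fderiv (by simp)
  have hex := (hc.fderiv (𝕜 := ℝ)).convolutionExists_left
    ((ContinuousLinearMap.lsmul ℝ ℝ : ℝ →L[ℝ] E →L[ℝ] E).precompL R3) hcd hg x
  rw [mollify, h1, convolution_eq_swap, ContinuousLinearMap.integral_apply]
  · rfl
  · exact hex.integrable_swap

theorem lintegral_normed_bump : ∫⁻ t, ENNReal.ofReal (φ.normed volume t) = 1 := by
  rw [← ofReal_integral_eq_lintegral_ofReal φ.integrable_normed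
    (Filter.Eventually.of_forall fun t => φ.nonneg_normed t), φ.integral_normed, ENNReal.ofReal_one]

/-- Mollification does not increase `Lᵖ` norms: by Jensen's inequality for the probability measure
with the mollifying kernel as density. -/
theorem eLpNorm_mollify_le {g : R3 → E} (hg : AEStronglyMeasurable g volume) {p : ℝ≥0}
    (hp : 1 ≤ p) : eLpNorm (mollify φ g) p volume ≤ eLpNorm g p volume := by
  have hp0 : p ≠ 0 := (zero_lt_one.trans_le hp).ne'
  have hp0' : 0 < (p : ℝ) := by positivity
  have hρm : Measurable fun t => ENNReal.ofReal (φ.normed (volume : Measure R3) t) :=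
    φ.continuous_normed.measurable.ennreal_ofReal
  set ν : Measure R3 := volume.withDensity fun t => ENNReal.ofReal (φ.normed volume t) with hν
  have hνv : ν ≪ volume := withDensity_absolutelyContinuous _ _
  have : IsProbabilityMeasure ν :=
    ⟨by rw [hν, withDensity_apply _ MeasurableSet.univ, Measure.restrict_univ,
      lintegral_normed_bump]⟩
  have hpt : ∀ x, ‖mollify φ g x‖ₑ ^ (p : ℝ) ≤ ∫⁻ t, ‖g (x - t)‖ₑ ^ (p : ℝ) ∂ν := fun x => by
    have hgx : AEStronglyMeasurable (fun t => g (x - t)) ν :=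
      (hg.comp_quasiMeasurePreserving
        (quasiMeasurePreserving_sub_left_of_right_invariant volume x)).mono_ac hνv
    have h1 : ‖mollify φ g x‖ₑ ≤ ∫⁻ t, ‖g (x - t)‖ₑ ∂ν := by
      rw [hν, lintegral_withDensity_eq_lintegral_mul_non_measurable _ hρm
        (Filter.Eventually.of_forall fun t => ENNReal.ofReal_lt_top)]
      refine (enorm_integral_le_lintegral_enorm _).trans (le_of_eq (lintegral_congr fun t => ?_))
      rw [ContinuousLinearMap.lsmul_apply, enorm_smul, Real.enorm_of_nonneg (φ.nonneg_normed t)]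
      rfl
    have h2 := eLpNorm'_le_eLpNorm'_of_exponent_le zero_lt_one
      (show (1 : ℝ) ≤ p by exact_mod_cast hp) ν hgx
    rw [eLpNorm', eLpNorm'] at h2
    simp only [ENNReal.rpow_one, div_one, one_div] at h2
    calc ‖mollify φ g x‖ₑ ^ (p : ℝ) ≤ ((∫⁻ t, ‖g (x - t)‖ₑ ^ (p : ℝ) ∂ν) ^ (p : ℝ)⁻¹) ^ (p : ℝ) :=
          ENNReal.rpow_le_rpow (h1.trans h2) hp0'.le
      _ = _ := by rw [← ENNReal.rpow_mul, inv_mul_cancel₀ hp0'.ne', ENNReal.rpow_one]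
  rw [← ENNReal.rpow_le_rpow_iff hp0', eLpNorm_nnreal_pow_eq_lintegral hp0,
    eLpNorm_nnreal_pow_eq_lintegral hp0]
  have hm : AEMeasurable (fun q : R3 × R3 => ‖g (q.1 - q.2)‖ₑ ^ (p : ℝ)) (volume.prod ν) := by
    refine AEMeasurable.pow_const (AEStronglyMeasurable.enorm ?_) _
    exact (hg.mono_ac (quasiMeasurePreserving_sub_of_right_invariant volume ν).absolutelyContinuous
      ).comp_measurable measurable_sub
  calc ∫⁻ x, ‖mollify φ g x‖ₑ ^ (p : ℝ) ≤ ∫⁻ x, ∫⁻ t, ‖g (x - t)‖ₑ ^ (p : ℝ) ∂ν :=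
        lintegral_mono hpt
    _ = ∫⁻ t, (∫⁻ x, ‖g (x - t)‖ₑ ^ (p : ℝ)) ∂ν := lintegral_lintegral_swap hm
    _ = ∫⁻ _, (∫⁻ x, ‖g x‖ₑ ^ (p : ℝ)) ∂ν := by
        refine lintegral_congr fun t => ?_
        exact lintegral_sub_right_eq_self (fun x => ‖g x‖ₑ ^ (p : ℝ)) t
    _ = ∫⁻ x, ‖g x‖ₑ ^ (p : ℝ) := by simp

/-- A sequence of bump functions shrinking to the origin. -/
def bump (n : ℕ) : ContDiffBump (0 : R3) :=
  ⟨1 / ((n : ℝ) + 1), 2 * (1 / ((n : ℝ) + 1)), by positivity, by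
    have : 0 < 1 / ((n : ℝ) + 1) := by positivity
    linarith⟩

theorem ae_tendsto_mollify_bump [CompleteSpace E] {g : R3 → E} (hg : LocallyIntegrable g volume) :
    ∀ᵐ x, Filter.Tendsto (fun n => mollify (bump n) g x) Filter.atTop (nhds (g x)) := by
  refine ContDiffBump.ae_convolution_tendsto_right_of_locallyIntegrable (K := 2) ?_
    (Filter.Eventually.of_forall fun n => le_rfl) hg
  have := (tendsto_one_div_add_atTop_nhds_zero_nat (𝕜 := ℝ)).const_mul 2
  simpa [bump] using this

/-- If all mollifications of `g` are bounded by `C` in `Lᵖ`, so is `g`. -/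
theorem eLpNorm_le_of_forall_mollify_le [CompleteSpace E] {g : R3 → E}
    (hg : LocallyIntegrable g volume) {p C : ℝ≥0∞}
    (h : ∀ φ : ContDiffBump (0 : R3), eLpNorm (mollify φ g) p volume ≤ C) :
    eLpNorm g p volume ≤ C := by
  refine (Lp.eLpNorm_lim_le_liminf_eLpNorm
    (fun n => (contDiff_mollify (bump n) hg).continuous.aestronglyMeasurable) g
    (ae_tendsto_mollify_bump hg)).trans ?_
  refine (Filter.liminf_le_liminf (Filter.Eventually.of_forall fun n => h (bump n))).trans ?_
  simp

end Mollify

/-! ### Sobolev inequality for weakly differentiable functions -/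

/-- The reflected translate `y ↦ ρ(x - y)` of a mollifying kernel, as a test function. -/
def kernel (φ : ContDiffBump (0 : R3)) (x y : R3) : ℝ := φ.normed volume (x - y)

theorem contDiff_kernel (φ : ContDiffBump (0 : R3)) (x : R3) : ContDiff ℝ ∞ (kernel φ x) :=
  φ.contDiff_normed.comp (contDiff_const.sub contDiff_id)

theorem hasCompactSupport_kernel (φ : ContDiffBump (0 : R3)) (x : R3) :
    HasCompactSupport (kernel φ x) :=
  φ.hasCompactSupport_normed.comp_homeomorph (Homeomorph.subLeft x)

theorem fderiv_kernel (φ : ContDiffBump (0 : R3)) (x y v : R3) :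
    fderiv ℝ (kernel φ x) y v = -fderiv ℝ (φ.normed volume) (x - y) v := by
  have h1 : HasFDerivAt (φ.normed (volume : Measure R3)) (fderiv ℝ (φ.normed volume) (x - y))
      (x - y) :=
    ((φ.contDiff_normed (n := 1)).differentiable (by simp)).differentiableAt.hasFDerivAt
  have h2 : HasFDerivAt (fun y : R3 => x - y) (-ContinuousLinearMap.id ℝ R3) y :=
    (hasFDerivAt_id y).const_sub x
  have h3 : fderiv ℝ (kernel φ x) y = _ := (h1.comp y h2).fderiv
  rw [h3]
  simp

theorem mollify_apply_coord {𝕜 : Type*} [RCLike 𝕜] (φ : ContDiffBump (0 : R3))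
    {g : R3 → EuclideanSpace 𝕜 (Fin 3)} (hg : LocallyIntegrable g volume) (x : R3) (i : Fin 3) :
    mollify φ g x i = ∫ y, kernel φ x y • g y i := by
  have h1 : Integrable (fun y => φ.normed volume (x - y) • g y) volume :=
    hg.integrable_smul_left_of_hasCompactSupport (contDiff_kernel φ x).continuous
      (hasCompactSupport_kernel φ x)
  rw [mollify_apply]
  have := ((EuclideanSpace.proj (𝕜 := 𝕜) i).restrictScalars ℝ).integral_comp_comm h1
  exact this.symm

/-- The mollification of the weak gradient is the gradient of the mollification. -/
theorem HasWeakGradR3.fderiv_mollify {ψ : R3 → ℂ} {G : R3 → C3} (h : HasWeakGradR3 ψ G)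
    (hψ : LocallyIntegrable ψ volume) (hG : LocallyIntegrable G volume)
    (φ : ContDiffBump (0 : R3)) (x v : R3) :
    fderiv ℝ (mollify φ ψ) x v = ∑ k, mollify φ G x k * (v k : ℂ) := by
  have h1 := h (fun y => kernel φ x y • v) ((contDiff_kernel φ x).smul contDiff_const)
    (hasCompactSupport_kernel φ x).smul_right
  have hd : ∀ y, divR3 (fun y => kernel φ x y • v) y = -fderiv ℝ (φ.normed volume) (x - y) v :=
    fun y => by
    rw [divR3_smul (contDiff_kernel φ x) contDiff_const, inner_grad, fderiv_kernel]
    simp [divR3]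
  have hint : ∀ k, Integrable (fun y => kernel φ x y • G y k) volume := fun k =>
    (((EuclideanSpace.proj (𝕜 := ℂ) k).restrictScalars ℝ).integrable_comp
      (hG.integrable_smul_left_of_hasCompactSupport (contDiff_kernel φ x).continuous
        (hasCompactSupport_kernel φ x)))
  rw [MSF.fderiv_mollify φ hψ]
  calc ∫ y, fderiv ℝ (φ.normed volume) (x - y) v • ψ y
      = -∫ y, ψ y * (divR3 (fun y => kernel φ x y • v) y : ℂ) := by
        rw [← integral_neg]
        congr 1
        ext y
        rw [hd, Complex.real_smul]
        push_cast
        ring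
    _ = ∫ y, ∑ k, (kernel φ x y • G y k) * (v k : ℂ) := by
        rw [h1, neg_neg]
        congr 1
        ext y
        refine Finset.sum_congr rfl fun k _ => ?_
        simp
        ring
    _ = _ := by
        rw [integral_finsetSum _ fun k _ => (hint k).mul_const _]
        refine Finset.sum_congr rfl fun k _ => ?_
        rw [integral_mul_const, mollify_apply_coord φ hG]

/-- The Gagliardo–Nirenberg–Sobolev constant of `ℝ³` for the exponent `p`. -/
def gns (p : ℝ) : ℝ≥0 := eLpNormLESNormFDerivOfEqInnerConst (volume : Measure R3) p

/-- Gagliardo–Nirenberg–Sobolev inequality for compactly supported functions with a weak gradient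
in `Lᵖ`. -/
theorem HasWeakGradR3.eLpNorm_le {ψ : R3 → ℂ} {G : R3 → C3} (h : HasWeakGradR3 ψ G)
    (hψ : LocallyIntegrable ψ volume) (hG : LocallyIntegrable G volume)
    (hc : HasCompactSupport ψ) {p p' : ℝ≥0} (hp : 1 ≤ p)
    (hp' : (p' : ℝ)⁻¹ = (p : ℝ)⁻¹ - 3⁻¹) :
    eLpNorm ψ p' volume ≤ gns p * eLpNorm G p volume := by
  refine eLpNorm_le_of_forall_mollify_le hψ fun φ => ?_
  have h1 := eLpNorm_le_eLpNorm_fderiv_of_eq_inner (volume : Measure R3)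
    ((contDiff_mollify φ hψ).of_le (by simp)) (hasCompactSupport_mollify φ hc) hp
    (p' := p') (by simp) (by simpa using hp')
  refine h1.trans (mul_le_mul_right ?_ _)
  refine le_trans (eLpNorm_mono fun x => ?_) (eLpNorm_mollify_le φ hG.aestronglyMeasurable hp)
  refine ContinuousLinearMap.opNorm_le_bound _ (norm_nonneg _) fun v => ?_
  rw [h.fderiv_mollify hψ hG, mul_comm]
  exact norm_sum_mul_ofReal_le _ _

/-! ### The div-curl estimate -/

/-- Integration by parts, twice. -/
theorem integral_fderiv_mul_fderiv_symm {f g : R3 → ℝ} (hf : ContDiff ℝ ∞ f) (hg : ContDiff ℝ ∞ g)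
    (hfc : HasCompactSupport f) (v w : R3) :
    ∫ x, fderiv ℝ f x v * fderiv ℝ g x w = ∫ x, fderiv ℝ f x w * fderiv ℝ g x v := by
  have hg' : ∀ w, ContDiff ℝ ∞ fun x => fderiv ℝ g x w := fun w =>
    (hg.fderiv_right (by simp)).clm_apply contDiff_const
  have hfc' : ∀ v, HasCompactSupport fun x => fderiv ℝ f x v := fun v =>
    hfc.fderiv_apply (𝕜 := ℝ) v
  have hf' : ∀ v, Continuous fun x => fderiv ℝ f x v := fun v =>
    (hf.continuous_fderiv (by simp)).clm_apply continuous_const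
  have key : ∀ v w, ∫ x, f x * fderiv ℝ (fun y => fderiv ℝ g y w) x v =
      -∫ x, fderiv ℝ f x v * fderiv ℝ g x w := fun v w =>
    integral_mul_fderiv_eq_neg_fderiv_mul_of_integrable
      (((hf' v).mul (hg' w).continuous).integrable_of_hasCompactSupport ((hfc' v).mul_right))
      ((hf.continuous.mul ((hg' w).continuous_fderiv (by simp) |>.clm_apply
        continuous_const)).integrable_of_hasCompactSupport hfc.mul_right)
      ((hf.continuous.mul (hg' w).continuous).integrable_of_hasCompactSupport hfc.mul_right)
      (fun x _ => (hf.differentiable (by simp)).differentiableAt)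
      (fun x _ => ((hg' w).differentiable (by simp)).differentiableAt)
  have hsymm : ∀ x, fderiv ℝ (fun y => fderiv ℝ g y w) x v =
      fderiv ℝ (fun y => fderiv ℝ g y v) x w := fun x => by
    have hd : DifferentiableAt ℝ (fderiv ℝ g) x :=
      ((hg.fderiv_right (m := ∞) (by simp)).differentiable (by simp)).differentiableAt
    have h : ∀ v w, fderiv ℝ (fun y => fderiv ℝ g y w) x v = fderiv ℝ (fderiv ℝ g) x v w :=
      fun v w => by
        rw [fderiv_clm_apply hd (differentiableAt_const _)]
        simp
    rw [h, h]
    exact (hg.contDiffAt.isSymmSndFDerivAt (by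
      simp only [minSmoothness_of_isRCLikeNormedField]
      exact WithTop.coe_le_coe.2 (le_top : (2 : ℕ∞) ≤ ⊤))) _ _
  have h1 := key v w
  have h2 := key w v
  simp only [hsymm] at h1
  linarith

/-- The squared Frobenius norm of the Jacobian matrix of a vector field. -/
def frobSq (u : R3 → R3) (x : R3) : ℝ := ∑ i, ∑ j, fderiv ℝ u x (stdVec i) j ^ 2

theorem norm_fderiv_sq_le_frobSq (u : R3 → R3) (x : R3) :
    ‖fderiv ℝ u x‖ ^ 2 ≤ frobSq u x := by
  have hF : 0 ≤ frobSq u x := Finset.sum_nonneg fun i _ => Finset.sum_nonneg fun j _ => sq_nonneg _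
  have h : ‖fderiv ℝ u x‖ ≤ Real.sqrt (frobSq u x) := by
    refine ContinuousLinearMap.opNorm_le_bound _ (Real.sqrt_nonneg _) fun v => ?_
    refine (sq_le_sq₀ (norm_nonneg _) (by positivity)).1 ?_
    rw [mul_pow, Real.sq_sqrt hF]
    have hj : ∀ j, fderiv ℝ u x v j ^ 2 ≤ (∑ i, fderiv ℝ u x (stdVec i) j ^ 2) * ‖v‖ ^ 2 := by
      intro j
      have h1 : fderiv ℝ u x v j = ∑ i, v i * fderiv ℝ u x (stdVec i) j := by
        conv_lhs => rw [eq_sum_stdVec v]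
        simp [Finset.sum_apply]
      rw [h1]
      refine (Finset.sum_mul_sq_le_sq_mul_sq _ _ _).trans (le_of_eq ?_)
      rw [EuclideanSpace.norm_sq_eq, mul_comm]
      simp
    calc ‖fderiv ℝ u x v‖ ^ 2 = ∑ j, fderiv ℝ u x v j ^ 2 := by
          rw [EuclideanSpace.norm_sq_eq]; simp
      _ ≤ ∑ j, (∑ i, fderiv ℝ u x (stdVec i) j ^ 2) * ‖v‖ ^ 2 := Finset.sum_le_sum fun j _ => hj j
      _ = _ := by rw [← Finset.sum_mul, Finset.sum_comm, frobSq]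
  calc ‖fderiv ℝ u x‖ ^ 2 ≤ Real.sqrt (frobSq u x) ^ 2 := by gcongr
    _ = _ := Real.sq_sqrt hF

/-- For test fields, `∫ |∇u|² = ∫ |∇ × u|² + ∫ (∇ · u)²`. -/
theorem integral_frobSq {u : R3 → R3} (hu : ContDiff ℝ ∞ u) (hc : HasCompactSupport u) :
    ∫ x, frobSq u x = ∫ x, (‖curlR3 u x‖ ^ 2 + divR3 u x ^ 2) := by
  have hd : ∀ i j : Fin 3, Continuous fun x => fderiv ℝ u x (stdVec i) j := fun i j =>
    (EuclideanSpace.proj (𝕜 := ℝ) j).continuous.comp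
      ((hu.continuous_fderiv (by simp)).clm_apply continuous_const)
  have hs : ∀ i j : Fin 3, HasCompactSupport fun x => fderiv ℝ u x (stdVec i) j := fun i j =>
    (hc.fderiv_apply (𝕜 := ℝ) (stdVec i)).comp_left (g := fun v : R3 => v j) rfl
  have hi : ∀ i j k l : Fin 3, Integrable
      (fun x => fderiv ℝ u x (stdVec i) j * fderiv ℝ u x (stdVec k) l) volume := fun i j k l =>
    ((hd i j).mul (hd k l)).integrable_of_hasCompactSupport (hs i j).mul_right
  -- the null Lagrangians `∂ᵢuⱼ ∂ⱼuᵢ - ∂ᵢuᵢ ∂ⱼuⱼ` integrate to zero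
  obtain ⟨q, hq⟩ : ∃ q : Fin 3 → Fin 3 → R3 → ℝ, ∀ i j, q i j = fun x =>
      fderiv ℝ u x (stdVec i) j * fderiv ℝ u x (stdVec j) i -
        fderiv ℝ u x (stdVec i) i * fderiv ℝ u x (stdVec j) j := ⟨_, fun _ _ => rfl⟩
  have hq0 : ∀ i j : Fin 3, ∫ x, q i j x = 0 := fun i j => by
    rw [hq, integral_sub (hi i j j i) (hi i i j j), sub_eq_zero]
    have h := integral_fderiv_mul_fderiv_symm (contDiff_coord hu j) (contDiff_coord hu i)
      (hc.comp_left (g := fun v : R3 => v j) rfl) (stdVec i) (stdVec j)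
    simp only [fderiv_coord hu] at h
    rw [h]
    congr 1
    ext x
    ring
  have hqi : ∀ i j : Fin 3, Integrable (q i j) volume := fun i j => by
    rw [hq]
    exact (hi i j j i).sub (hi i i j j)
  have hpt : ∀ x, frobSq u x = (‖curlR3 u x‖ ^ 2 + divR3 u x ^ 2) +
      2 * (q 0 1 + q 0 2 + q 1 2) x := fun x => by
    rw [norm_sq_R3]
    simp only [frobSq, divR3, curlR3, Fin.sum_univ_three, PiLp.toLp_apply, Matrix.cons_val,
      Pi.add_apply, hq]
    ring
  have hH : Integrable (fun x => ‖curlR3 u x‖ ^ 2 + divR3 u x ^ 2) volume := by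
    refine Continuous.integrable_of_hasCompactSupport
      (((continuous_curlR3 hu).norm.pow 2).add ((continuous_divR3 hu).pow 2)) ?_
    refine HasCompactSupport.add
      ((hasCompactSupport_curlR3 hc).comp_left (g := fun v : R3 => ‖v‖ ^ 2) (by simp))
      ((hasCompactSupport_divR3 hc).comp_left (g := fun t : ℝ => t ^ 2) (by simp))
  rw [integral_congr_ae (Filter.Eventually.of_forall hpt),
    integral_add hH ((((hqi 0 1).add (hqi 0 2)).add (hqi 1 2)).const_mul 2),
    integral_const_mul, integral_add' ((hqi 0 1).add (hqi 0 2)) (hqi 1 2),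
    integral_add' (hqi 0 1) (hqi 0 2), hq0, hq0, hq0]
  simp

theorem eLpNorm_fderiv_le_curl_add_div {u : R3 → R3} (hu : ContDiff ℝ ∞ u)
    (hc : HasCompactSupport u) :
    eLpNorm (fderiv ℝ u) 2 volume ≤
      eLpNorm (curlR3 u) 2 volume + eLpNorm (divR3 u) 2 volume := by
  have hsq : ∀ {F : Type} [NormedAddCommGroup F] (f : R3 → F),
      eLpNorm f 2 volume ^ 2 = ∫⁻ x, ENNReal.ofReal (‖f x‖ ^ 2) := fun f => by
    have h := eLpNorm_nnreal_pow_eq_lintegral (μ := (volume : Measure R3)) (f := f) (p := 2)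
      two_ne_zero
    simp only [NNReal.coe_ofNat, ENNReal.rpow_ofNat, ENNReal.coe_ofNat] at h
    rw [h]
    refine lintegral_congr fun x => ?_
    rw [ENNReal.ofReal_pow (norm_nonneg _), ofReal_norm]
  have hcu := continuous_curlR3 hu
  have hdu := continuous_divR3 hu
  have hfr : Continuous (frobSq u) := continuous_finsetSum _ fun i _ =>
    continuous_finsetSum _ fun j _ => ((EuclideanSpace.proj (𝕜 := ℝ) j).continuous.comp
      ((hu.continuous_fderiv (by simp)).clm_apply continuous_const)).pow 2
  have hfrc : HasCompactSupport (frobSq u) := by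
    refine (hc.fderiv (𝕜 := ℝ)).mono fun x hx => ?_
    contrapose! hx
    simp only [Function.mem_support, not_not] at hx
    simp [frobSq, hx]
  have hfr0 : ∀ x, 0 ≤ frobSq u x := fun x => (sq_nonneg _).trans (norm_fderiv_sq_le_frobSq u x)
  have hHc : HasCompactSupport (fun x => ‖curlR3 u x‖ ^ 2 + divR3 u x ^ 2) :=
    HasCompactSupport.add
      ((hasCompactSupport_curlR3 hc).comp_left (g := fun v : R3 => ‖v‖ ^ 2) (by simp))
      ((hasCompactSupport_divR3 hc).comp_left (g := fun t : ℝ => t ^ 2) (by simp))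
  have hHi := ((hcu.norm.pow 2).add (hdu.pow 2)).integrable_of_hasCompactSupport (μ := volume) hHc
  have hmain : eLpNorm (fderiv ℝ u) 2 volume ^ 2 ≤
      eLpNorm (curlR3 u) 2 volume ^ 2 + eLpNorm (divR3 u) 2 volume ^ 2 := by
    rw [hsq, hsq, hsq]
    calc ∫⁻ x, ENNReal.ofReal (‖fderiv ℝ u x‖ ^ 2)
        ≤ ∫⁻ x, ENNReal.ofReal (frobSq u x) :=
          lintegral_mono fun x => ENNReal.ofReal_le_ofReal (norm_fderiv_sq_le_frobSq u x)
      _ = ENNReal.ofReal (∫ x, frobSq u x) :=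
          (ofReal_integral_eq_lintegral_ofReal (hfr.integrable_of_hasCompactSupport hfrc)
            (Filter.Eventually.of_forall hfr0)).symm
      _ = ∫⁻ x, ENNReal.ofReal (‖curlR3 u x‖ ^ 2 + divR3 u x ^ 2) := by
          rw [integral_frobSq hu hc]
          exact ofReal_integral_eq_lintegral_ofReal hHi
            (Filter.Eventually.of_forall fun x => by positivity)
      _ = ∫⁻ x, (ENNReal.ofReal (‖curlR3 u x‖ ^ 2) + ENNReal.ofReal (‖divR3 u x‖ ^ 2)) := by
          refine lintegral_congr fun x => ?_
          rw [ENNReal.ofReal_add (by positivity) (by positivity), Real.norm_eq_abs, sq_abs]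
      _ = _ := lintegral_add_left (hcu.norm.pow 2).measurable.ennreal_ofReal _
  refine (ENNReal.pow_le_pow_left_iff two_ne_zero).1 (hmain.trans ?_)
  rw [add_sq]
  calc _ ≤ eLpNorm (curlR3 u) 2 volume ^ 2 +
        2 * eLpNorm (curlR3 u) 2 volume * eLpNorm (divR3 u) 2 volume +
        eLpNorm (divR3 u) 2 volume ^ 2 := by gcongr; exact le_self_add
    _ = _ := rfl

theorem fderiv_mollify_coord (φ : ContDiffBump (0 : R3)) {u : R3 → R3}
    (hu : LocallyIntegrable u volume) (x v : R3) (j : Fin 3) :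
    fderiv ℝ (mollify φ u) x v j = -∫ y, fderiv ℝ (kernel φ x) y v * u y j := by
  have hk := contDiff_kernel φ x
  have h1 : Integrable (fun y => fderiv ℝ (kernel φ x) y v • u y) volume :=
    hu.integrable_smul_left_of_hasCompactSupport
      ((hk.continuous_fderiv (by simp)).clm_apply continuous_const)
      ((hasCompactSupport_kernel φ x).fderiv_apply (𝕜 := ℝ) v)
  have h2 : fderiv ℝ (mollify φ u) x v = -∫ y, fderiv ℝ (kernel φ x) y v • u y := by
    rw [fderiv_mollify φ hu, ← integral_neg]
    congr 1
    ext1 y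
    rw [fderiv_kernel, neg_smul, neg_neg]
  have h3 := (EuclideanSpace.proj (𝕜 := ℝ) j).integral_comp_comm h1
  rw [h2]
  simp only [PiLp.neg_apply]
  exact congrArg Neg.neg h3.symm

theorem integrable_fderiv_kernel_mul (φ : ContDiffBump (0 : R3)) {u : R3 → R3}
    (hu : LocallyIntegrable u volume) (x v : R3) (j : Fin 3) :
    Integrable (fun y => fderiv ℝ (kernel φ x) y v * u y j) volume :=
  (EuclideanSpace.proj (𝕜 := ℝ) j).integrable_comp
    (hu.integrable_smul_left_of_hasCompactSupport
      (((contDiff_kernel φ x).continuous_fderiv (by simp)).clm_apply continuous_const)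
      ((hasCompactSupport_kernel φ x).fderiv_apply (𝕜 := ℝ) v))

theorem HasWeakDivR3.div_mollify {u : R3 → R3} {ρ : R3 → ℝ} (h : HasWeakDivR3 u ρ)
    (hu : LocallyIntegrable u volume) (φ : ContDiffBump (0 : R3)) (x : R3) :
    divR3 (mollify φ u) x = mollify φ ρ x := by
  have h1 := h (kernel φ x) (contDiff_kernel φ x) (hasCompactSupport_kernel φ x)
  rw [divR3, mollify_apply]
  simp only [fderiv_mollify_coord φ hu]
  rw [Finset.sum_neg_distrib, ← integral_finsetSum _ fun i _ =>
    integrable_fderiv_kernel_mul φ hu x (stdVec i) i, neg_eq_iff_eq_neg]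
  calc ∫ y, ∑ i, fderiv ℝ (kernel φ x) y (stdVec i) * u y i
      = ∫ y, fderiv ℝ (kernel φ x) y (u y) := by
        congr 1
        ext y
        rw [← inner_grad, inner_R3, Fin.sum_univ_three]
        simp
    _ = _ := by
        rw [h1]
        congr 2
        ext y
        simp [kernel, mul_comm]

theorem HasWeakCurlR3.curl_mollify {u B : R3 → R3} (h : HasWeakCurlR3 u B)
    (hu : LocallyIntegrable u volume) (hB : LocallyIntegrable B volume)
    (φ : ContDiffBump (0 : R3)) (x : R3) :
    curlR3 (mollify φ u) x = mollify φ B x := by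
  have h0 : ∀ m, mollify φ B x m =
      ∫ y, inner ℝ (u y) (cross (grad (kernel φ x) y) (stdVec m)) := fun m => by
    have h1 := h (fun y => kernel φ x y • stdVec m) ((contDiff_kernel φ x).smul contDiff_const)
      (hasCompactSupport_kernel φ x).smul_right
    rw [mollify_apply_coord φ hB]
    refine Eq.trans ?_ (h1.symm.trans ?_)
    · congr 1
      ext y
      rw [inner_smul_right, inner_stdVec, smul_eq_mul]
    · congr 1
      ext y
      rw [curlR3_smul (contDiff_kernel φ x) contDiff_const]
      congr 1
      have : curlR3 (fun _ => (stdVec m : R3)) y = 0 := by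
        ext i
        fin_cases i <;> simp [curlR3]
      rw [this]
      simp
  have hi := integrable_fderiv_kernel_mul φ hu x
  ext m
  rw [h0]
  fin_cases m
  · change fderiv ℝ (mollify φ u) x (stdVec 1) 2 - fderiv ℝ (mollify φ u) x (stdVec 2) 1 = _
    rw [fderiv_mollify_coord φ hu, fderiv_mollify_coord φ hu, sub_neg_eq_add, neg_add_eq_sub,
      ← integral_sub (hi _ _) (hi _ _)]
    congr 1
    ext y
    rw [inner_R3]
    simp [cross]
    ring
  · change fderiv ℝ (mollify φ u) x (stdVec 2) 0 - fderiv ℝ (mollify φ u) x (stdVec 0) 2 = _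
    rw [fderiv_mollify_coord φ hu, fderiv_mollify_coord φ hu, sub_neg_eq_add, neg_add_eq_sub,
      ← integral_sub (hi _ _) (hi _ _)]
    congr 1
    ext y
    rw [inner_R3]
    simp [cross]
    ring
  · change fderiv ℝ (mollify φ u) x (stdVec 0) 1 - fderiv ℝ (mollify φ u) x (stdVec 1) 0 = _
    rw [fderiv_mollify_coord φ hu, fderiv_mollify_coord φ hu, sub_neg_eq_add, neg_add_eq_sub,
      ← integral_sub (hi _ _) (hi _ _)]
    congr 1
    ext y
    rw [inner_R3]
    simp [cross]
    ring

/-- A compactly supported field with curl and divergence in `L²` lies in `L⁶`. -/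
theorem eLpNorm_six_le_curl_add_div {u B : R3 → R3} {ρ : R3 → ℝ} (hcurl : HasWeakCurlR3 u B)
    (hdiv : HasWeakDivR3 u ρ) (hu : LocallyIntegrable u volume) (hB : LocallyIntegrable B volume)
    (hρ : AEStronglyMeasurable ρ volume) (hc : HasCompactSupport u) :
    eLpNorm u 6 volume ≤ gns 2 * (eLpNorm B 2 volume + eLpNorm ρ 2 volume) := by
  refine eLpNorm_le_of_forall_mollify_le hu fun φ => ?_
  have hs := contDiff_mollify φ hu
  have hsc := hasCompactSupport_mollify φ hc
  have h1 := eLpNorm_le_eLpNorm_fderiv_of_eq_inner (volume : Measure R3)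
    (hs.of_le (by simp)) hsc (p := 2) (p' := 6) one_le_two (by simp) (by simp; norm_num)
  refine h1.trans (mul_le_mul_right ((eLpNorm_fderiv_le_curl_add_div hs hsc).trans ?_) _)
  have e1 : curlR3 (mollify φ u) = mollify φ B := funext (hcurl.curl_mollify hu hB φ)
  have e2 : divR3 (mollify φ u) = mollify φ ρ := funext (hdiv.div_mollify hu φ)
  rw [e1, e2]
  exact add_le_add (eLpNorm_mollify_le φ hB.aestronglyMeasurable one_le_two)
    (eLpNorm_mollify_le φ hρ one_le_two)

/-! ### Cut-off functions and global integrability -/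

/-- Cut-offs at radius `n + 1`. Their gradients are `O(1 / (n + 1))` and vanish for
`r > 2 (n + 1)`, hence are `O(lam^{1/2})` uniformly in `n`. This is exactly the weight in which
pulled-back `L²` covector fields are square integrable. -/
theorem exists_cutoff : ∃ C : ℝ≥0, ∃ χ : ℕ → R3 → ℝ,
    (∀ n, ContDiff ℝ ∞ (χ n)) ∧ (∀ n, HasCompactSupport (χ n)) ∧ (∀ n x, ‖χ n x‖ ≤ 1) ∧
    (∀ x, ∀ᶠ n in Filter.atTop, χ n x = 1 ∧ grad (χ n) x = 0) ∧
    ∀ n x, ‖grad (χ n) x‖ ≤ C * Real.sqrt (lam x) := by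
  let χ₀ : ContDiffBump (0 : R3) := ⟨1, 2, one_pos, one_lt_two⟩
  have hs : ContDiff ℝ ∞ χ₀ := χ₀.contDiff
  obtain ⟨K, hK⟩ := (hs.continuous_fderiv (by simp)).norm.bounded_above_of_compact_support
    (χ₀.hasCompactSupport.fderiv (𝕜 := ℝ)).norm
  have hK0 : 0 ≤ K := (norm_nonneg _).trans (hK 0)
  simp only [norm_norm] at hK
  have hN : ∀ n : ℕ, (0 : ℝ) < (n : ℝ) + 1 := fun n => by positivity
  have hfd : ∀ (n : ℕ) x v, fderiv ℝ (fun x : R3 => χ₀ (((n : ℝ) + 1)⁻¹ • x)) x v =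
      ((n : ℝ) + 1)⁻¹ * fderiv ℝ χ₀ (((n : ℝ) + 1)⁻¹ • x) v := fun n x v => by
    have h := ((hs.differentiable (by simp)).differentiableAt.hasFDerivAt
      (x := ((n : ℝ) + 1)⁻¹ • x)).comp x ((hasFDerivAt_id x).const_smul ((n : ℝ) + 1)⁻¹)
    refine (congrArg (fun L : R3 →L[ℝ] ℝ => L v) h.fderiv).trans ?_
    simp
  refine ⟨⟨2 * K, by positivity⟩, fun n x => χ₀ (((n : ℝ) + 1)⁻¹ • x), fun n => ?_, fun n => ?_,
    fun n x => ?_, fun x => ?_, fun n x => ?_⟩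
  · exact hs.comp (contDiff_const_smul _)
  · exact χ₀.hasCompactSupport.comp_homeomorph (Homeomorph.smulOfNeZero _ (inv_ne_zero (hN n).ne'))
  · rw [Real.norm_of_nonneg χ₀.nonneg]
    exact χ₀.le_one
  · obtain ⟨N, hN'⟩ := exists_nat_gt ‖x‖
    filter_upwards [Filter.eventually_ge_atTop N] with n hn
    have hxn : ‖x‖ < (n : ℝ) + 1 := by
      have : (N : ℝ) ≤ n := by exact_mod_cast hn
      linarith
    have hball : ((n : ℝ) + 1)⁻¹ • x ∈ Metric.ball (0 : R3) 1 := by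
      rw [mem_ball_zero_iff, norm_smul, norm_inv, Real.norm_of_nonneg (hN n).le,
        inv_mul_lt_one₀ (hN n)]
      exact hxn
    refine ⟨χ₀.one_of_mem_closedBall (Metric.ball_subset_closedBall hball), ?_⟩
    have h1 : (χ₀ : R3 → ℝ) =ᶠ[nhds (((n : ℝ) + 1)⁻¹ • x)] fun _ => 1 := by
      filter_upwards [Metric.isOpen_ball.mem_nhds hball] with y hy
      exact χ₀.one_of_mem_closedBall (Metric.ball_subset_closedBall hy)
    ext i
    rw [grad_apply, hfd, h1.fderiv_eq]
    simp
  · have hl := lam_pos x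
    refine (norm_grad_le _ x).trans ?_
    by_cases hx : ‖x‖ ≤ 2 * ((n : ℝ) + 1)
    · have h1 : ‖fderiv ℝ (fun x : R3 => χ₀ (((n : ℝ) + 1)⁻¹ • x)) x‖ ≤ ((n : ℝ) + 1)⁻¹ * K := by
        refine ContinuousLinearMap.opNorm_le_bound _ (by have := hN n; positivity) fun v => ?_
        rw [hfd, norm_mul, norm_inv, Real.norm_of_nonneg (hN n).le, mul_assoc]
        have := hN n
        gcongr
        exact ContinuousLinearMap.le_of_opNorm_le _ (hK _) v
      have h2 : ((n : ℝ) + 1)⁻¹ ≤ 2 * Real.sqrt (lam x) := by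
        refine (sq_le_sq₀ (by have := hN n; positivity) (by positivity)).1 ?_
        rw [mul_pow, Real.sq_sqrt hl.le, lam, inv_pow, inv_le_iff_one_le_mul₀ (by
          have := hN n; positivity)]
        have hx2 : ‖x‖ ^ 2 ≤ (2 * ((n : ℝ) + 1)) ^ 2 := by gcongr
        have hn1 : (1 : ℝ) ≤ ((n : ℝ) + 1) ^ 2 := by
          have : (0 : ℝ) ≤ n := n.cast_nonneg
          nlinarith
        have : 2 ^ 2 * (2 / (1 + ‖x‖ ^ 2)) * ((n : ℝ) + 1) ^ 2 =
            8 * ((n : ℝ) + 1) ^ 2 / (1 + ‖x‖ ^ 2) := by ring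
        rw [this, one_le_div (by positivity)]
        nlinarith
      calc _ ≤ ((n : ℝ) + 1)⁻¹ * K := h1
        _ ≤ 2 * Real.sqrt (lam x) * K := by gcongr
        _ = 2 * K * Real.sqrt (lam x) := by ring
    · push Not at hx
      have h1 : (χ₀ : R3 → ℝ) =ᶠ[nhds (((n : ℝ) + 1)⁻¹ • x)] fun _ => 0 := by
        have hmem : 2 < ‖((n : ℝ) + 1)⁻¹ • x‖ := by
          rw [norm_smul, norm_inv, Real.norm_of_nonneg (hN n).le, inv_mul_eq_div,
            lt_div_iff₀ (hN n)]
          exact hx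
        filter_upwards [(isOpen_lt continuous_const continuous_norm).mem_nhds hmem] with y hy
        exact χ₀.zero_of_le_dist (by simpa using (le_of_lt hy : (2 : ℝ) ≤ ‖y‖))
      have h2 : fderiv ℝ (fun x : R3 => χ₀ (((n : ℝ) + 1)⁻¹ • x)) x = 0 := by
        ext1 v
        rw [hfd, h1.fderiv_eq]
        simp
      rw [h2, norm_zero]
      exact mul_nonneg (by change (0 : ℝ) ≤ 2 * K; positivity) (Real.sqrt_nonneg _)

/-- Fatou's lemma along a sequence of cut-offs. -/
theorem eLpNorm_le_of_forall_cutoff {E : Type*} [NormedAddCommGroup E] [NormedSpace ℝ E]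
    {f : R3 → E} (hf : AEStronglyMeasurable f volume) {χ : ℕ → R3 → ℝ}
    (hχ : ∀ n, Continuous (χ n)) (hχ1 : ∀ x, ∀ᶠ n in Filter.atTop, χ n x = 1) {p M : ℝ≥0∞}
    (h : ∀ n, eLpNorm (fun x => χ n x • f x) p volume ≤ M) : eLpNorm f p volume ≤ M := by
  refine (Lp.eLpNorm_lim_le_liminf_eLpNorm
    (fun n => (hχ n).aestronglyMeasurable.smul hf) f
    (Filter.Eventually.of_forall fun x => ?_)).trans ?_
  · refine tendsto_const_nhds.congr' ?_
    filter_upwards [hχ1 x] with n hn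
    exact (by rw [hn, one_smul] : f x = χ n x • f x)
  · refine (Filter.liminf_le_liminf (Filter.Eventually.of_forall h)).trans ?_
    simp

theorem eLpNorm_mul_le_of_norm_le {E F : Type*} [NormedAddCommGroup E] [NormedAddCommGroup F]
    {f : R3 → E} {g : R3 → F} {C : ℝ≥0} {p : ℝ≥0∞} (h : ∀ x, ‖f x‖ ≤ C * ‖g x‖) :
    eLpNorm f p volume ≤ C * eLpNorm g p volume := by
  have := eLpNorm_le_nnreal_smul_eLpNorm_of_ae_le_mul (μ := (volume : Measure R3)) (c := C)
    (Filter.Eventually.of_forall fun x => (by exact_mod_cast h x : ‖f x‖₊ ≤ C * ‖g x‖₊)) p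
  simpa [ENNReal.smul_def] using this

/-- A divergence free potential with `lam^{1/2} a ∈ L²` and curl in `L²` lies in `L⁶`: the error
terms `|∇χ| |a|` in curl and divergence of `χ a` are bounded in `L²`, uniformly in the cut-off `χ`. -/
theorem memLp_six_of_curl {a B : R3 → R3} (hcurl : HasWeakCurlR3 a B)
    (hdiv : HasWeakDivR3 a fun _ => 0) (hB : MemLp B 2 volume)
    (ha : MemLp (fun x => Real.sqrt (lam x) • a x) 2 volume) : MemLp a 6 volume := by
  obtain ⟨C, χ, hχs, hχc, hχ1, hχe, hχg⟩ := exists_cutoff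
  have hsq : ∀ x, Real.sqrt (lam x) ≠ 0 := fun x => (Real.sqrt_pos.2 (lam_pos x)).ne'
  have hal : LocallyIntegrable a volume := by
    have h := (ha.locallyIntegrable (by norm_num)).continuous_smul
      ((contDiff_lam.continuous.sqrt).inv₀ hsq)
    simpa [smul_smul, inv_mul_cancel₀ (hsq _)] using h
  have hBl : LocallyIntegrable B volume := hB.locallyIntegrable (by norm_num)
  have hgm : ∀ n, Continuous (grad (χ n)) := fun n => continuous_grad (hχs n)
  set M : ℝ≥0∞ := eLpNorm (fun x => Real.sqrt (lam x) • a x) 2 volume with hM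
  have hgrad : ∀ n x, ‖grad (χ n) x‖ * ‖a x‖ ≤ C * ‖Real.sqrt (lam x) • a x‖ := fun n x => by
    rw [norm_smul, Real.norm_of_nonneg (Real.sqrt_nonneg _), ← mul_assoc]
    gcongr
    exact hχg n x
  have hcr : ∀ n, AEStronglyMeasurable (fun x => cross (grad (χ n) x) (a x)) volume := fun n =>
    (continuous_cross (u := fun p : R3 × R3 => p.1) (v := fun p => p.2) continuous_fst
      continuous_snd).comp_aestronglyMeasurable
      ((hgm n).aestronglyMeasurable.prodMk hal.aestronglyMeasurable)
  have hbd : ∀ n, eLpNorm (fun x => χ n x • a x) 6 volume ≤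
      gns 2 * ((eLpNorm B 2 volume + C * M) + C * M) := fun n => by
    have h1 := hcurl.smul hal hBl (hχs n)
    have h2 := hdiv.smul hal (locallyIntegrable_zero) (hχs n)
    have hB' : AEStronglyMeasurable (fun x => χ n x • B x) volume :=
      (hχs n).continuous.aestronglyMeasurable.smul hB.1
    have e1 : eLpNorm (fun x => χ n x • B x + cross (grad (χ n) x) (a x)) 2 volume ≤
        eLpNorm B 2 volume + C * M := by
      refine (eLpNorm_add_le hB' (hcr n) one_le_two).trans (add_le_add ?_ ?_)
      · refine eLpNorm_mono fun x => ?_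
        rw [norm_smul]
        exact mul_le_of_le_one_left (norm_nonneg _) (hχ1 n x)
      · exact eLpNorm_mul_le_of_norm_le fun x => (norm_cross_le _ _).trans (hgrad n x)
    have e2 : eLpNorm (fun x => χ n x * 0 + inner ℝ (grad (χ n) x) (a x)) 2 volume ≤ C * M := by
      refine eLpNorm_mul_le_of_norm_le fun x => ?_
      rw [mul_zero, zero_add]
      exact (norm_inner_le_norm _ _).trans (hgrad n x)
    have hl1 : LocallyIntegrable (fun x => χ n x • B x + cross (grad (χ n) x) (a x)) volume := by
      have h3 : MemLp (fun x => χ n x • B x + cross (grad (χ n) x) (a x)) 2 volume :=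
        ⟨hB'.add (hcr n), e1.trans_lt (ENNReal.add_lt_top.2
          ⟨hB.2, ENNReal.mul_lt_top ENNReal.coe_lt_top ha.2⟩)⟩
      exact h3.locallyIntegrable (by norm_num)
    have h4 := eLpNorm_six_le_curl_add_div h1 h2 (hal.continuous_smul (hχs n).continuous) hl1
      (by simpa only [mul_zero, zero_add] using
        (hgm n).aestronglyMeasurable.inner hal.aestronglyMeasurable) ((hχc n).smul_right)
    exact h4.trans (mul_le_mul_right (add_le_add e1 e2) _)
  refine ⟨hal.aestronglyMeasurable, (eLpNorm_le_of_forall_cutoff hal.aestronglyMeasurable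
    (fun n => (hχs n).continuous) (fun x => (hχe x).mono fun n h => h.1) hbd).trans_lt ?_⟩
  have hCM : C * M < ⊤ := ENNReal.mul_lt_top ENNReal.coe_lt_top ha.2
  exact ENNReal.mul_lt_top ENNReal.coe_lt_top
    (ENNReal.add_lt_top.2 ⟨ENNReal.add_lt_top.2 ⟨hB.2, hCM⟩, hCM⟩)

/-! ### Square integrability of the gradient -/

theorem holderTriple_six_two : ENNReal.HolderTriple 6 2 ((3 / 2 : ℝ≥0) : ℝ≥0∞) where
  inv_add_inv_eq_inv := by
    have h6 : (6 : ℝ≥0∞) = ((6 : ℝ≥0) : ℝ≥0∞) := rfl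
    have h2 : (2 : ℝ≥0∞) = ((2 : ℝ≥0) : ℝ≥0∞) := rfl
    rw [h6, h2, ← ENNReal.coe_inv (by norm_num), ← ENNReal.coe_inv (by norm_num),
      ← ENNReal.coe_inv (by norm_num), ← ENNReal.coe_add]
    norm_num

theorem holderTriple_three_six : ENNReal.HolderTriple 3 6 2 where
  inv_add_inv_eq_inv := by
    have h6 : (6 : ℝ≥0∞) = ((6 : ℝ≥0) : ℝ≥0∞) := rfl
    have h3 : (3 : ℝ≥0∞) = ((3 : ℝ≥0) : ℝ≥0∞) := rfl
    have h2 : (2 : ℝ≥0∞) = ((2 : ℝ≥0) : ℝ≥0∞) := rfl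
    rw [h6, h3, h2, ← ENNReal.coe_inv (by norm_num), ← ENNReal.coe_inv (by norm_num),
      ← ENNReal.coe_inv (by norm_num), ← ENNReal.coe_add]
    norm_num

theorem holderTriple_four_twelve : ENNReal.HolderTriple 4 12 3 where
  inv_add_inv_eq_inv := by
    have h12 : (12 : ℝ≥0∞) = ((12 : ℝ≥0) : ℝ≥0∞) := rfl
    have h3 : (3 : ℝ≥0∞) = ((3 : ℝ≥0) : ℝ≥0∞) := rfl
    have h4 : (4 : ℝ≥0∞) = ((4 : ℝ≥0) : ℝ≥0∞) := rfl
    rw [h12, h3, h4, ← ENNReal.coe_inv (by norm_num), ← ENNReal.coe_inv (by norm_num),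
      ← ENNReal.coe_inv (by norm_num), ← ENNReal.coe_add]
    norm_num

/-- Interpolation of `L³` between `L²` and `L⁶`. -/
theorem eLpNorm_three_sq_le {E : Type*} [NormedAddCommGroup E] {f : R3 → E}
    (hf : AEStronglyMeasurable f volume) :
    eLpNorm f 3 volume * eLpNorm f 3 volume ≤ eLpNorm f 2 volume * eLpNorm f 6 volume := by
  have := holderTriple_four_twelve
  have hm : AEStronglyMeasurable (fun x => ‖f x‖ ^ (1 / 2 : ℝ)) volume :=
    (hf.norm.aemeasurable.pow_const _).aestronglyMeasurable
  have h1 := eLpNorm_smul_le_mul_eLpNorm (p := 4) (q := 12) (r := 3) hm hm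
  have e1 : eLpNorm ((fun x => ‖f x‖ ^ (1 / 2 : ℝ)) • fun x => ‖f x‖ ^ (1 / 2 : ℝ)) 3 volume =
      eLpNorm f 3 volume := by
    rw [← eLpNorm_norm f]
    congr 1
    ext x
    simp only [Pi.smul_apply', smul_eq_mul]
    rw [← Real.rpow_add_of_nonneg (norm_nonneg _) (by norm_num) (by norm_num)]
    norm_num
  have e2 : (4 : ℝ≥0∞) * ENNReal.ofReal (1 / 2) = 2 := by
    rw [show (4 : ℝ≥0∞) = ENNReal.ofReal 4 by simp, ← ENNReal.ofReal_mul (by norm_num)]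
    norm_num
  have e3 : (12 : ℝ≥0∞) * ENNReal.ofReal (1 / 2) = 6 := by
    rw [show (12 : ℝ≥0∞) = ENNReal.ofReal 12 by simp, ← ENNReal.ofReal_mul (by norm_num)]
    norm_num
  rw [e1, eLpNorm_norm_rpow _ (by norm_num), eLpNorm_norm_rpow _ (by norm_num), e2, e3] at h1
  have e4 : ∀ A : ℝ≥0∞, A ^ (1 / 2 : ℝ) * A ^ (1 / 2 : ℝ) = A := fun A => by
    rw [← ENNReal.rpow_add_of_nonneg _ _ (by norm_num) (by norm_num)]
    norm_num
  calc _ ≤ _ := mul_le_mul' h1 h1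
    _ = _ := by rw [mul_mul_mul_comm, e4, e4]

theorem le_max_of_mul_self_le {Y P Q : ℝ≥0∞} (hY : Y ≠ ⊤) (h : Y * Y ≤ P + Q * Y) :
    Y ≤ max 1 (P + Q) := by
  rcases le_total Y 1 with h1 | h1
  · exact h1.trans (le_max_left _ _)
  · refine le_trans ?_ (le_max_right _ _)
    have h2 : Y * Y ≤ (P + Q) * Y := by
      refine h.trans ?_
      rw [add_mul]
      gcongr
      exact le_mul_of_one_le_right' h1
    exact (ENNReal.mul_le_mul_iff_left (zero_lt_one.trans_le h1).ne' hY).1 h2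

theorem sqrt_lam_le (x : R3) : Real.sqrt (lam x) ≤ 2 := by
  refine Real.sqrt_le_iff.2 ⟨by norm_num, ?_⟩
  rw [lam, div_le_iff₀ (by positivity)]
  nlinarith [sq_nonneg ‖x‖]

/-- The uniform bound behind `HasWeakGradR3.memLp_two`. A cut-off function `χψ` lies in `L³` by the
Sobolev inequality with exponents `3/2` and `3`; the one with exponents `2` and `6`, interpolated
with `L²`, then bounds `‖χψ‖₃²` by an affine function of `‖χψ‖₃`, uniformly in `χ`. -/
theorem HasWeakGradR3.eLpNorm_three_le {ψ : R3 → ℂ} {V W : R3 → C3}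
    (h : HasWeakGradR3 ψ fun x => V x - ψ x • W x) (hψ : MemLp ψ 2 volume)
    (hV : MemLp V 2 volume) (hW : MemLp W 6 volume) {χ : R3 → ℝ} (hχs : ContDiff ℝ ∞ χ)
    (hχc : HasCompactSupport χ) (hχ1 : ∀ x, ‖χ x‖ ≤ 1) {K : ℝ≥0} (hχg : ∀ x, ‖grad χ x‖ ≤ K) :
    eLpNorm (fun x => (χ x : ℂ) * ψ x) 3 volume ≤ max 1
      (eLpNorm ψ 2 volume * (gns 2 * (eLpNorm V 2 volume + K * eLpNorm ψ 2 volume)) +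
        eLpNorm ψ 2 volume * (gns 2 * eLpNorm W 6 volume)) := by
  have := holderTriple_six_two
  have := holderTriple_three_six
  have hsymm : ENNReal.HolderTriple 2 6 ((3 / 2 : ℝ≥0) : ℝ≥0∞) := ENNReal.HolderTriple.symm
  have h32 : (1 : ℝ≥0∞) ≤ ((3 / 2 : ℝ≥0) : ℝ≥0∞) := by
    exact_mod_cast (by rw [le_div_iff₀ (by norm_num)]; norm_num : (1 : ℝ≥0) ≤ 3 / 2)
  have hψW : MemLp (fun x => ψ x • W x) ((3 / 2 : ℝ≥0) : ℝ≥0∞) volume := hW.smul hψ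
  have hψl := hψ.locallyIntegrable (by norm_num)
  have hGl : LocallyIntegrable (fun x => V x - ψ x • W x) volume :=
    (hV.locallyIntegrable (by norm_num)).sub (hψW.locallyIntegrable h32)
  have hcχ : Continuous fun x => (χ x : ℂ) := Complex.continuous_ofReal.comp hχs.continuous
  have hcg : Continuous fun x => toC (grad χ x) := continuous_toC.comp (continuous_grad hχs)
  have hsχ : HasCompactSupport fun x => (χ x : ℂ) := hχc.comp_left Complex.ofReal_zero
  have hsg : HasCompactSupport fun x => toC (grad χ x) := by
    refine (hχc.fderiv (𝕜 := ℝ)).mono fun x hx => ?_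
    contrapose! hx
    have hx' : fderiv ℝ χ x = 0 := by simpa using hx
    have : toC (grad χ x) = 0 := by
      ext i
      simp [grad_apply, hx']
    simpa using this
  have hnχ : ∀ x, ‖(χ x : ℂ)‖ ≤ 1 := fun x => by
    rw [Complex.norm_real]
    exact hχ1 x
  have hχψ2 : eLpNorm (fun x => (χ x : ℂ) * ψ x) 2 volume ≤ eLpNorm ψ 2 volume :=
    eLpNorm_mono fun x => by
      rw [norm_mul]
      exact mul_le_of_le_one_left (norm_nonneg _) (hnχ x)
  have hχψm : AEStronglyMeasurable (fun x => (χ x : ℂ) * ψ x) volume :=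
    hcχ.aestronglyMeasurable.mul hψ.1
  have hgr : HasWeakGradR3 (fun x => (χ x : ℂ) * ψ x) fun x =>
      (χ x : ℂ) • V x - ((χ x : ℂ) * ψ x) • W x + ψ x • toC (grad χ x) := by
    have h1 := h.smul hψl hGl hχs
    simpa only [smul_sub, smul_smul] using h1
  have hm1 : MemLp (fun x => (χ x : ℂ) • V x) ((3 / 2 : ℝ≥0) : ℝ≥0∞) volume :=
    hV.smul (hcχ.memLp_of_hasCompactSupport hsχ (p := 6))
  have hm2 : MemLp (fun x => ((χ x : ℂ) * ψ x) • W x) ((3 / 2 : ℝ≥0) : ℝ≥0∞) volume :=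
    hW.smul (⟨hχψm, hχψ2.trans_lt hψ.2⟩ : MemLp _ 2 volume)
  have hm3 : MemLp (fun x => ψ x • toC (grad χ x)) ((3 / 2 : ℝ≥0) : ℝ≥0∞) volume :=
    (hcg.memLp_of_hasCompactSupport hsg (p := 6)).smul hψ
  have hsupp : HasCompactSupport fun x => (χ x : ℂ) * ψ x := hsχ.mul_right
  have hlψ : LocallyIntegrable (fun x => (χ x : ℂ) * ψ x) volume := hψl.continuous_smul hcχ
  have hmG : MemLp (fun x => (χ x : ℂ) • V x - ((χ x : ℂ) * ψ x) • W x + ψ x • toC (grad χ x))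
      ((3 / 2 : ℝ≥0) : ℝ≥0∞) volume := (hm1.sub hm2).add hm3
  have hlG := hmG.locallyIntegrable h32
  have hfin : eLpNorm (fun x => (χ x : ℂ) * ψ x) 3 volume ≠ ⊤ := by
    have h4 := hgr.eLpNorm_le hlψ hlG hsupp (p := 3 / 2) (p' := 3)
      (by rw [le_div_iff₀ (by norm_num)]; norm_num) (by norm_num)
    exact (h4.trans_lt (ENNReal.mul_lt_top ENNReal.coe_lt_top hmG.2)).ne
  have hbd : eLpNorm (fun x => (χ x : ℂ) * ψ x) 6 volume ≤ gns 2 *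
      (eLpNorm V 2 volume + eLpNorm (fun x => (χ x : ℂ) * ψ x) 3 volume * eLpNorm W 6 volume +
        K * eLpNorm ψ 2 volume) := by
    have h4 := hgr.eLpNorm_le hlψ hlG hsupp (p := 2) (p' := 6) (by norm_num) (by norm_num)
    have e1 : eLpNorm (fun x => (χ x : ℂ) • V x) 2 volume ≤ eLpNorm V 2 volume := by
      refine eLpNorm_mono fun x => ?_
      rw [norm_smul]
      exact mul_le_of_le_one_left (norm_nonneg _) (hnχ x)
    have e2 : eLpNorm (fun x => ((χ x : ℂ) * ψ x) • W x) 2 volume ≤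
        eLpNorm (fun x => (χ x : ℂ) * ψ x) 3 volume * eLpNorm W 6 volume :=
      eLpNorm_smul_le_mul_eLpNorm (φ := fun x => (χ x : ℂ) * ψ x) (p := 3) (q := 6) (r := 2)
        hW.1 hχψm
    have e3 : eLpNorm (fun x => ψ x • toC (grad χ x)) 2 volume ≤ K * eLpNorm ψ 2 volume := by
      refine eLpNorm_mul_le_of_norm_le fun x => ?_
      rw [norm_smul, norm_toC, mul_comm]
      gcongr
      exact hχg x
    have e4 := (eLpNorm_add_le (hm1.1.sub hm2.1) hm3.1 one_le_two).trans
      (add_le_add ((eLpNorm_sub_le hm1.1 hm2.1 one_le_two).trans (add_le_add e1 e2)) e3)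
    exact h4.trans (mul_le_mul_right e4 _)
  refine le_max_of_mul_self_le hfin ?_
  calc _ ≤ _ := eLpNorm_three_sq_le hχψm
    _ ≤ _ := mul_le_mul' hχψ2 hbd
    _ = _ := by ring

/-- If the covariant gradient `V = ∇ψ + ψ W` of `ψ ∈ L²` is square integrable and `W ∈ L⁶`, then
`ψ ∈ L³`, so that `ψ W` and hence `∇ψ` are square integrable. -/
theorem HasWeakGradR3.memLp_two {ψ : R3 → ℂ} {V W : R3 → C3}
    (h : HasWeakGradR3 ψ fun x => V x - ψ x • W x) (hψ : MemLp ψ 2 volume)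
    (hV : MemLp V 2 volume) (hW : MemLp W 6 volume) :
    MemLp (fun x => V x - ψ x • W x) 2 volume := by
  have := holderTriple_three_six
  obtain ⟨C, χ, hχs, hχc, hχ1, hχe, hχg⟩ := exists_cutoff
  have hg : ∀ n x, ‖grad (χ n) x‖ ≤ (C * 2 : ℝ≥0) := fun n x => by
    rw [NNReal.coe_mul]
    exact (hχg n x).trans (mul_le_mul_of_nonneg_left (sqrt_lam_le x) C.coe_nonneg)
  have h3 := fun n => h.eLpNorm_three_le hψ hV hW (hχs n) (hχc n) (hχ1 n) (hg n)
  have hfin : max 1 (eLpNorm ψ 2 volume * (gns 2 * (eLpNorm V 2 volume +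
      (C * 2 : ℝ≥0) * eLpNorm ψ 2 volume)) +
        eLpNorm ψ 2 volume * (gns 2 * eLpNorm W 6 volume)) < ⊤ :=
    max_lt ENNReal.one_lt_top (ENNReal.add_lt_top.2
      ⟨ENNReal.mul_lt_top hψ.2 (ENNReal.mul_lt_top ENNReal.coe_lt_top
        (ENNReal.add_lt_top.2 ⟨hV.2, ENNReal.mul_lt_top ENNReal.coe_lt_top hψ.2⟩)),
      ENNReal.mul_lt_top hψ.2 (ENNReal.mul_lt_top ENNReal.coe_lt_top hW.2)⟩)
  have hψ3 : MemLp ψ 3 volume := by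
    refine ⟨hψ.1, (eLpNorm_le_of_forall_cutoff hψ.1 (fun n => (hχs n).continuous)
      (fun x => (hχe x).mono fun n h => h.1) fun n => ?_).trans_lt
        hfin⟩
    simpa only [Complex.real_smul] using h3 n
  exact hV.sub (hW.smul hψ3)

/-! ### The Fourier characterization of `H¹` -/

open scoped LineDeriv Laplacian

theorem memLp_coord {G : R3 → C3} {p : ℝ≥0∞} (hG : MemLp G p volume) (j : Fin 3) :
    MemLp (fun x => G x j) p volume :=
  hG.mono ((EuclideanSpace.proj (𝕜 := ℂ) j).continuous.comp_aestronglyMeasurable hG.1)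
    (Filter.Eventually.of_forall fun _ => PiLp.norm_apply_le _ _)

/-- A square integrable weak gradient may be tested with a function which is square integrable
together with its derivative. -/
theorem HasWeakGradR3.integral_mul_fderiv {ψ : R3 → ℂ} {G : R3 → C3} (h : HasWeakGradR3 ψ G)
    (hψ : MemLp ψ 2 volume) (hG : MemLp G 2 volume) {η : R3 → ℝ} (hη : ContDiff ℝ ∞ η)
    (hη2 : MemLp η 2 volume) (j : Fin 3)
    (hη2' : MemLp (fun x => fderiv ℝ η x (stdVec j)) 2 volume) :
    ∫ x, ψ x * (fderiv ℝ η x (stdVec j) : ℂ) = -∫ x, G x j * (η x : ℂ) := by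
  obtain ⟨C, χ, hχs, hχc, hχ1, hχe, hχg⟩ := exists_cutoff
  have hGj := memLp_coord hG j
  have hfd : ∀ n x, fderiv ℝ (fun y => χ n y * η y) x (stdVec j) =
      χ n x * fderiv ℝ η x (stdVec j) + η x * grad (χ n) x j := fun n x => by
    rw [fderiv_fun_mul ((hχs n).differentiable (by simp)).differentiableAt
      (hη.differentiable (by simp)).differentiableAt]
    simp [grad_apply]
  have hn : ∀ n, ∫ x, ψ x * (fderiv ℝ (fun y => χ n y * η y) x (stdVec j) : ℂ) =
      -∫ x, G x j * ((χ n x * η x : ℝ) : ℂ) := fun n => by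
    have hs : ContDiff ℝ ∞ fun y => χ n y * η y := (hχs n).mul hη
    have h1 := h (fun y => (χ n y * η y) • stdVec j) (hs.smul contDiff_const)
      ((hχc n).mul_right.smul_right)
    have h2 : ∀ x, divR3 (fun y => (χ n y * η y) • stdVec j) x =
        fderiv ℝ (fun y => χ n y * η y) x (stdVec j) := fun x => by
      have hd : HasFDerivAt (fun y => (χ n y * η y) • (stdVec j : R3))
          ((fderiv ℝ (fun y => χ n y * η y) x).smulRight (stdVec j)) x :=
        (hs.differentiable (by simp)).differentiableAt.hasFDerivAt.smul_const _
      simp [divR3, hd.fderiv, stdVec_apply]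
    simp only [h2] at h1
    rw [h1]
    congr 2
    ext x
    exact (Finset.sum_eq_single j (fun k _ hk => by simp [stdVec_apply, hk]) (by simp)).trans
      (by simp [stdVec_apply])
  have hL : Filter.Tendsto
      (fun n => ∫ x, ψ x * (fderiv ℝ (fun y => χ n y * η y) x (stdVec j) : ℂ)) Filter.atTop
      (nhds (∫ x, ψ x * (fderiv ℝ η x (stdVec j) : ℂ))) := by
    refine tendsto_integral_of_dominated_convergence
      (fun x => ‖ψ x‖ * (‖fderiv ℝ η x (stdVec j)‖ + C * 2 * ‖η x‖)) (fun n => ?_) ?_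
      (fun n => Filter.Eventually.of_forall fun x => ?_) (Filter.Eventually.of_forall fun x => ?_)
    · refine hψ.1.mul (Complex.continuous_ofReal.comp ?_).aestronglyMeasurable
      exact (((hχs n).mul hη).continuous_fderiv (by simp)).clm_apply continuous_const
    · exact hψ.norm.integrable_mul (hη2'.norm.add (hη2.norm.const_mul _))
    · rw [norm_mul, Complex.norm_real, hfd]
      gcongr
      refine (norm_add_le _ _).trans (add_le_add ?_ ?_)
      · rw [norm_mul]
        exact mul_le_of_le_one_left (norm_nonneg _) (hχ1 n x)
      · rw [norm_mul, mul_comm]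
        gcongr
        exact (PiLp.norm_apply_le _ _).trans ((hχg n x).trans (by gcongr; exact sqrt_lam_le x))
    · refine tendsto_const_nhds.congr' ?_
      filter_upwards [hχe x] with n hx
      rw [hfd, hx.1, hx.2]
      simp
  have hR : Filter.Tendsto (fun n => ∫ x, G x j * ((χ n x * η x : ℝ) : ℂ)) Filter.atTop
      (nhds (∫ x, G x j * (η x : ℂ))) := by
    refine tendsto_integral_of_dominated_convergence (fun x => ‖G x j‖ * ‖η x‖) (fun n => ?_) ?_
      (fun n => Filter.Eventually.of_forall fun x => ?_) (Filter.Eventually.of_forall fun x => ?_)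
    · exact hGj.1.mul (Complex.continuous_ofReal.comp
        ((hχs n).mul hη).continuous).aestronglyMeasurable
    · exact hGj.norm.integrable_mul hη2.norm
    · rw [norm_mul, Complex.norm_real, norm_mul]
      gcongr
      exact mul_le_of_le_one_left (norm_nonneg _) (hχ1 n x)
    · refine tendsto_const_nhds.congr' ?_
      filter_upwards [hχe x] with n hx
      rw [hx.1, one_mul]
  exact tendsto_nhds_unique hL (by simpa only [hn] using hR.neg)

/-- Schwartz test functions are complex valued, the test fields of `HasWeakGradR3` real: real and
imaginary parts are treated separately. -/
theorem HasWeakGradR3.integral_mul_lineDerivOp {ψ : R3 → ℂ} {G : R3 → C3}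
    (h : HasWeakGradR3 ψ G) (hψ : MemLp ψ 2 volume) (hG : MemLp G 2 volume) (g : 𝓢(R3, ℂ))
    (j : Fin 3) : ∫ x, ψ x * (∂_{stdVec j} g) x = -∫ x, G x j * g x := by
  have hGj := memLp_coord hG j
  have key : ∀ L : ℂ →L[ℝ] ℝ, ContDiff ℝ ∞ (fun x => L (g x)) ∧
      MemLp (fun x => L (g x)) 2 volume ∧
      (∀ x, fderiv ℝ (fun x => L (g x)) x (stdVec j) = L ((∂_{stdVec j} g) x)) ∧
      MemLp (fun x => L ((∂_{stdVec j} g) x)) 2 volume := fun L => by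
    refine ⟨L.contDiff.comp (g.smooth ⊤), L.comp_memLp' (g.memLp 2), fun x => ?_,
      L.comp_memLp' ((∂_{stdVec j} g).memLp 2)⟩
    have hd := L.hasFDerivAt.comp x (g.differentiableAt (x := x)).hasFDerivAt
    rw [SchwartzMap.lineDerivOp_apply_eq_fderiv]
    exact congrArg (fun A : R3 →L[ℝ] ℝ => A (stdVec j)) hd.fderiv
  have hmain : ∀ L : ℂ →L[ℝ] ℝ, ∫ x, ψ x * (L ((∂_{stdVec j} g) x) : ℂ) =
      -∫ x, G x j * (L (g x) : ℂ) := fun L => by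
    obtain ⟨h1, h2, h3, h4⟩ := key L
    simpa only [h3] using h.integral_mul_fderiv hψ hG h1 h2 j (by simpa only [h3] using h4)
  have hi1 : ∀ L : ℂ →L[ℝ] ℝ, Integrable (fun x => ψ x * (L ((∂_{stdVec j} g) x) : ℂ)) volume :=
    fun L => hψ.integrable_mul (key L).2.2.2.ofReal
  have hi2 : ∀ L : ℂ →L[ℝ] ℝ, Integrable (fun x => G x j * (L (g x) : ℂ)) volume :=
    fun L => hGj.integrable_mul (key L).2.1.ofReal
  have e : ∀ a z : ℂ, a * z = a * (Complex.reCLM z : ℂ) + Complex.I * (a * (Complex.imCLM z : ℂ)) :=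
    fun a z => by
      conv_lhs => rw [← Complex.re_add_im z]
      simp only [Complex.reCLM_apply, Complex.imCLM_apply]
      ring
  have e1 : (fun x => ψ x * (∂_{stdVec j} g) x) = _ := funext fun _ => e _ _
  have e2 : (fun x => G x j * g x) = _ := funext fun _ => e _ _
  rw [e1, e2, integral_add (hi1 _) ((hi1 _).const_mul _),
    integral_add (hi2 _) ((hi2 _).const_mul _), integral_const_mul, integral_const_mul,
    hmain, hmain]
  ring

/-- The weak gradient is the gradient of the tempered distribution. -/
theorem HasWeakGradR3.lineDerivOp_toLp {ψ : R3 → ℂ} {G : R3 → C3} (h : HasWeakGradR3 ψ G)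
    (hψ : MemLp ψ 2 volume) (hG : MemLp G 2 volume) (j : Fin 3) :
    ∂_{stdVec j} (hψ.toLp ψ : 𝓢'(R3, ℂ)) = ((memLp_coord hG j).toLp : 𝓢'(R3, ℂ)) := by
  ext g
  rw [TemperedDistribution.lineDerivOp_apply_apply, Lp.toTemperedDistribution_apply,
    Lp.toTemperedDistribution_apply]
  have e1 : ∫ x, (-∂_{stdVec j} g) x • (hψ.toLp ψ) x = -∫ x, ψ x * (∂_{stdVec j} g) x := by
    rw [← integral_neg]
    refine integral_congr_ae ?_
    filter_upwards [hψ.coeFn_toLp] with x hx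
    rw [hx, neg_apply, smul_eq_mul]
    ring
  have e2 : ∫ x, g x • ((memLp_coord hG j).toLp) x = ∫ x, G x j * g x := by
    refine integral_congr_ae ?_
    filter_upwards [(memLp_coord hG j).coeFn_toLp] with x hx
    rw [hx, smul_eq_mul, mul_comm]
  rw [e1, e2, h.integral_mul_lineDerivOp hψ hG, neg_neg]

/-- The Bessel potential of order two is `1 - Δ / (2π)²`, in the normalization of the Fourier
transform with `2π` in the exponent. -/
theorem besselPotential_two (f : 𝓢'(R3, ℂ)) :
    TemperedDistribution.besselPotential R3 ℂ 2 f = f + (-((2 * Real.pi) ^ 2)⁻¹ : ℝ) • Δ f := by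
  have hc : (2 * Real.pi) ^ 2 ≠ 0 := by positivity
  have h1 : TemperedDistribution.besselPotential R3 ℂ 2 f =
      TemperedDistribution.fourierMultiplierCLM ℂ (fun _ : R3 => (1 : ℂ)) f +
      TemperedDistribution.fourierMultiplierCLM ℂ (fun x : R3 => ((‖x‖ ^ 2 : ℝ) : ℂ)) f := by
    have h2 := TemperedDistribution.fourierMultiplierCLM_sum (F := ℂ) (s := Finset.univ)
      (g := ![fun _ : R3 => (1 : ℂ), fun x : R3 => ((‖x‖ ^ 2 : ℝ) : ℂ)]) (by
        intro i _
        fin_cases i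
        · exact Function.HasTemperateGrowth.const 1
        · simp only [Fin.mk_one, Matrix.cons_val_one, Matrix.cons_val_zero]
          fun_prop)
    have h3 := DFunLike.congr_fun h2 f
    simp only [Fin.sum_univ_two, Matrix.cons_val_zero, Matrix.cons_val_one,
      add_apply] at h3
    rw [← h3, TemperedDistribution.besselPotential]
    congr 2
    ext x
    simp
  rw [h1, TemperedDistribution.laplacian_eq_fourierMultiplierCLM,
    TemperedDistribution.fourierMultiplierCLM_const, smul_smul]
  simp [hc]

/-- A square integrable function with square integrable weak gradient is in `H¹`. With
`f` and its first derivatives in `H⁰`, both `f` and `Δ f` are in `H⁻¹`, whence so is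
`(1 - Δ / (2π)²) f`. -/
theorem HasWeakGradR3.memH1 {ψ : R3 → ℂ} {G : R3 → C3} (h : HasWeakGradR3 ψ G)
    (hψ : MemLp ψ 2 volume) (hG : MemLp G 2 volume) : MemH1 ψ := by
  refine ⟨hψ, ?_⟩
  set f : 𝓢'(R3, ℂ) := (hψ.toLp ψ : 𝓢'(R3, ℂ)) with hf
  have hd : ∀ j, TemperedDistribution.MemSobolev 0 2 (∂_{(stdVec j : R3)} f) := fun j =>
    TemperedDistribution.memSobolev_zero_iff.2 ⟨_, h.lineDerivOp_toLp hψ hG j⟩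
  have hdd : ∀ j, TemperedDistribution.MemSobolev (-1) 2
      (∂_{(stdVec j : R3)} (∂_{(stdVec j : R3)} f)) := fun j => by
    simpa using (hd j).lineDerivOp (m := (stdVec j : R3))
  have hΔ : TemperedDistribution.MemSobolev (-1) 2 (Δ f) := by
    rw [TemperedDistribution.laplacian_eq_sum (EuclideanSpace.basisFun (Fin 3) ℝ),
      Fin.sum_univ_three]
    simp only [EuclideanSpace.basisFun_apply]
    exact ((hdd 0).add (hdd 1)).add (hdd 2)
  have hf0 : TemperedDistribution.MemSobolev 0 2 f :=
    TemperedDistribution.memSobolev_zero_iff.2 ⟨_, rfl⟩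
  have hb : TemperedDistribution.MemSobolev (-1) 2
      (TemperedDistribution.besselPotential R3 ℂ 2 f) := by
    rw [besselPotential_two]
    exact (hf0.mono (by norm_num)).add (hΔ.smul ((-((2 * Real.pi) ^ 2)⁻¹ : ℝ) : ℂ))
  have := TemperedDistribution.memSobolev_besselPotential_iff.1 hb
  norm_num at this
  exact this

end MSF

end

theorem mainTheorem9 (D : MSF.CylinderData) (hD : D.IsFiniteEnergy) (R : ℝ) (hR : 0 < R) :
    (∃ ξ : MSF.R3 → ℝ, MSF.IsModifier R ξ) ∧
    ∀ ξ : MSF.R3 → ℝ, MSF.IsModifier R ξ →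
      -- the modified data are finite energy Minkowski data; in particular they lie in `L²` and
      -- satisfy the two divergence constraints
      (D.induced.modify ξ).IsFiniteEnergy ∧
      -- the Maxwell data are unchanged, and all the data are unchanged on the ball of radius `R`
      (D.induced.modify ξ).E = D.induced.E ∧
      (D.induced.modify ξ).B = D.induced.B ∧
      (∀ x : MSF.R3, ‖x‖ ≤ R →
        (D.induced.modify ξ).U0 x = D.induced.U0 x ∧
        (D.induced.modify ξ).U x = D.induced.U x ∧
        (D.induced.modify ξ).φ x = D.induced.φ x) ∧
      -- with respect to any initial potential of the cylinder data
      (∀ a : MSF.S3 → MSF.R4, D.IsPotential a →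
        MSF.HasWeakCurlR3 (MSF.pull a) (D.induced.modify ξ).B ∧
        (D.induced.modify ξ).HasPotential (MSF.pull a) ∧
        -- in the gauge in which the induced potential on `ℝ³` is divergence free
        (MSF.HasWeakDivR3 (MSF.pull a) (fun _ => 0) →
          MSF.MemH1 (D.induced.modify ξ).φ)) := by
  refine ⟨MSF.exists_isModifier hR, fun ξ hξ => ?_⟩
  have hfe := MSF.isFiniteEnergy_modify hD hξ
  refine ⟨hfe, rfl, rfl, fun x hx => MSF.modify_eq_induced hξ hR hx, fun a ha => ?_⟩
  have hcurl : MSF.HasWeakCurlR3 (MSF.pull a) (D.induced.modify ξ).B := by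
    rw [MSF.modify_B_eq]
    exact ha.curl_eq.pull ha.tangent
  have hpot := MSF.hasPotential_modify hD hξ ha
  refine ⟨hcurl, hpot, fun hdiv => ?_⟩
  have ha6 : MemLp (MSF.pull a) 6 volume := MSF.memLp_six_of_curl hcurl hdiv hfe.memLp_B
    (MSF.memLp_sqrt_lam_smul_pull ha.memLp)
  have htoC : MemLp (fun x => MSF.toC (MSF.pull a x)) 6 volume :=
    ha6.of_le (MSF.continuous_toC.comp_aestronglyMeasurable ha6.1)
      (Filter.Eventually.of_forall fun x => (MSF.norm_toC _).le)
  have hW : MemLp (fun x => Complex.I • MSF.toC (MSF.pull a x)) 6 volume :=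
    htoC.const_smul Complex.I
  have hgrad : MSF.HasWeakGradR3 (D.induced.modify ξ).φ fun x => (D.induced.modify ξ).U x -
      (D.induced.modify ξ).φ x • Complex.I • MSF.toC (MSF.pull a x) := by
    have e : (fun x => (D.induced.modify ξ).U x -
        (D.induced.modify ξ).φ x • Complex.I • MSF.toC (MSF.pull a x)) = fun x =>
        WithLp.toLp 2 fun k => (D.induced.modify ξ).U x k -
          Complex.I * (MSF.pull a x k : ℂ) * (D.induced.modify ξ).φ x := by
      ext x k
      simp only [PiLp.sub_apply, PiLp.smul_apply, smul_eq_mul, MSF.toC_apply]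
      ring
    rw [e]
    exact hpot
  exact hgrad.memH1 hfe.memLp_φ (hgrad.memLp_two hfe.memLp_φ hfe.memLp_U hW)
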